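/- Let $\lambda$ be a smooth contact form on $S^3$, oriented by $\lambda\wedge d\lambda$, with Reeb vector field $X$, Reeb flow $\phi^t$ and contact structure $\xi=\ker\lambda$. Let $\gamma_0$ be a periodic Reeb orbit, oriented by the flow, which is unknotted and has self-linking number $-1$. A disk-like global surface of section spanned by $\gamma_0$ is a smoothly embedded closed disk $\Sigma\subset S^3$ with $\partial\Sigma=\gamma_0$, whose interior is transverse to $X$, and such that for every $x\in S^3$ there are $t_-<0<t_+$ with $\phi^{t_\pm}(x)\in\Sigma$. It is called $\partial$-strong if the closed curve formed by the outward pointing directions of $T\Sigma$ along $\gamma_0$, taken modulo $\mathbb{R}X$, is a global surface of section for the flow induced by $D\phi^t$ on the torus of oriented directions of $TS^3/\mathbb{R}X\simeq\xi$ over $\gamma_0$ (that is, this curve is transverse to that flow and every trajectory on the torus meets it in the future and in the past). Fix a global symplectic trivialisation $\sigma$ of $(\xi,d\lambda)$. For $0\neq u\in\xi_x$ let $t\mapsto\widetilde\Theta_\sigma(t,u)\in\mathbb{R}$ be a continuous lift of the angle of $D\phi^t u$ in the trivialisation $\sigma$. Given a $\partial$-strong disk-like global surface of section $\Sigma$ spanned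 by $\gamma_0$, put, for $x\in S^3\setminus\gamma_0$, $$t_+^\Sigma(x)=\inf\{t\ge 0 \mid \phi^t(x)\in\Sigma\},\qquad t_-^\Sigma(x)=\sup\{t\le 0\mid \phi^t(x)\in\Sigma\},$$ and for $T>0$ let $k(T,x;\Sigma)\subset S^3\setminus\gamma_0$ be any loop obtained by concatenating to the piece of trajectory $\phi^{[t_-^\Sigma(x),\,T+t_+^\Sigma(\phi^T(x))]}(x)$ a path in $\Sigma\setminus\gamma_0$ from its end point to its initial point. Define $$\kappa(\gamma_0;\Sigma,\sigma)=\liminf_{T\to+\infty}\ \inf_{x,u}\ \frac{\widetilde\Theta_\sigma(T,u)-\widetilde\Theta_\sigma(0,u)}{\mathrm{link}(k(T,x;\Sigma),\gamma_0)}\in[-\infty,+\infty],$$ where the infimum is over all $x\in S^3\setminus\gamma_0$ and all $0\neq u\in\xi_x$. Then $\kappa(\gamma_0;\Sigma,\sigma)$ does not depend on $\Sigma$: if $\Sigma$ and $\hat\Sigma$ are $\partial$-strong disk-like global surfaces of section spanned by $\gamma_0$, then $\kappa(\gamma_0;\Sigma,\sigma)=\kappa(\gamma_0;\hat\Sigma,\sigma)$.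 -/

import Mathlib

open Filter Topology
open scoped ContDiff

noncomputable section

/-- The ambient Euclidean space `ℝ⁴`. -/
abbrev E4 : Type := EuclideanSpace ℝ (Fin 4)

/-- The unit sphere `S³ ⊆ ℝ⁴`. -/
def S3 : Set E4 := Metric.sphere 0 1

/-- `v` is tangent to `S³` at `x`. -/
def IsTangentS3 (x v : E4) : Prop := inner ℝ x v = 0

/-- Radial projection of `ℝ⁴ ∖ {0}` onto `S³`. -/
def radialProj (y : E4) : E4 := ‖y‖⁻¹ • y

/-! ### Contact forms on the three-sphere

A smooth differential form (or vector field, or map) on a closed submanifold of a Euclidean space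
is the restriction of a smooth one defined on the whole space. Accordingly one-forms on `S³` are
given by smooth maps `lam : ℝ⁴ → (ℝ⁴)*`; only the restrictions to tangent vectors of `S³` enter. -/

/-- The exterior derivative `d lam` at `x`, evaluated on `v, w`. -/
def extD (lam : E4 → E4 →L[ℝ] ℝ) (x v w : E4) : ℝ :=
  fderiv ℝ lam x v w - fderiv ℝ lam x w v

/-- The three-form `lam ∧ d lam` at `x`, evaluated on `u, v, w`. -/
def contactVol (lam : E4 → E4 →L[ℝ] ℝ) (x u v w : E4) : ℝ :=
  lam x u * extD lam x v w + lam x v * extD lam x w u + lam x w * extD lam x u v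

/-- `lam` restricts to a smooth contact form on `S³`: the three-form `lam ∧ d lam` does not vanish
at any point of `S³`. The sphere is oriented by this three-form. -/
structure IsContactForm (lam : E4 → E4 →L[ℝ] ℝ) : Prop where
  smooth : ContDiff ℝ ∞ lam
  nondegenerate : ∀ x ∈ S3, ∃ u v w : E4, IsTangentS3 x u ∧ IsTangentS3 x v ∧ IsTangentS3 x w ∧
    contactVol lam x u v w ≠ 0

/-- `u` lies in the contact plane `ξ_x = ker lam_x ⊆ T_x S³`. -/
def InContactPlane (lam : E4 → E4 →L[ℝ] ℝ) (x u : E4) : Prop :=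
  IsTangentS3 x u ∧ lam x u = 0

/-! ### The Reeb flow -/

/-- `v ∈ T_x S³` satisfies `lam(v) = 1` and `i_v d lam = 0`. -/
def IsReebVector (lam : E4 → E4 →L[ℝ] ℝ) (x v : E4) : Prop :=
  IsTangentS3 x v ∧ lam x v = 1 ∧ ∀ w, IsTangentS3 x w → extD lam x v w = 0

open Classical in
/-- The Reeb vector field `X` of `lam` on `S³`. -/
def reebField (lam : E4 → E4 →L[ℝ] ℝ) (x : E4) : E4 :=
  if h : ∃ v, IsReebVector lam x v then h.choose else 0

/-- `c` is a trajectory of the Reeb vector field on `S³`, defined for all times. -/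
def IsReebTrajectory (lam : E4 → E4 →L[ℝ] ℝ) (c : ℝ → E4) : Prop :=
  ∀ t, c t ∈ S3 ∧ HasDerivAt c (reebField lam (c t)) t

open Classical in
/-- The Reeb flow `φ^t(x)` on `S³`. -/
def reebFlow (lam : E4 → E4 →L[ℝ] ℝ) (t : ℝ) (x : E4) : E4 :=
  if h : ∃ c, IsReebTrajectory lam c ∧ c 0 = x then h.choose t else x

/-- The linearised Reeb flow `Dφ^t(x) u` for `x ∈ S³` and `u ∈ T_x S³`, computed with the
degree-zero homogeneous extension of `φ^t` to a neighbourhood of `S³`. -/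
def linReebFlow (lam : E4 → E4 →L[ℝ] ℝ) (t : ℝ) (x u : E4) : E4 :=
  fderiv ℝ (fun y => reebFlow lam t (radialProj y)) x u

/-- `γ` is a periodic Reeb orbit, parametrised by the flow, of primitive period `T₀`. -/
structure IsPeriodicReebOrbit (lam : E4 → E4 →L[ℝ] ℝ) (γ : ℝ → E4) (T₀ : ℝ) : Prop where
  trajectory : IsReebTrajectory lam γ
  period_pos : 0 < T₀
  periodic : Function.Periodic γ T₀
  primitive : Set.InjOn γ (Set.Ico 0 T₀)

/-! ### Angular variation and linking numbers -/

/-- `f` is a continuous argument of the nowhere vanishing path `z` on `[a, b]`. -/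
def IsAngleLift (z : ℝ → ℂ) (a b : ℝ) (f : ℝ → ℝ) : Prop :=
  ContinuousOn f (Set.Icc a b) ∧
    ∀ t ∈ Set.Icc a b, z t ≠ 0 ∧ z t = (‖z t‖ : ℂ) * Complex.exp ((f t : ℂ) * Complex.I)

open Classical in
/-- The total variation `f b - f a` of a continuous argument `f` of the continuous nowhere
vanishing path `z : [a, b] → ℂ`. It does not depend on the choice of `f`. -/
def angleVariation (z : ℝ → ℂ) (a b : ℝ) : ℝ :=
  if h : ∃ f, IsAngleLift z a b f then h.choose b - h.choose a else 0

/-- `θ` is a continuous map `S³ ∖ γ → ℂ ∖ {0}` that winds once around the origin along every small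
positively oriented meridian of `γ`. A small meridian is the boundary of a small disk through `γ t`
spanned by `e₁, e₂`; it is positive if `(γ'(t), e₁, e₂)` is an oriented basis with respect to
`lam ∧ d lam`. Up to homotopy `θ` represents the class in `H¹(S³ ∖ γ; ℤ) = [S³ ∖ γ, S¹]` that is
Alexander dual to the oriented knot `γ`, equivalently the class dual to an oriented Seifert
surface of `γ`. -/
def IsSeifertClass (lam : E4 → E4 →L[ℝ] ℝ) (γ : ℝ → E4) (θ : E4 → ℂ) : Prop :=
  ContinuousOn θ (S3 \ Set.range γ) ∧ (∀ x ∈ S3 \ Set.range γ, θ x ≠ 0) ∧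
    ∀ (t : ℝ) (e₁ e₂ : E4), IsTangentS3 (γ t) e₁ → IsTangentS3 (γ t) e₂ →
      0 < contactVol lam (γ t) (deriv γ t) e₁ e₂ →
      ∀ᶠ ε : ℝ in 𝓝[>] 0,
        angleVariation
          (fun s => θ (radialProj (γ t + ε • (Real.cos s • e₁ + Real.sin s • e₂))))
          0 (2 * Real.pi) = 2 * Real.pi

open Classical in
/-- The linking number `link(k, γ)` of the oriented knot `γ` with a loop `k : [a, b] → S³ ∖ γ`,
`k a = k b`: the value on `k` of the class in `H¹(S³ ∖ γ; ℤ)` dual to `γ`. It does not depend on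
the choice of the map representing this class. The sphere is oriented by `lam ∧ d lam`. -/
def linkingNumber (lam : E4 → E4 →L[ℝ] ℝ) (γ k : ℝ → E4) (a b : ℝ) : ℝ :=
  if h : ∃ θ, IsSeifertClass lam γ θ then
    angleVariation (fun s => h.choose (k s)) a b / (2 * Real.pi)
  else 0

/-- The transverse knot `γ` of period `T₀` has self-linking number `n`: if `Z` is a nowhere
vanishing section of the contact structure on `S³` (in particular on a Seifert surface of `γ`),
then `γ` pushed slightly in the direction of `Z` has linking number `n` with `γ`. -/
def HasSelfLinkingNumber (lam : E4 → E4 →L[ℝ] ℝ) (γ : ℝ → E4) (T₀ : ℝ) (n : ℤ) : Prop :=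
  ∃ Z : E4 → E4, ContDiff ℝ ∞ Z ∧ (∀ x ∈ S3, InContactPlane lam x (Z x) ∧ Z x ≠ 0) ∧
    ∀ᶠ ε : ℝ in 𝓝[>] 0,
      linkingNumber lam γ (fun s => radialProj (γ s + ε • Z (γ s))) 0 T₀ = n

/-! ### Disk-like global surfaces of section -/

/-- `f` restricts to a smooth embedding of the closed unit disk of `ℂ` into `S³`. -/
structure IsEmbeddedDisk (f : ℂ → E4) : Prop where
  smooth : ContDiff ℝ ∞ f
  mapsTo : Set.MapsTo f (Metric.closedBall 0 1) S3
  injOn : Set.InjOn f (Metric.closedBall 0 1)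
  immersion : ∀ z ∈ Metric.closedBall (0 : ℂ) 1, Function.Injective (fderiv ℝ f z)

/-- The embedded disk, as a subset of `S³`. -/
def diskImage (f : ℂ → E4) : Set E4 := f '' Metric.closedBall 0 1

/-- The knot `γ` is unknotted: it bounds a smoothly embedded disk in `S³`. -/
def IsUnknotted (γ : ℝ → E4) : Prop :=
  ∃ f : ℂ → E4, IsEmbeddedDisk f ∧ f '' Metric.sphere 0 1 = Set.range γ

/-- The embedded disk `f` is a disk-like global surface of section for the Reeb flow of `lam`,
spanned by the periodic orbit `γ`. -/
structure IsDiskGSS (lam : E4 → E4 →L[ℝ] ℝ) (γ : ℝ → E4) (f : ℂ → E4) : Prop where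
  embedded : IsEmbeddedDisk f
  boundary : f '' Metric.sphere 0 1 = Set.range γ
  transverse : ∀ z ∈ Metric.ball (0 : ℂ) 1, reebField lam (f z) ∉ Set.range (fderiv ℝ f z)
  forward_hit : ∀ x ∈ S3, ∃ t > 0, reebFlow lam t x ∈ diskImage f
  backward_hit : ∀ x ∈ S3, ∃ t < 0, reebFlow lam t x ∈ diskImage f

/-- The outward pointing vector of the disk `f` at the boundary point `f z`, `|z| = 1`. -/
def outwardNormal (f : ℂ → E4) (z : ℂ) : E4 := fderiv ℝ f z z

/-- At time `t` the linearised polar trajectory through the direction of `u ∈ ξ_x` meets the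
curve of outward pointing directions of the disk `f`: modulo `ℝ X`, the vector `Dφ^t(x) u` is a
positive multiple of an outward pointing vector. -/
def PolarHit (lam : E4 → E4 →L[ℝ] ℝ) (f : ℂ → E4) (x u : E4) (t : ℝ) : Prop :=
  ∃ w ∈ Metric.sphere (0 : ℂ) 1, reebFlow lam t x = f w ∧ ∃ a b : ℝ, 0 < a ∧
    linReebFlow lam t x u = a • outwardNormal f w + b • reebField lam (f w)

/-- The disk-like global surface of section `f` is `∂`-strong: the closed curve `ν` of outward
pointing directions modulo `ℝ X`, in the torus of oriented directions of `TS³ / ℝ X` along the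
boundary orbit, is a global surface of section for the linearised polar dynamics on that torus.

`transverse`: the curve `ν` is transverse to the generating vector field. If
`s ↦ w s` is the lift to the unit circle of the boundary orbit, both `s ↦ Dφ^s ν(w 0)` and
`s ↦ ν(w s)` lie over the point `φ^s(f (w 0))`, so this says that the oriented area spanned by
them (measured by `d lam`, which vanishes on `X`) has non-zero derivative at `s = 0`.
`forward_hit`, `backward_hit`: every trajectory meets `ν` in the future and in the past. -/
structure IsBoundaryStrong (lam : E4 → E4 →L[ℝ] ℝ) (f : ℂ → E4) : Prop where
  transverse : ∀ w : ℝ → ℂ,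
    (∀ s, w s ∈ Metric.sphere (0 : ℂ) 1 ∧ f (w s) = reebFlow lam s (f (w 0))) →
    deriv (fun s => extD lam (f (w s)) (linReebFlow lam s (f (w 0)) (outwardNormal f (w 0)))
      (outwardNormal f (w s))) 0 ≠ 0
  forward_hit : ∀ z ∈ Metric.sphere (0 : ℂ) 1, ∀ u, InContactPlane lam (f z) u → u ≠ 0 →
    ∃ t > 0, PolarHit lam f (f z) u t
  backward_hit : ∀ z ∈ Metric.sphere (0 : ℂ) 1, ∀ u, InContactPlane lam (f z) u → u ≠ 0 →
    ∃ t < 0, PolarHit lam f (f z) u t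

/-! ### The number `κ` -/

/-- `(Z₁, Z₂)` is a smooth global symplectic frame of `(ξ, d lam)` on `S³`. -/
structure IsSymplecticFrame (lam : E4 → E4 →L[ℝ] ℝ) (Z₁ Z₂ : E4 → E4) : Prop where
  smooth₁ : ContDiff ℝ ∞ Z₁
  smooth₂ : ContDiff ℝ ∞ Z₂
  mem₁ : ∀ x ∈ S3, InContactPlane lam x (Z₁ x)
  mem₂ : ∀ x ∈ S3, InContactPlane lam x (Z₂ x)
  symplectic : ∀ x ∈ S3, extD lam x (Z₁ x) (Z₂ x) = 1

/-- The coordinate `a + i b` of the vector `u = a Z₁ + b Z₂` of `ξ_x`. Its argument is the angular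
coordinate `Θ_σ` of the direction of `u` in the trivialisation `σ` given by the frame. -/
def frameCoord (lam : E4 → E4 →L[ℝ] ℝ) (Z₁ Z₂ : E4 → E4) (x u : E4) : ℂ :=
  ⟨extD lam x u (Z₂ x), extD lam x (Z₁ x) u⟩

/-- `t₊(x)`, the first non-negative time at which the trajectory of `x` is in `S`. -/
def hitTimePos (lam : E4 → E4 →L[ℝ] ℝ) (S : Set E4) (x : E4) : ℝ :=
  sInf {t : ℝ | 0 ≤ t ∧ reebFlow lam t x ∈ S}

/-- `t₋(x)`, the last non-positive time at which the trajectory of `x` is in `S`. -/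
def hitTimeNeg (lam : E4 → E4 →L[ℝ] ℝ) (S : Set E4) (x : E4) : ℝ :=
  sSup {t : ℝ | t ≤ 0 ∧ reebFlow lam t x ∈ S}

/-- The right end point `T + t₊(φ^T(x))` of the interval `I(T, x; S)`, whose left end point is
`t₋(x)`. -/
def closingTime (lam : E4 → E4 →L[ℝ] ℝ) (S : Set E4) (T : ℝ) (x : E4) : ℝ :=
  T + hitTimePos lam S (reebFlow lam T x)

/-- `k`, on the interval `[t₋(x), T + t₊(φ^T(x)) + 1]`, is a loop `k(T, x; S)`: it follows the
trajectory of `x` on `I(T, x; S)`, and then a path in `S ∖ γ` back to the initial point. -/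
structure IsClosedUpTrajectory (lam : E4 → E4 →L[ℝ] ℝ) (γ : ℝ → E4) (S : Set E4) (T : ℝ) (x : E4)
    (k : ℝ → E4) : Prop where
  continuousOn : ContinuousOn k (Set.Icc (hitTimeNeg lam S x) (closingTime lam S T x + 1))
  trajectory : ∀ t ∈ Set.Icc (hitTimeNeg lam S x) (closingTime lam S T x), k t = reebFlow lam t x
  inSection : ∀ t ∈ Set.Icc (closingTime lam S T x) (closingTime lam S T x + 1),
    k t ∈ S \ Set.range γ
  closed : k (closingTime lam S T x + 1) = k (hitTimeNeg lam S x)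

/-- The number `κ`, computed with the global surface of section `S` spanned by `γ` and the global
symplectic frame `(Z₁, Z₂)`: the limit inferior as `T → +∞` of the infimum, over `x ∈ S³ ∖ γ`, over
the directions of `u ∈ ξ_x ∖ {0}` and over the loops `k = k(T, x; S)`, of the ratio of the angular
variation of `Dφ^t u` for `t ∈ [0, T]` by `link(k, γ)`. The ratio does not depend on the
choice of `k`. The value is in `[-∞, +∞]`. -/
def kappa (lam : E4 → E4 →L[ℝ] ℝ) (γ : ℝ → E4) (Z₁ Z₂ : E4 → E4) (S : Set E4) : EReal :=
  liminf (fun T : ℝ => sInf {r : EReal | ∃ x u : E4, ∃ k : ℝ → E4,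
    x ∈ S3 \ Set.range γ ∧ InContactPlane lam x u ∧ u ≠ 0 ∧ IsClosedUpTrajectory lam γ S T x k ∧
    r = ((angleVariation
        (fun t => frameCoord lam Z₁ Z₂ (reebFlow lam t x) (linReebFlow lam t x u)) 0 T /
      linkingNumber lam γ k (hitTimeNeg lam S x) (closingTime lam S T x + 1) : ℝ) : EReal)}) atTop

end

noncomputable section

/-! ### Transverse pages of a flow and lifted arguments -/

section Pages

variable {M : Type*} [TopologicalSpace M]

/-! The numerator in `kappa` does not involve the disk; only the linking number does. So it is
enough that the linking numbers obtained from two disks have a ratio tending to `1` as `T → ∞`,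
uniformly in the starting point. This holds because they differ by a bounded amount while each grows
linearly in `T`. `liminf_sInf_div_le` turns this into equality of the two lower limits.

On `M = S³ ∖ γ` the linking number is the winding of a circle-valued map `ϑ`, the normalised Seifert
class. The open disk is simply connected, so `ϑ` has a continuous argument `h` on it. Transporting
`h` back along the flow from a hit of the disk at time `a` gives an argument `liftedArg` of `ϑ x`.
The linking number of a closed-up trajectory is then, up to sign and `2π`, the difference of the
lifted arguments at its last and first hits (`linkingNumber_closedUp`).

Boundedness (`exists_winding_bound`): lifted arguments coming from two disks are both arguments of
`ϑ x`, so they differ by a multiple of `2π`. This difference is locally constant in `x` as long as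
the hits persist, so a compactness argument bounds it for hit times in a bounded window. Growth
(`exists_winding_growth`): return times are bounded, and the jump of the lifted argument from one
hit to the next is one constant `j` because the disk is connected. If `j` were `0`, `ϑ` would have a
global argument on `M`, which is impossible since it winds once around a meridian.

Both steps need compactness, and `M` is not compact. It is compactified by blowing up `γ`: the ideal
points are the directions of the contact plane at `γ 0`, encoded as filters on `M` (`complFilters`),
and every point of `M` is reached from finitely many of the corresponding sets in bounded time
(`isCompactFamily_complFilters`). At ideal points, transversality to the disk and the existence of
hits come from the linearised flow and are what `∂`-strong provides (`isTransverseAt_polarFilter`).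
-/

/-- Homotopy lifting along `s ↦ ϑ (φ (s t) x) / ϑ x`, which is constant at `s = 0`. Treating `(x,
t)` as the parameter makes the lift jointly continuous. -/
theorem exists_flow_lift (φ : Flow ℝ M) (ϑ : C(M, Circle)) :
    ∃ V : C(M × ℝ, ℝ), (∀ x, V (x, 0) = 0) ∧ ∀ x t, Circle.exp (V (x, t)) = ϑ (φ t x) / ϑ x := by
  let H : C(unitInterval × (M × ℝ), Circle) :=
    ⟨fun p => ϑ (φ ((p.1 : ℝ) * p.2.2) p.2.1) / ϑ p.2.1, by
      refine Continuous.div' ?_ (by fun_prop)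
      exact ϑ.continuous.comp (φ.continuous (by fun_prop) (by fun_prop))⟩
  have H0 : ∀ a : M × ℝ, H (0, a) = Circle.exp ((ContinuousMap.const (M × ℝ) (0 : ℝ)) a) := by
    intro a
    simp [H]
  let L := Circle.isCoveringMap_exp.liftHomotopy H (ContinuousMap.const (M × ℝ) (0 : ℝ)) H0
  have hL : ∀ p, Circle.exp (L p) = H p := fun p =>
    congr_fun (Circle.isCoveringMap_exp.liftHomotopy_lifts H _ H0) p
  have hL0 : ∀ a, L (0, a) = 0 := Circle.isCoveringMap_exp.liftHomotopy_zero H _ H0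
  refine ⟨⟨fun q => L (1, q), by fun_prop⟩, fun x => ?_, fun x t => ?_⟩
  · have hc : Continuous fun s : unitInterval => L (s, (x, (0 : ℝ))) := by fun_prop
    have := Circle.isCoveringMap_exp.const_of_comp hc (fun a a' => ?_) 1 0
    · simpa [hL0] using this
    · simp [hL, H]
  · simp [hL, H]

/-- The variation of the argument of `ϑ` along the trajectory of `x` on `[0, t]`. -/
def flowVariation (φ : Flow ℝ M) (ϑ : C(M, Circle)) : C(M × ℝ, ℝ) :=
  (exists_flow_lift φ ϑ).choose

variable {φ : Flow ℝ M} {ϑ : C(M, Circle)}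

theorem flowVariation_zero (x : M) : flowVariation φ ϑ (x, 0) = 0 :=
  (exists_flow_lift φ ϑ).choose_spec.1 x

theorem exp_flowVariation (x : M) (t : ℝ) :
    Circle.exp (flowVariation φ ϑ (x, t)) = ϑ (φ t x) / ϑ x :=
  (exists_flow_lift φ ϑ).choose_spec.2 x t

theorem flowVariation_add (x : M) (s t : ℝ) :
    flowVariation φ ϑ (x, s + t) = flowVariation φ ϑ (x, s) + flowVariation φ ϑ (φ s x, t) := by
  have hc : Continuous fun t : ℝ => flowVariation φ ϑ (x, s + t) - flowVariation φ ϑ (x, s)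
      - flowVariation φ ϑ (φ s x, t) := by fun_prop
  have h1 : ∀ t, Circle.exp (flowVariation φ ϑ (x, s + t) - flowVariation φ ϑ (x, s)
      - flowVariation φ ϑ (φ s x, t)) = 1 := by
    intro t
    rw [Circle.exp_sub, Circle.exp_sub, exp_flowVariation, exp_flowVariation, exp_flowVariation,
      add_comm s t, φ.map_add]
    simp
  have := Circle.isCoveringMap_exp.const_of_comp hc (fun a a' => by rw [h1, h1]) t 0
  simp only [add_zero, sub_self, flowVariation_zero] at this
  linarith

/-- The argument of `ϑ x` obtained by transporting the argument `h` on a page back from time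
`a`. -/
def liftedArg (φ : Flow ℝ M) (ϑ : C(M, Circle)) (h : M → ℝ) (x : M) (a : ℝ) : ℝ :=
  h (φ a x) - flowVariation φ ϑ (x, a)

theorem liftedArg_zero (h : M → ℝ) (x : M) : liftedArg φ ϑ h x 0 = h x := by
  simp [liftedArg, flowVariation_zero]

/-- Moving the base point shifts all lifted arguments, for every page, by the same amount. Their
differences therefore depend only on the trajectory and the hits. -/
theorem liftedArg_flow (h : M → ℝ) (x : M) (s a : ℝ) :
    liftedArg φ ϑ h (φ s x) a = liftedArg φ ϑ h x (s + a) + flowVariation φ ϑ (x, s) := by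
  rw [liftedArg, liftedArg, flowVariation_add, ← φ.map_add, add_comm a s]
  ring

/-- A closed connected subset `S` together with a continuous argument `h` of `ϑ` on `S`. -/
structure IsPage (ϑ : C(M, Circle)) (S : Set M) (h : M → ℝ) : Prop where
  isClosed : IsClosed S
  isPreconnected : IsPreconnected S
  continuousOn : ContinuousOn h S
  exp_eq : ∀ x ∈ S, Circle.exp (h x) = ϑ x

/-- Trajectories of points near the filter `F` do not hit `S` at times near `t`. -/
def NoHitAt (φ : Flow ℝ M) (S : Set M) (F : Filter M) (t : ℝ) : Prop :=
  ∃ δ > 0, ∀ᶠ y in F, ∀ s ∈ Set.Icc (t - δ) (t + δ), φ s y ∉ S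

/-- Trajectories of points near the filter `F` hit `S` exactly once at times near `t`. -/
def SimpleHitAt (φ : Flow ℝ M) (S : Set M) (F : Filter M) (t : ℝ) : Prop :=
  ∀ δ₀ > 0, ∃ δ > 0, δ < δ₀ ∧ ∀ᶠ y in F, ∃! s, s ∈ Set.Icc (t - δ) (t + δ) ∧ φ s y ∈ S

/-- Near the filter `F` the flow is transverse to `S`, and its trajectories hit `S` after time `c`
and before time `0`. -/
structure IsTransverseAt (φ : Flow ℝ M) (S : Set M) (c : ℝ) (F : Filter M) : Prop where
  dichotomy : ∀ t, NoHitAt φ S F t ∨ SimpleHitAt φ S F t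
  forward : ∃ t > c, SimpleHitAt φ S F t
  backward : ∃ t < 0, SimpleHitAt φ S F t

/-- A family of filters containing all neighbourhood filters, each having a basis of connected
sets, which is compact up to flowing for times in `[0, c]`. -/
structure IsCompactFamily (φ : Flow ℝ M) (c : ℝ) (G : Set (Filter M)) : Prop where
  conn : ∀ F ∈ G, ∀ U ∈ F, ∃ W ∈ F, W ⊆ U ∧ IsPreconnected W
  nhds_mem : ∀ x, 𝓝 x ∈ G
  cover : ∀ W : Filter M → Set M, (∀ F ∈ G, W F ∈ F) →
    ∃ s : Set (Filter M), s.Finite ∧ s ⊆ G ∧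
      ∀ y, ∃ F ∈ s, ∃ t ∈ Set.Icc 0 c, ∃ w ∈ W F, φ t w = y

theorem eventually_forall_notMem {S : Set M} (hS : IsClosed S) {K : Set ℝ} (hK : IsCompact K)
    {x : M} (hx : ∀ s ∈ K, φ s x ∉ S) : ∀ᶠ y in 𝓝 x, ∀ s ∈ K, φ s y ∉ S := by
  apply hK.eventually_forall_of_forall_eventually
  intro s hs
  have hc : Continuous fun p : M × ℝ => φ p.2 p.1 := φ.continuous continuous_snd continuous_fst
  exact hc.continuousAt.preimage_mem_nhds (hS.isOpen_compl.mem_nhds (by exact hx s hs))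

theorem IsPage.exp_liftedArg {S : Set M} {h : M → ℝ} (hP : IsPage ϑ S h) {x : M} {a : ℝ}
    (ha : φ a x ∈ S) : Circle.exp (liftedArg φ ϑ h x a) = ϑ x := by
  rw [liftedArg, Circle.exp_sub, hP.exp_eq _ ha, exp_flowVariation]
  simp

/-- A locally unique hitting time is continuous. -/
theorem continuousOn_hitTime {S : Set M} (hS : IsClosed S) {U : Set M} {a b : ℝ} {ρ : M → ℝ}
    (hρ : ∀ y ∈ U, ρ y ∈ Set.Icc a b ∧ φ (ρ y) y ∈ S)
    (huniq : ∀ y ∈ U, ∀ s ∈ Set.Icc a b, φ s y ∈ S → s = ρ y) : ContinuousOn ρ U := by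
  intro y₀ hy₀
  rw [ContinuousWithinAt, Metric.tendsto_nhds]
  intro ε hε
  have hK : IsCompact (Set.Icc a b \ Metric.ball (ρ y₀) ε) :=
    isCompact_Icc.diff Metric.isOpen_ball
  have hx : ∀ s ∈ Set.Icc a b \ Metric.ball (ρ y₀) ε, φ s y₀ ∉ S := by
    rintro s ⟨hs, hs'⟩ hmem
    apply hs'
    rw [huniq y₀ hy₀ s hs hmem]
    exact Metric.mem_ball_self hε
  filter_upwards [nhdsWithin_le_nhds (eventually_forall_notMem hS hK hx), self_mem_nhdsWithin]
    with y hy hyU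
  by_contra hcon
  exact hy (ρ y) ⟨(hρ y hyU).1, hcon⟩ (hρ y hyU).2

theorem IsPage.continuousOn_liftedArg {S : Set M} {h : M → ℝ} (hP : IsPage ϑ S h) {U : Set M}
    {ρ : M → ℝ} (hρ : ContinuousOn ρ U) (hmem : ∀ y ∈ U, φ (ρ y) y ∈ S) :
    ContinuousOn (fun y => liftedArg φ ϑ h y (ρ y)) U := by
  have h1 : ContinuousOn (fun y => φ (ρ y) y) U :=
    (φ.continuous continuous_snd continuous_fst : Continuous fun p : M × ℝ => φ p.2 p.1).comp_continuousOn
      (continuousOn_id.prodMk hρ)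
  exact (hP.continuousOn.comp h1 hmem).sub
    ((flowVariation φ ϑ).continuous.comp_continuousOn (continuousOn_id.prodMk hρ))

theorem SimpleHitAt.exists_hitTime {S : Set M} (hS : IsClosed S) {F : Filter M} {t : ℝ}
    (h : SimpleHitAt φ S F t) {δ₀ : ℝ} (hδ₀ : 0 < δ₀) : ∃ δ > 0, δ < δ₀ ∧ ∃ U ∈ F, ∃ ρ : M → ℝ,
      ContinuousOn ρ U ∧ ∀ y ∈ U, ρ y ∈ Set.Icc (t - δ) (t + δ) ∧ φ (ρ y) y ∈ S ∧
        ∀ s ∈ Set.Icc (t - δ) (t + δ), φ s y ∈ S → s = ρ y := by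
  classical
  obtain ⟨δ, hδ, hδ', hev⟩ := h δ₀ hδ₀
  refine ⟨δ, hδ, hδ', _, hev, ?_⟩
  set U := {y | ∃! s, s ∈ Set.Icc (t - δ) (t + δ) ∧ φ s y ∈ S}
  have hU : ∀ y, ∃ s, y ∈ U → (s ∈ Set.Icc (t - δ) (t + δ) ∧ φ s y ∈ S) ∧
      ∀ s', s' ∈ Set.Icc (t - δ) (t + δ) ∧ φ s' y ∈ S → s' = s := by
    intro y
    by_cases hy : y ∈ U
    · obtain ⟨s, hs, hs'⟩ := hy
      exact ⟨s, fun _ => ⟨hs, hs'⟩⟩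
    · exact ⟨0, fun h => absurd h hy⟩
  choose ρ hρ using hU
  refine ⟨ρ, continuousOn_hitTime hS (fun y hy => (hρ y hy).1)
    (fun y hy s hs hm => (hρ y hy).2 s ⟨hs, hm⟩), fun y hy => ⟨(hρ y hy).1.1, (hρ y hy).1.2,
    fun s hs hm => (hρ y hy).2 s ⟨hs, hm⟩⟩⟩

/-! ### Bounds and finiteness for hitting times -/

section Hits

variable {S : Set M} {c : ℝ} {G : Set (Filter M)}

theorem SimpleHitAt.eventually_exists {F : Filter M} {t : ℝ} (h : SimpleHitAt φ S F t) {δ₀ : ℝ}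
    (hδ₀ : 0 < δ₀) : ∀ᶠ y in F, ∃ s ∈ Set.Ioo (t - δ₀) (t + δ₀), φ s y ∈ S := by
  obtain ⟨δ, hδ, hδ', hev⟩ := h δ₀ hδ₀
  filter_upwards [hev] with y hy
  obtain ⟨s, ⟨hs, hs'⟩, -⟩ := hy
  exact ⟨s, ⟨by linarith [hs.1], by linarith [hs.2]⟩, hs'⟩

/-- Hitting times, forwards and backwards, are uniformly bounded. -/
theorem exists_hit_bound (hG : IsCompactFamily φ c G) (hT : ∀ F ∈ G, IsTransverseAt φ S c F) :
    ∃ τ > 0, ∀ y, (∃ t ∈ Set.Ioc 0 τ, φ t y ∈ S) ∧ (∃ t ∈ Set.Ico (-τ) 0, φ t y ∈ S) := by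
  classical
  have key : ∀ F : Filter M, ∃ W : Set M, ∃ A : ℝ, F ∈ G → W ∈ F ∧ ∀ w ∈ W,
      (∃ t, c < t ∧ t ≤ A ∧ φ t w ∈ S) ∧ (∃ t, t < 0 ∧ -A ≤ t ∧ φ t w ∈ S) := by
    intro F
    by_cases hF : F ∈ G
    swap
    · exact ⟨∅, 0, fun h => absurd h hF⟩
    obtain ⟨t₁, ht₁, h₁⟩ := (hT F hF).forward
    obtain ⟨t₂, ht₂, h₂⟩ := (hT F hF).backward
    -- The radius keeps the hit after time `c`. A point `y = φ t w` with `t ≤ c` then still has this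
    -- hit in its own future.
    have e₁ := h₁.eventually_exists (δ₀ := t₁ - c) (by linarith)
    have e₂ := h₂.eventually_exists (δ₀ := -t₂) (by linarith)
    refine ⟨_, max (2 * t₁ - c) (-(2 * t₂)), fun _ => ⟨e₁.and e₂, ?_⟩⟩
    rintro w ⟨⟨s, hs, hs'⟩, ⟨s₂, hs₂, hs₂'⟩⟩
    refine ⟨⟨s, by linarith [hs.1], le_max_of_le_left (by linarith [hs.2]), hs'⟩,
      ⟨s₂, by linarith [hs₂.2], ?_, hs₂'⟩⟩
    have := le_max_right (2 * t₁ - c) (-(2 * t₂))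
    linarith [hs₂.1]
  choose W A hWA using key
  obtain ⟨s, hs, hsG, hcov⟩ := hG.cover W (fun F hF => (hWA F hF).1)
  obtain ⟨B, hB⟩ := (hs.image A).bddAbove
  have hB' : ∀ F ∈ s, A F ≤ B := fun F hF => hB (Set.mem_image_of_mem _ hF)
  refine ⟨|B| + |c| + 1, by positivity, fun y => ?_⟩
  obtain ⟨F, hF, t, ht, w, hw, rfl⟩ := hcov y
  obtain ⟨⟨a, ha, ha', ha''⟩, ⟨b, hb, hb', hb''⟩⟩ := (hWA F (hsG hF)).2 w hw
  have h1 := hB' F hF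
  have h2 := le_abs_self B
  have h3 := le_abs_self c
  refine ⟨⟨a - t, ⟨by linarith [ht.2], by linarith [ht.1, abs_nonneg c]⟩, ?_⟩,
    ⟨b - t, ⟨by linarith [ht.2], by linarith [ht.1]⟩, ?_⟩⟩
  · rw [← φ.map_add]; simpa using ha''
  · rw [← φ.map_add]; simpa using hb''

/-- The dichotomy makes every time have a neighbourhood containing at most one hit of the given
trajectory; compactness of the interval does the rest. -/
theorem finite_hits (hnhds : ∀ x : M, IsTransverseAt φ S c (𝓝 x)) (x : M) (a b : ℝ) :
    {t | t ∈ Set.Icc a b ∧ φ t x ∈ S}.Finite := by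
  have : ∀ K : Set ℝ, IsCompact K → {t | t ∈ K ∧ φ t x ∈ S}.Finite := by
    intro K hK
    refine hK.induction_on (p := fun K => {t | t ∈ K ∧ φ t x ∈ S}.Finite) (by simp)
      (fun s t hst ht => ht.subset fun r hr => ⟨hst hr.1, hr.2⟩)
      (fun s t hs ht => (hs.union ht).subset ?_) ?_
    · rintro r ⟨hr | hr, hr'⟩
      · exact Or.inl ⟨hr, hr'⟩
      · exact Or.inr ⟨hr, hr'⟩
    intro t _
    rcases (hnhds x).dichotomy t with ⟨δ, hδ, hev⟩ | h
    · refine ⟨_, nhdsWithin_le_nhds (Icc_mem_nhds (a := t - δ) (b := t + δ) (by linarith)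
        (by linarith)), ?_⟩
      refine Set.Finite.subset Set.finite_empty ?_
      rintro s ⟨hs, hs'⟩
      exact hev.self_of_nhds s hs hs'
    · obtain ⟨δ, hδ, -, hev⟩ := h 1 one_pos
      refine ⟨_, nhdsWithin_le_nhds (Icc_mem_nhds (a := t - δ) (b := t + δ) (by linarith)
        (by linarith)), ?_⟩
      obtain ⟨s₀, -, hs₀⟩ := hev.self_of_nhds
      refine Set.Finite.subset (Set.finite_singleton s₀) ?_
      rintro s hs
      exact hs₀ s hs
  exact this _ isCompact_Icc

theorem exists_isLeast_hit {S : Set M} (hfin : ∀ x a b, {t | t ∈ Set.Icc a b ∧ φ t x ∈ S}.Finite)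
    {x : M} {P : ℝ → Prop} {m τ : ℝ} (hm : ∀ t, P t → m ≤ t) (hex : P τ ∧ φ τ x ∈ S) :
    ∃ ρ, IsLeast {t | P t ∧ φ t x ∈ S} ρ := by
  have hF : ({t | t ≤ τ ∧ P t ∧ φ t x ∈ S}).Finite :=
    (hfin x m τ).subset fun t ht => ⟨⟨hm t ht.2.1, ht.1⟩, ht.2.2⟩
  obtain ⟨ρ, hρ, hρ'⟩ := Set.exists_min_image _ id hF ⟨τ, le_rfl, hex.1, hex.2⟩
  refine ⟨ρ, hρ.2, fun t ht => ?_⟩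
  rcases le_total t τ with h | h
  · exact hρ' t ⟨h, ht⟩
  · exact hρ.1.trans h

theorem exists_isGreatest_hit {S : Set M}
    (hfin : ∀ x a b, {t | t ∈ Set.Icc a b ∧ φ t x ∈ S}.Finite)
    {x : M} {P : ℝ → Prop} {m τ : ℝ} (hm : ∀ t, P t → t ≤ m) (hex : P τ ∧ φ τ x ∈ S) :
    ∃ ρ, IsGreatest {t | P t ∧ φ t x ∈ S} ρ := by
  have hF : ({t | τ ≤ t ∧ P t ∧ φ t x ∈ S}).Finite :=
    (hfin x τ m).subset fun t ht => ⟨⟨ht.1, hm t ht.2.1⟩, ht.2.2⟩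
  obtain ⟨ρ, hρ, hρ'⟩ := Set.exists_max_image _ id hF ⟨τ, le_rfl, hex.1, hex.2⟩
  refine ⟨ρ, hρ.2, fun t ht => ?_⟩
  rcases le_total t τ with h | h
  · exact h.trans hρ.1
  · exact hρ' t ⟨h, ht⟩

end Hits

/-! ### The constant jump of the lifted argument between consecutive hits -/

section Jump

variable {S : Set M} {c : ℝ} {h : M → ℝ}

/-- The increment of the lifted argument between consecutive hits is constant. -/
theorem exists_jump (hP : IsPage ϑ S h) (hnhds : ∀ x : M, IsTransverseAt φ S c (𝓝 x))
    (hex : ∀ x, ∃ t > 0, φ t x ∈ S) :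
    ∃ j : ℝ, ∀ x ∈ S, ∀ ρ, IsLeast {t | 0 < t ∧ φ t x ∈ S} ρ → liftedArg φ ϑ h x ρ - h x = j := by
  have hleast : ∀ x, ∃ ρ, IsLeast {t | 0 < t ∧ φ t x ∈ S} ρ := fun x => by
    obtain ⟨t, ht, ht'⟩ := hex x
    exact exists_isLeast_hit (finite_hits hnhds) (P := fun t => 0 < t) (m := 0)
      (fun t ht => le_of_lt ht) ⟨ht, ht'⟩
  choose ρ hρ using hleast
  -- Continuity of the first return time. Simplicity of the hit at time `0` excludes returns up to
  -- `δ₀`, the tube lemma excludes them on `[δ₀, ρ x₀ - ε]`, and the hit at `ρ x₀` persists.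
  have hcont : ContinuousOn ρ S := by
    intro x₀ hx₀
    rw [ContinuousWithinAt, Metric.tendsto_nhds]
    intro ε hε
    have hpos : 0 < ρ x₀ := (hρ x₀).1.1
    have s0 : SimpleHitAt φ S (𝓝 x₀) 0 := by
      rcases (hnhds x₀).dichotomy 0 with ⟨δ, hδ, hev⟩ | h
      · exact absurd (by simpa using hx₀) (hev.self_of_nhds 0 ⟨by linarith, by linarith⟩)
      · exact h
    have s1 : SimpleHitAt φ S (𝓝 x₀) (ρ x₀) := by
      rcases (hnhds x₀).dichotomy (ρ x₀) with ⟨δ, hδ, hev⟩ | h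
      · exact absurd (hρ x₀).1.2 (hev.self_of_nhds _ ⟨by linarith, by linarith⟩)
      · exact h
    have hm : 0 < min ε (ρ x₀ / 2) := by positivity
    obtain ⟨δ₀, h₀, h₀', e₀⟩ := s0 (min ε (ρ x₀ / 2)) hm
    have e₁ := s1.eventually_exists hm
    have hK : ∀ s ∈ Set.Icc δ₀ (ρ x₀ - ε), φ s x₀ ∉ S := fun s hs hs' => by
      have := (hρ x₀).2 ⟨lt_of_lt_of_le h₀ hs.1, hs'⟩
      linarith [hs.2]
    have e₂ := eventually_forall_notMem hP.isClosed isCompact_Icc hK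
    filter_upwards [nhdsWithin_le_nhds e₀, nhdsWithin_le_nhds e₁, nhdsWithin_le_nhds e₂,
      self_mem_nhdsWithin] with y y₀ y₁ y₂ hyS
    obtain ⟨s₀, -, hs₀⟩ := y₀
    have hmε := min_le_left ε (ρ x₀ / 2)
    have hmρ := min_le_right ε (ρ x₀ / 2)
    have hz : (0 : ℝ) = s₀ := hs₀ 0 ⟨⟨by linarith, by linarith⟩, by simpa using hyS⟩
    have hgt : δ₀ < ρ y := by
      by_contra hcon
      have := hs₀ (ρ y) ⟨⟨by linarith [(hρ y).1.1], by linarith⟩, (hρ y).1.2⟩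
      linarith [(hρ y).1.1]
    obtain ⟨s₁, hs₁, hs₁'⟩ := y₁
    have hle : ρ y ≤ s₁ := (hρ y).2 ⟨by linarith [hs₁.1], hs₁'⟩
    have hge : ρ x₀ - ε < ρ y := by
      by_contra hcon
      exact y₂ (ρ y) ⟨hgt.le, by linarith⟩ (hρ y).1.2
    rw [Real.dist_eq, abs_lt]
    constructor <;> linarith [hs₁.2]
  have hJ : ContinuousOn (fun x => liftedArg φ ϑ h x (ρ x) - h x) S :=
    (hP.continuousOn_liftedArg hcont fun y _ => (hρ y).1.2).sub hP.continuousOn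
  rcases S.eq_empty_or_nonempty with rfl | ⟨x₁, hx₁⟩
  · exact ⟨0, fun x hx => absurd hx (Set.notMem_empty x)⟩
  refine ⟨liftedArg φ ϑ h x₁ (ρ x₁) - h x₁, fun x hx r hr => ?_⟩
  have hr' : r = ρ x := hr.unique (hρ x)
  subst hr'
  -- Both terms are arguments of `ϑ y`, so the continuous jump takes values in a discrete set on the
  -- connected page.
  have h1 : ∀ y ∈ S, Circle.exp (liftedArg φ ϑ h y (ρ y) - h y) = 1 := fun y hy => by
    rw [Circle.exp_sub, hP.exp_liftedArg (hρ y).1.2, hP.exp_eq y hy, div_self']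
  exact Circle.isCoveringMap_exp.constOn_of_comp hP.isPreconnected hJ
    (fun a ha a' ha' => by rw [h1 a ha, h1 a' ha']) hx hx₁

/-- Here `n` is the number of returns between the two hits: each contributes `j` and takes time at
most `τ`. The second inequality is what later converts elapsed time into winding. -/
theorem liftedArg_sub_eq_natMul {j τ : ℝ} (hnhds : ∀ x : M, IsTransverseAt φ S c (𝓝 x))
    (hτ : ∀ x, ∃ t ∈ Set.Ioc 0 τ, φ t x ∈ S)
    (hj : ∀ x ∈ S, ∀ ρ, IsLeast {t | 0 < t ∧ φ t x ∈ S} ρ → liftedArg φ ϑ h x ρ - h x = j)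
    (x : M) {a t : ℝ} (hat : a ≤ t) (ha : φ a x ∈ S) (ht : φ t x ∈ S) :
    ∃ n : ℕ, liftedArg φ ϑ h x t - liftedArg φ ϑ h x a = n * j ∧ t - a ≤ n * τ := by
  have hfin := finite_hits hnhds x a t
  -- Induction runs downwards from the last hit `t`, using that there are finitely many hits.
  have hwf : {s | s ∈ Set.Icc a t ∧ φ s x ∈ S}.WellFoundedOn (· > ·) := hfin.wellFoundedOn
  suffices ∀ s ∈ {s | s ∈ Set.Icc a t ∧ φ s x ∈ S}, ∃ n : ℕ,
      liftedArg φ ϑ h x t - liftedArg φ ϑ h x s = n * j ∧ t - s ≤ n * τ from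
    this a ⟨⟨le_rfl, hat⟩, ha⟩
  intro s₀ hs₀
  refine hwf.induction (P := fun s => ∃ n : ℕ,
    liftedArg φ ϑ h x t - liftedArg φ ϑ h x s = n * j ∧ t - s ≤ n * τ) hs₀ fun s hs ih => ?_
  rcases hs.1.2.eq_or_lt with rfl | hlt
  · exact ⟨0, by simp, by simp⟩
  obtain ⟨r, hr, hr'⟩ := hτ (φ s x)
  obtain ⟨ρ, hρ⟩ := exists_isLeast_hit (finite_hits hnhds) (x := φ s x) (P := fun t => 0 < t)
    (m := 0) (fun t ht => le_of_lt ht) ⟨hr.1, hr'⟩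
  have hρ1 : ρ ≤ τ := (hρ.2 ⟨hr.1, hr'⟩).trans hr.2
  have hρ2 : ρ ≤ t - s := hρ.2 ⟨by linarith, by rw [← φ.map_add]; simpa using ht⟩
  have hρ0 : 0 < ρ := hρ.1.1
  have hρm : φ (s + ρ) x ∈ S := by rw [add_comm, φ.map_add]; exact hρ.1.2
  obtain ⟨n, hn, hn'⟩ := ih (s + ρ)
    ⟨⟨by linarith [hs.1.1], by linarith⟩, hρm⟩ (by simpa using hρ0)
  have hJ := hj (φ s x) hs.2 ρ hρ
  rw [liftedArg_flow, ← liftedArg_zero (φ := φ) (ϑ := ϑ) h (φ s x), liftedArg_flow,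
    add_zero] at hJ
  refine ⟨n + 1, ?_, ?_⟩
  · push_cast; linarith
  · push_cast; linarith

/-- If consecutive hits have the same lifted argument, then `ϑ` has a global argument. -/
theorem exists_global_lift (hP : IsPage ϑ S h) {τ : ℝ}
    (hnhds : ∀ x : M, IsTransverseAt φ S c (𝓝 x)) (hτ : ∀ x, ∃ t ∈ Set.Ioc 0 τ, φ t x ∈ S)
    (hj : ∀ x ∈ S, ∀ ρ, IsLeast {t | 0 < t ∧ φ t x ∈ S} ρ → liftedArg φ ϑ h x ρ - h x = 0) :
    ∃ P : C(M, ℝ), ∀ x, Circle.exp (P x) = ϑ x := by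
  -- With zero jump every hit yields the same argument. The arbitrary hit time `r x` may then be
  -- replaced, near each point, by a continuous one.
  have heq : ∀ x a b, φ a x ∈ S → φ b x ∈ S → liftedArg φ ϑ h x a = liftedArg φ ϑ h x b := by
    intro x a b ha hb
    rcases le_total a b with hab | hab
    · obtain ⟨n, hn, -⟩ := liftedArg_sub_eq_natMul hnhds hτ hj x hab ha hb
      linarith
    · obtain ⟨n, hn, -⟩ := liftedArg_sub_eq_natMul hnhds hτ hj x hab hb ha
      linarith
  choose r hr hr' using hτ
  refine ⟨⟨fun x => liftedArg φ ϑ h x (r x), ?_⟩, fun x => hP.exp_liftedArg (hr' x)⟩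
  rw [continuous_iff_continuousAt]
  intro x
  obtain ⟨t, -, ht⟩ := (hnhds x).forward
  obtain ⟨δ, -, -, U, hU, ρ, hρ, hρ'⟩ := ht.exists_hitTime hP.isClosed one_pos
  have := hP.continuousOn_liftedArg hρ fun y hy => (hρ' y hy).2.1
  exact (this.congr fun y hy => heq y _ _ (hr' y) (hρ' y hy).2.1).continuousAt hU

end Jump

/-! ### Comparison of the lifted arguments of two pages -/

section Compare

variable {S₁ S₂ : Set M} {h₁ h₂ : M → ℝ} {c : ℝ} {G : Set (Filter M)}

/-- Near a pair of times `(s, t)`, either one page is missed, and there is nothing to bound, or both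
are hit exactly once at continuous times. In the second case the difference is continuous with
values in `2πℤ` on a connected set of `F`, hence constant. Finitely many such pairs cover the square
of times. -/
theorem exists_local_bound {F : Filter M}
    (hconn : ∀ U ∈ F, ∃ W ∈ F, W ⊆ U ∧ IsPreconnected W)
    (hP₁ : IsPage ϑ S₁ h₁) (hP₂ : IsPage ϑ S₂ h₂)
    (hT₁ : IsTransverseAt φ S₁ c F) (hT₂ : IsTransverseAt φ S₂ c F) (A : ℝ) :
    ∃ W ∈ F, ∃ C, ∀ w ∈ W, ∀ a ∈ Set.Icc (-A) A, ∀ b ∈ Set.Icc (-A) A, φ a w ∈ S₁ → φ b w ∈ S₂ →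
      |liftedArg φ ϑ h₁ w a - liftedArg φ ϑ h₂ w b| ≤ C := by
  have hK : IsCompact (Set.Icc (-A) A ×ˢ Set.Icc (-A) A) := isCompact_Icc.prod isCompact_Icc
  have := hK.induction_on (p := fun Z => ∃ W ∈ F, ∃ C, ∀ w ∈ W, ∀ p ∈ Z, φ p.1 w ∈ S₁ →
    φ p.2 w ∈ S₂ → |liftedArg φ ϑ h₁ w p.1 - liftedArg φ ϑ h₂ w p.2| ≤ C)
    ⟨Set.univ, univ_mem, 0, by simp⟩ ?_ ?_ ?_
  · obtain ⟨W, hW, C, hC⟩ := this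
    exact ⟨W, hW, C, fun w hw a ha b hb => hC w hw (a, b) ⟨ha, hb⟩⟩
  · rintro Z Z' hZ ⟨W, hW, C, hC⟩
    exact ⟨W, hW, C, fun w hw p hp => hC w hw p (hZ hp)⟩
  · rintro Z Z' ⟨W, hW, C, hC⟩ ⟨W', hW', C', hC'⟩
    refine ⟨W ∩ W', inter_mem hW hW', max C C', fun w hw p hp m₁ m₂ => ?_⟩
    rcases hp with hp | hp
    · exact (hC w hw.1 p hp m₁ m₂).trans (le_max_left _ _)
    · exact (hC' w hw.2 p hp m₁ m₂).trans (le_max_right _ _)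
  rintro ⟨s, t⟩ -
  have hnb : ∀ {δ δ' : ℝ}, 0 < δ → 0 < δ' →
      Set.Icc (s - δ) (s + δ) ×ˢ Set.Icc (t - δ') (t + δ') ∈
        𝓝[Set.Icc (-A) A ×ˢ Set.Icc (-A) A] (s, t) := fun hδ hδ' =>
    nhdsWithin_le_nhds (prod_mem_nhds (Icc_mem_nhds (by linarith) (by linarith))
      (Icc_mem_nhds (by linarith) (by linarith)))
  rcases hT₁.dichotomy s with ⟨δ, hδ, hev⟩ | s₁
  · exact ⟨_, hnb hδ one_pos, _, hev, 0, fun w hw p hp m₁ _ => absurd m₁ (hw p.1 hp.1)⟩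
  rcases hT₂.dichotomy t with ⟨δ, hδ, hev⟩ | s₂
  · exact ⟨_, hnb one_pos hδ, _, hev, 0, fun w hw p hp _ m₂ => absurd m₂ (hw p.2 hp.2)⟩
  obtain ⟨δ₁, hδ₁, -, U₁, hU₁, ρ₁, hρ₁, hρ₁'⟩ := s₁.exists_hitTime hP₁.isClosed one_pos
  obtain ⟨δ₂, hδ₂, -, U₂, hU₂, ρ₂, hρ₂, hρ₂'⟩ := s₂.exists_hitTime hP₂.isClosed one_pos
  obtain ⟨W, hW, hWU, hWc⟩ := hconn _ (inter_mem hU₁ hU₂)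
  refine ⟨_, hnb hδ₁ hδ₂, ?_⟩
  rcases W.eq_empty_or_nonempty with rfl | ⟨w₀, hw₀⟩
  · exact ⟨∅, hW, 0, by simp⟩
  refine ⟨W, hW, |liftedArg φ ϑ h₁ w₀ (ρ₁ w₀) - liftedArg φ ϑ h₂ w₀ (ρ₂ w₀)|, ?_⟩
  rintro w hw p hp m₁ m₂
  rw [(hρ₁' w (hWU hw).1).2.2 p.1 hp.1 m₁, (hρ₂' w (hWU hw).2).2.2 p.2 hp.2 m₂]
  have hc : ContinuousOn (fun w => liftedArg φ ϑ h₁ w (ρ₁ w) - liftedArg φ ϑ h₂ w (ρ₂ w)) W :=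
    ((hP₁.continuousOn_liftedArg hρ₁ fun y hy => (hρ₁' y hy).2.1).mono fun y hy => (hWU hy).1).sub
    ((hP₂.continuousOn_liftedArg hρ₂ fun y hy => (hρ₂' y hy).2.1).mono fun y hy => (hWU hy).2)
  have hone : ∀ w ∈ W, Circle.exp (liftedArg φ ϑ h₁ w (ρ₁ w) - liftedArg φ ϑ h₂ w (ρ₂ w)) = 1 :=
    fun w hw => by
      rw [Circle.exp_sub, hP₁.exp_liftedArg (hρ₁' w (hWU hw).1).2.1,
        hP₂.exp_liftedArg (hρ₂' w (hWU hw).2).2.1, div_self']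
  have := Circle.isCoveringMap_exp.constOn_of_comp hWc hc
    (fun a ha a' ha' => by rw [hone a ha, hone a' ha']) hw hw₀
  exact (congrArg abs this).le

/-- The local bounds are taken on windows enlarged by `|c|`, because `y` is reached from a point of
one of the finitely many sets only after a time in `[0, c]`. This shift does not affect the
difference. -/
theorem exists_uniform_bound (hG : IsCompactFamily φ c G)
    (hP₁ : IsPage ϑ S₁ h₁) (hP₂ : IsPage ϑ S₂ h₂)
    (hT₁ : ∀ F ∈ G, IsTransverseAt φ S₁ c F) (hT₂ : ∀ F ∈ G, IsTransverseAt φ S₂ c F) (A : ℝ) :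
    ∃ C, ∀ y, ∀ a ∈ Set.Icc (-A) A, ∀ b ∈ Set.Icc (-A) A, φ a y ∈ S₁ → φ b y ∈ S₂ →
      |liftedArg φ ϑ h₁ y a - liftedArg φ ϑ h₂ y b| ≤ C := by
  classical
  have key : ∀ F : Filter M, ∃ W : Set M, ∃ C : ℝ, F ∈ G → W ∈ F ∧ ∀ w ∈ W,
      ∀ a ∈ Set.Icc (-(A + |c|)) (A + |c|), ∀ b ∈ Set.Icc (-(A + |c|)) (A + |c|),
      φ a w ∈ S₁ → φ b w ∈ S₂ → |liftedArg φ ϑ h₁ w a - liftedArg φ ϑ h₂ w b| ≤ C := by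
    intro F
    by_cases hF : F ∈ G
    · obtain ⟨W, hW, C, hC⟩ := exists_local_bound (hG.conn F hF) hP₁ hP₂ (hT₁ F hF) (hT₂ F hF)
        (A + |c|)
      exact ⟨W, C, fun _ => ⟨hW, hC⟩⟩
    · exact ⟨∅, 0, fun h => absurd h hF⟩
  choose W C hWC using key
  obtain ⟨s, hs, hsG, hcov⟩ := hG.cover W (fun F hF => (hWC F hF).1)
  obtain ⟨B, hB⟩ := (hs.image C).bddAbove
  refine ⟨B, fun y a ha b hb m₁ m₂ => ?_⟩
  obtain ⟨F, hF, t, ht, w, hw, rfl⟩ := hcov y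
  have h3 := le_abs_self c
  have := (hWC F (hsG hF)).2 w hw (t + a) ⟨by linarith [ht.1, ha.1, abs_nonneg c],
    by linarith [ht.2, ha.2]⟩ (t + b) ⟨by linarith [ht.1, hb.1, abs_nonneg c],
    by linarith [ht.2, hb.2]⟩ (by rw [add_comm, φ.map_add]; exact m₁)
    (by rw [add_comm, φ.map_add]; exact m₂)
  rw [liftedArg_flow, liftedArg_flow, add_sub_add_right_eq_sub]
  exact this.trans (hB (Set.mem_image_of_mem _ hF))

/-- The winding of trajectories closed up in two pages differs by a bounded amount. -/
theorem exists_winding_bound (hG : IsCompactFamily φ c G)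
    (hP₁ : IsPage ϑ S₁ h₁) (hP₂ : IsPage ϑ S₂ h₂)
    (hT₁ : ∀ F ∈ G, IsTransverseAt φ S₁ c F) (hT₂ : ∀ F ∈ G, IsTransverseAt φ S₂ c F) :
    ∃ C, ∀ x T a₁ b₁ a₂ b₂, IsGreatest {t | t ≤ 0 ∧ φ t x ∈ S₁} a₁ →
      IsLeast {t | T ≤ t ∧ φ t x ∈ S₁} b₁ → IsGreatest {t | t ≤ 0 ∧ φ t x ∈ S₂} a₂ →
      IsLeast {t | T ≤ t ∧ φ t x ∈ S₂} b₂ →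
      |(liftedArg φ ϑ h₁ x b₁ - liftedArg φ ϑ h₁ x a₁) -
        (liftedArg φ ϑ h₂ x b₂ - liftedArg φ ϑ h₂ x a₂)| ≤ C := by
  obtain ⟨τ₁, hτ₁, hit₁⟩ := exists_hit_bound hG hT₁
  obtain ⟨τ₂, hτ₂, hit₂⟩ := exists_hit_bound hG hT₂
  obtain ⟨C, hC⟩ := exists_uniform_bound hG hP₁ hP₂ hT₁ hT₂ (max τ₁ τ₂)
  have l₁ := le_max_left τ₁ τ₂
  have l₂ := le_max_right τ₁ τ₂
  have hpre : ∀ {S : Set M} {τ : ℝ}, (∀ y, (∃ t ∈ Set.Ioc 0 τ, φ t y ∈ S) ∧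
      (∃ t ∈ Set.Ico (-τ) 0, φ t y ∈ S)) → ∀ {x a}, IsGreatest {t | t ≤ 0 ∧ φ t x ∈ S} a →
      -τ ≤ a := by
    intro S τ hit x a ha
    obtain ⟨t, ht, ht'⟩ := (hit x).2
    exact ht.1.trans (ha.2 ⟨ht.2.le, ht'⟩)
  have hpost : ∀ {S : Set M} {τ : ℝ}, (∀ y, (∃ t ∈ Set.Ioc 0 τ, φ t y ∈ S) ∧
      (∃ t ∈ Set.Ico (-τ) 0, φ t y ∈ S)) → ∀ {x T b}, IsLeast {t | T ≤ t ∧ φ t x ∈ S} b →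
      b - T ≤ τ := by
    intro S τ hit x T b hb
    obtain ⟨t, ht, ht'⟩ := (hit (φ T x)).1
    have := hb.2 ⟨by linarith [ht.1], (by rw [φ.map_add]; exact ht' : φ (t + T) x ∈ S)⟩
    linarith [ht.2]
  refine ⟨2 * C, fun x T a₁ b₁ a₂ b₂ ha₁ hb₁ ha₂ hb₂ => ?_⟩
  -- The first hits are compared with base point `x`, the last ones with base point `φ T x`. In both
  -- cases all hits lie in a window independent of `T`, which gives twice the uniform constant.
  have e₁ := hC x a₁ ⟨by linarith [hpre hit₁ ha₁], by linarith [ha₁.1.1]⟩ a₂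
    ⟨by linarith [hpre hit₂ ha₂], by linarith [ha₂.1.1]⟩ ha₁.1.2 ha₂.1.2
  have e₂ := hC (φ T x) (b₁ - T) ⟨by linarith [hb₁.1.1], by linarith [hpost hit₁ hb₁]⟩ (b₂ - T)
    ⟨by linarith [hb₂.1.1], by linarith [hpost hit₂ hb₂]⟩
    (by rw [← φ.map_add]; simpa using hb₁.1.2) (by rw [← φ.map_add]; simpa using hb₂.1.2)
  rw [liftedArg_flow, liftedArg_flow, add_sub_add_right_eq_sub, add_sub_cancel,
    add_sub_cancel] at e₂
  rw [abs_le] at e₁ e₂ ⊢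
  constructor <;> linarith [e₁.1, e₁.2, e₂.1, e₂.2]

/-- The winding of trajectories closed up in a page grows at least linearly. -/
theorem exists_winding_growth (hG : IsCompactFamily φ c G) (hP₁ : IsPage ϑ S₁ h₁)
    (hT₁ : ∀ F ∈ G, IsTransverseAt φ S₁ c F) (hϑ : ¬ ∃ P : C(M, ℝ), ∀ x, Circle.exp (P x) = ϑ x) :
    ∃ κ > 0, ∀ x T a b, 0 ≤ T → IsGreatest {t | t ≤ 0 ∧ φ t x ∈ S₁} a →
      IsLeast {t | T ≤ t ∧ φ t x ∈ S₁} b →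
      κ * T ≤ |liftedArg φ ϑ h₁ x b - liftedArg φ ϑ h₁ x a| := by
  obtain ⟨τ, hτ, hit⟩ := exists_hit_bound hG hT₁
  have hnhds := fun x => hT₁ _ (hG.nhds_mem x)
  obtain ⟨j, hj⟩ := exists_jump hP₁ hnhds fun x => by
    obtain ⟨t, ht, ht'⟩ := (hit x).1
    exact ⟨t, ht.1, ht'⟩
  -- This is where the nontriviality of the class of `ϑ` enters.
  have hj0 : j ≠ 0 := by
    rintro rfl
    exact hϑ (exists_global_lift hP₁ hnhds (fun x => (hit x).1) hj)
  refine ⟨|j| / τ, by positivity, fun x T a b hT ha hb => ?_⟩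
  obtain ⟨n, hn, hn'⟩ := liftedArg_sub_eq_natMul hnhds (fun x => (hit x).1) hj x
    (a := a) (t := b) (by linarith [ha.1.1, hb.1.1]) ha.1.2 hb.1.2
  rw [hn, abs_mul, Nat.abs_cast, div_mul_eq_mul_div, div_le_iff₀ hτ]
  have : T ≤ n * τ := by linarith [ha.1.1, hb.1.1]
  nlinarith [abs_nonneg j]

end Compare

end Pages

/-! ### Global flows of Lipschitz vector fields -/

section GlobalFlows

open scoped NNReal

variable {E : Type*} [NormedAddCommGroup E] [NormedSpace ℝ E]

/-- A bounded, globally Lipschitz time-dependent vector field has global solutions. -/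
theorem exists_global_solution [CompleteSpace E] {f : ℝ → E → E} {K L : ℝ≥0}
    (hK : ∀ t, LipschitzWith K (f t)) (hc : ∀ x, Continuous fun t => f t x)
    (hL : ∀ t x, ‖f t x‖ ≤ L) (x₀ : E) : ∃ u : ℝ → E, u 0 = x₀ ∧ ∀ t, HasDerivAt u (f t (u t)) t := by
  have hloc : ∀ n : ℕ, ∃ u : ℝ → E, u 0 = x₀ ∧
      ∀ t ∈ Set.Ioo (-(n : ℝ)) n, HasDerivAt u (f t (u t)) t := by
    intro n
    have h0 : (0 : ℝ) ∈ Set.Icc (-(n : ℝ)) n := ⟨by simp, by simp⟩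
    -- Since `f` is bounded by `L`, a ball of radius `L * n` suffices for the whole interval `[-n,
    -- n]`, with no shrinking of time.
    have hPL : IsPicardLindelof f (⟨0, h0⟩ : Set.Icc (-(n : ℝ)) n) x₀ (L * n) 0 L K :=
      { lipschitzOnWith := fun t _ => (hK t).lipschitzOnWith
        continuousOn := fun x _ => (hc x).continuousOn
        norm_le := fun t _ x _ => hL t x
        mul_max_le := by simp }
    obtain ⟨u, hu, hu'⟩ := hPL.exists_eq_forall_mem_Icc_hasDerivWithinAt₀
    exact ⟨u, hu, fun t ht => (hu' t (Set.Ioo_subset_Icc_self ht)).hasDerivAt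
      (Icc_mem_nhds ht.1 ht.2)⟩
  choose u hu hu' using hloc
  have huniq : ∀ m n : ℕ, 0 < m → m ≤ n → Set.EqOn (u m) (u n) (Set.Ioo (-(m : ℝ)) m) := by
    intro m n hm hmn
    have hm' : (0 : ℝ) < m := by exact_mod_cast hm
    have hmn' : (m : ℝ) ≤ n := by exact_mod_cast hmn
    exact ODE_solution_unique_of_mem_Ioo (v := f) (s := fun _ => Set.univ) (K := K) (t₀ := 0)
      (fun t _ => (hK t).lipschitzOnWith) ⟨by linarith, hm'⟩
      (fun t ht => ⟨hu' m t ht, trivial⟩)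
      (fun t ht => ⟨hu' n t ⟨by linarith [ht.1], by linarith [ht.2]⟩, trivial⟩) (by rw [hu, hu])
  have hN : ∀ t : ℝ, t ∈ Set.Ioo (-((⌈|t|⌉₊ + 1 : ℕ) : ℝ)) ((⌈|t|⌉₊ + 1 : ℕ) : ℝ) := by
    intro t
    have h1 := Nat.le_ceil |t|
    have h2 := neg_abs_le t
    have h3 := le_abs_self t
    push_cast
    constructor <;> linarith
  -- The solutions on growing intervals agree, so the index `⌈|t|⌉₊ + 1` may be frozen near a given
  -- time when differentiating.
  have heq : ∀ (n : ℕ) (t : ℝ), 0 < n → t ∈ Set.Ioo (-(n : ℝ)) n → u (⌈|t|⌉₊ + 1) t = u n t := by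
    intro n t hn ht
    rcases le_total n (⌈|t|⌉₊ + 1) with h | h
    · exact (huniq n _ hn h ht).symm
    · exact huniq _ n (Nat.succ_pos _) h (hN t)
  refine ⟨fun t => u (⌈|t|⌉₊ + 1) t, hu _, fun t => ?_⟩
  refine (hu' _ t (hN t)).congr_of_eventuallyEq ?_
  filter_upwards [Ioo_mem_nhds (hN t).1 (hN t).2] with s hs
  exact heq _ s (Nat.succ_pos _) hs

theorem LipschitzWith.solution_unique {v : E → E} {K : ℝ≥0} (hv : LipschitzWith K v) {a b : ℝ → E}
    (ha : ∀ t, HasDerivAt a (v (a t)) t) (hb : ∀ t, HasDerivAt b (v (b t)) t) (h : a 0 = b 0) :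
    a = b :=
  ODE_solution_unique_univ (v := fun _ => v) (s := fun _ => Set.univ) (K := K) (t₀ := 0)
    (fun _ => hv.lipschitzOnWith) (fun t => ⟨ha t, trivial⟩) (fun t => ⟨hb t, trivial⟩) h

/-- `Φ` is the global flow of the vector field `v`. -/
structure IsFlowOf (v : E → E) (Φ : ℝ → E → E) : Prop where
  zero : ∀ x, Φ 0 x = x
  deriv : ∀ x t, HasDerivAt (fun s => Φ s x) (v (Φ t x)) t

theorem exists_isFlowOf [CompleteSpace E] {v : E → E} {K L : ℝ≥0} (hK : LipschitzWith K v)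
    (hL : ∀ x, ‖v x‖ ≤ L) : ∃ Φ, IsFlowOf v Φ := by
  have := fun x => exists_global_solution (f := fun _ => v) (fun _ => hK)
    (fun _ => continuous_const) (fun _ => hL) x
  choose u hu hu' using this
  exact ⟨fun t x => u x t, hu, hu'⟩

namespace IsFlowOf

variable {v : E → E} {Φ : ℝ → E → E} {K : ℝ≥0}

theorem neg (h : IsFlowOf v Φ) : IsFlowOf (fun x => -v x) (fun t x => Φ (-t) x) where
  zero x := by simpa using h.zero x
  deriv x t := by simpa [Function.comp_def] using (h.deriv x (-t)).scomp t (hasDerivAt_neg t)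

theorem continuous_time (h : IsFlowOf v Φ) (x : E) : Continuous fun t => Φ t x :=
  continuous_iff_continuousAt.2 fun t => (h.deriv x t).continuousAt

theorem eq_of_hasDerivAt (h : IsFlowOf v Φ) (hv : LipschitzWith K v) {c : ℝ → E}
    (hc : ∀ t, HasDerivAt c (v (c t)) t) (t : ℝ) : c t = Φ t (c 0) :=
  congr_fun (hv.solution_unique hc (h.deriv (c 0)) (h.zero _).symm) t

theorem add (h : IsFlowOf v Φ) (hv : LipschitzWith K v) (s t : ℝ) (x : E) :
    Φ (s + t) x = Φ s (Φ t x) := by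
  have := h.eq_of_hasDerivAt hv (c := fun s => Φ (s + t) x)
    (fun s => (h.deriv x (s + t)).comp_add_const s t) s
  simpa using this

theorem dist_le_of_nonneg (h : IsFlowOf v Φ) (hv : LipschitzWith K v) (x y : E) {t : ℝ}
    (ht : 0 ≤ t) : dist (Φ t x) (Φ t y) ≤ dist x y * Real.exp (K * t) := by
  have := dist_le_of_trajectories_ODE (v := fun _ => v) (K := K) (a := 0) (b := t)
    (δ := dist x y) (fun _ => hv) (h.continuous_time x).continuousOn
    (fun s _ => (h.deriv x s).hasDerivWithinAt) (h.continuous_time y).continuousOn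
    (fun s _ => (h.deriv y s).hasDerivWithinAt) (by rw [h.zero, h.zero]) t ⟨ht, le_rfl⟩
  simpa using this

theorem dist_le (h : IsFlowOf v Φ) (hv : LipschitzWith K v) (x y : E) (t : ℝ) :
    dist (Φ t x) (Φ t y) ≤ dist x y * Real.exp (K * |t|) := by
  rcases le_total 0 t with ht | ht
  · rw [abs_of_nonneg ht]; exact h.dist_le_of_nonneg hv x y ht
  · rw [abs_of_nonpos ht]
    simpa using h.neg.dist_le_of_nonneg (K := K) hv.neg x y (t := -t) (by linarith)

theorem continuous (h : IsFlowOf v Φ) (hv : LipschitzWith K v) :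
    Continuous fun p : ℝ × E => Φ p.1 p.2 := by
  rw [continuous_iff_continuousAt]
  rintro ⟨t, x⟩
  have h1 : Tendsto (fun p : ℝ × E => Φ p.1 x) (𝓝 (t, x)) (𝓝 (Φ t x)) :=
    ((h.continuous_time x).comp continuous_fst).continuousAt
  refine h1.congr_dist (squeeze_zero (fun _ => dist_nonneg)
    (fun p => h.dist_le hv x p.2 p.1) ?_)
  have : Continuous fun p : ℝ × E => dist x p.2 * Real.exp (K * |p.1|) := by fun_prop
  simpa using this.tendsto (t, x)

end IsFlowOf

/-- Linear equations with bounded continuous coefficients have solutions on bounded intervals. -/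
theorem exists_linear_solution [FiniteDimensional ℝ E] {D : ℝ → E →L[ℝ] E} (hD : Continuous D)
    {K : ℝ≥0} (hK : ∀ t, ‖D t‖ ≤ K) (u₀ : E) (T : ℝ) :
    ∃ u : ℝ → E, u 0 = u₀ ∧ Continuous u ∧ ∀ t ∈ Set.Icc (-T) T, HasDerivAt u (D t (u t)) t := by
  have : CompleteSpace E := FiniteDimensional.complete ℝ E
  -- `R` exceeds the Gronwall bound of any solution on `[-|T|, |T|]`. Cutting off outside the ball
  -- of radius `R` makes the field bounded and Lipschitz without changing it along the solution.
  set R : ℝ := ‖u₀‖ * Real.exp (K * |T|) + 1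
  have hR : 0 < R := by positivity
  let χ : ContDiffBump (0 : E) := ⟨R, R + 1, hR, by linarith⟩
  let g : E → E := fun x => χ x • x
  have hgsm : ContDiff ℝ 1 g := χ.contDiff.smul contDiff_id
  have hgc : HasCompactSupport g := χ.hasCompactSupport.smul_right
  obtain ⟨C, hC⟩ := hgsm.lipschitzWith_of_hasCompactSupport hgc (by simp)
  have hgn : ∀ x, ‖g x‖ ≤ ‖x‖ := fun x => by
    simp only [g, norm_smul, Real.norm_eq_abs, abs_of_nonneg χ.nonneg]
    exact mul_le_of_le_one_left (norm_nonneg _) χ.le_one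
  have hgR : ∀ x, ‖g x‖ ≤ (⟨R + 1, by positivity⟩ : ℝ≥0) := fun x => by
    rcases le_total ‖x‖ (R + 1) with hx | hx
    · exact (hgn x).trans hx
    · have : χ x = 0 := χ.zero_of_le_dist (by simpa [χ] using hx)
      simp only [g, this, zero_smul, norm_zero]
      change (0 : ℝ) ≤ R + 1
      positivity
  obtain ⟨u, hu0, hu⟩ := exists_global_solution (f := fun t x => D t (g x)) (K := K * C)
    (L := K * ⟨R + 1, by positivity⟩) (fun t => ((D t).lipschitz.weaken (hK t)).comp hC)
    (fun x => by fun_prop)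
    (fun t x => ((D t).le_opNorm _).trans (mul_le_mul (hK t) (hgR x) (norm_nonneg _) K.2)) u₀
  have hb : ∀ (w : ℝ → E) (w' : ℝ → E), (∀ t, HasDerivAt w (w' t) t) → w 0 = u₀ →
      (∀ t, ‖w' t‖ ≤ K * ‖w t‖) → ∀ t ∈ Set.Icc 0 |T|, ‖w t‖ ≤ R := by
    intro w w' hw hw0 hw' t ht
    have := norm_le_gronwallBound_of_norm_deriv_right_le (f := w) (f' := w') (δ := ‖u₀‖) (K := K)
      (ε := 0) (a := 0) (b := |T|) (fun s _ => (hw s).continuousAt.continuousWithinAt)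
      (fun s _ => (hw s).hasDerivWithinAt) (by rw [hw0]) (fun s _ => by simpa using hw' s) t ht
    rw [gronwallBound_ε0, sub_zero] at this
    refine this.trans ?_
    have h2 : Real.exp (K * t) ≤ Real.exp (K * |T|) :=
      Real.exp_le_exp.2 (mul_le_mul_of_nonneg_left ht.2 K.2)
    have := mul_le_mul_of_nonneg_left h2 (norm_nonneg u₀)
    simp only [R]; linarith
  have hDg : ∀ t x, ‖D t (g x)‖ ≤ K * ‖x‖ := fun t x =>
    ((D t).le_opNorm _).trans (mul_le_mul (hK t) (hgn x) (norm_nonneg _) K.2)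
  refine ⟨u, hu0, continuous_iff_continuousAt.2 fun t => (hu t).continuousAt, fun t ht => ?_⟩
  have hut : ‖u t‖ ≤ R := by
    have hTT := le_abs_self T
    rcases le_total 0 t with h | h
    · exact hb u _ hu hu0 (fun s => hDg s (u s)) t ⟨h, by linarith [ht.2]⟩
    · have := hb (fun s => u (-s)) (fun s => -(D (-s) (g (u (-s)))))
        (fun s => by simpa [Function.comp_def] using (hu (-s)).scomp s (hasDerivAt_neg s))
        (by simpa using hu0)
        (fun s => by simpa using hDg (-s) (u (-s))) (-t) ⟨by linarith, by linarith [ht.1]⟩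
      simpa using this
  have hχ : χ (u t) = 1 := χ.one_of_mem_closedBall (by simpa [χ] using hut)
  simpa [g, hχ] using hu t

namespace IsFlowOf

variable {v : E → E} {Φ : ℝ → E → E} {K : ℝ≥0}

/-- Uniform continuity of the derivative makes the first-order Taylor remainder of `v` small
uniformly in the base point. Trajectories from `x` and `x + y` stay within `B * ‖y‖`, so the defect
satisfies a Gronwall inequality with zero initial value and a forcing term of size `η * B * ‖y‖`. -/
theorem linearization_forward (h : IsFlowOf v Φ) (hv : LipschitzWith K v)
    (hd : Differentiable ℝ v) (huc : UniformContinuous (fderiv ℝ v)) {x : E} {T : ℝ}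
    {A : ℝ → E →L[ℝ] E} (hA0 : A 0 = ContinuousLinearMap.id ℝ E)
    (hA : ∀ t ∈ Set.Icc 0 T, HasDerivAt A ((fderiv ℝ v (Φ t x)).comp (A t)) t) {ε : ℝ}
    (hε : 0 < ε) : ∃ δ > 0, ∀ y, ‖y‖ < δ → ∀ t ∈ Set.Icc 0 T,
      ‖Φ t (x + y) - Φ t x - A t y‖ ≤ ε * ‖y‖ := by
  set B : ℝ := Real.exp (K * T) with hB
  have hBpos : 0 < B := Real.exp_pos _
  set B' : ℝ := Real.exp ((K + 1) * T) with hB'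
  have hB'pos : 0 < B' := Real.exp_pos _
  -- `B` absorbs the spreading of trajectories and `B'` the Gronwall growth of the defect.
  set η : ℝ := ε / (B * B') with hη
  have hηpos : 0 < η := by positivity
  obtain ⟨δ, hδ, hδ'⟩ := Metric.uniformContinuous_iff.1 huc η hηpos
  have hlin : ∀ p k : E, ‖k‖ < δ → ‖v (p + k) - v p - fderiv ℝ v p k‖ ≤ η * ‖k‖ := by
    intro p k hk
    have := (convex_ball p δ).norm_image_sub_le_of_norm_fderiv_le' (f := v) (𝕜 := ℝ)
      (φ := fderiv ℝ v p) (C := η) (fun z _ => hd z)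
      (fun z hz => by rw [← dist_eq_norm]; exact (hδ' hz).le) (Metric.mem_ball_self hδ)
      (y := p + k) (by simpa [dist_eq_norm] using hk)
    simpa using this
  refine ⟨δ / B, by positivity, fun y hy t ht => ?_⟩
  have hdist : ∀ s ∈ Set.Icc 0 T, ‖Φ s (x + y) - Φ s x‖ ≤ ‖y‖ * B := by
    intro s hs
    rw [← dist_eq_norm]
    refine (h.dist_le_of_nonneg hv _ _ hs.1).trans ?_
    have h2 : Real.exp (K * s) ≤ B :=
      Real.exp_le_exp.2 (mul_le_mul_of_nonneg_left hs.2 K.2)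
    simpa using mul_le_mul_of_nonneg_left h2 (norm_nonneg y)
  have hyB : ‖y‖ * B < δ := by rwa [lt_div_iff₀ hBpos] at hy
  have hderiv : ∀ s ∈ Set.Icc 0 T, HasDerivAt (fun s => Φ s (x + y) - Φ s x - A s y)
      (v (Φ s (x + y)) - v (Φ s x) - fderiv ℝ v (Φ s x) (A s y)) s := by
    intro s hs
    exact ((h.deriv _ s).sub (h.deriv _ s)).sub ((hA s hs).clm_apply (hasDerivAt_const s y) |>.congr_deriv (by simp))
  have hKn : ∀ p, ‖fderiv ℝ v p‖ ≤ K := fun p => norm_fderiv_le_of_lipschitz ℝ hv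
  -- The rate `K + 1` replaces `K` so that it is at least `1`, and the division by it in the
  -- Gronwall bound is harmless.
  have hbound : ∀ s ∈ Set.Ico 0 T,
      ‖v (Φ s (x + y)) - v (Φ s x) - fderiv ℝ v (Φ s x) (A s y)‖ ≤
        (K + 1) * ‖Φ s (x + y) - Φ s x - A s y‖ + η * (‖y‖ * B) := by
    intro s hs
    have hs' := Set.Ico_subset_Icc_self hs
    have h1 := hlin (Φ s x) (Φ s (x + y) - Φ s x) ((hdist s hs').trans_lt hyB)
    rw [add_sub_cancel] at h1
    have h2 : v (Φ s (x + y)) - v (Φ s x) - fderiv ℝ v (Φ s x) (A s y) =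
        (v (Φ s (x + y)) - v (Φ s x) - fderiv ℝ v (Φ s x) (Φ s (x + y) - Φ s x)) +
        fderiv ℝ v (Φ s x) (Φ s (x + y) - Φ s x - A s y) := by
      rw [map_sub _ (Φ s (x + y) - Φ s x)]; abel
    rw [h2]
    refine (norm_add_le _ _).trans ?_
    have h3 : ‖fderiv ℝ v (Φ s x) (Φ s (x + y) - Φ s x - A s y)‖ ≤
        (K + 1) * ‖Φ s (x + y) - Φ s x - A s y‖ :=
      (ContinuousLinearMap.le_opNorm _ _).trans
        (mul_le_mul_of_nonneg_right (by linarith [hKn (Φ s x)]) (norm_nonneg _))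
    have h4 := mul_le_mul_of_nonneg_left (hdist s hs') hηpos.le
    linarith
  have hg := norm_le_gronwallBound_of_norm_deriv_right_le (δ := 0) (K := K + 1)
    (ε := η * (‖y‖ * B)) (a := 0) (b := T)
    (fun s hs => (hderiv s hs).continuousAt.continuousWithinAt)
    (fun s hs => (hderiv s (Set.Ico_subset_Icc_self hs)).hasDerivWithinAt)
    (by simp [h.zero, hA0]) hbound t ht
  refine hg.trans ?_
  have hK1 : (1 : ℝ) ≤ K + 1 := by simp
  rw [gronwallBound_of_K_ne_0 (by positivity)]
  simp only [zero_mul, zero_add, sub_zero]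
  have h5 : Real.exp ((K + 1) * t) - 1 ≤ B' := by
    have : Real.exp ((K + 1) * t) ≤ B' :=
      Real.exp_le_exp.2 (mul_le_mul_of_nonneg_left ht.2 (by positivity))
    linarith
  have h6 : η * (‖y‖ * B) / (K + 1) ≤ η * (‖y‖ * B) := div_le_self (by positivity) hK1
  have h7 : 0 ≤ Real.exp ((K + 1) * t) - 1 := by
    have : 1 ≤ Real.exp ((K + 1) * t) := Real.one_le_exp (mul_nonneg (by positivity) ht.1)
    linarith
  calc η * (‖y‖ * B) / (K + 1) * (Real.exp ((K + 1) * t) - 1)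
      ≤ η * (‖y‖ * B) * B' := mul_le_mul h6 h5 h7 (by positivity)
    _ = ε * ‖y‖ := by rw [hη]; field_simp

/-- The flow of a `C¹` Lipschitz vector field is differentiable, uniformly on bounded time
intervals. -/
theorem exists_linearization [FiniteDimensional ℝ E] (h : IsFlowOf v Φ) (hv : LipschitzWith K v)
    (hd : Differentiable ℝ v) (huc : UniformContinuous (fderiv ℝ v)) (x : E) (T : ℝ) :
    ∃ A : ℝ → E →L[ℝ] E, Continuous A ∧ ∀ ε > 0, ∃ δ > 0, ∀ y, ‖y‖ < δ →
      ∀ t ∈ Set.Icc (-T) T, ‖Φ t (x + y) - Φ t x - A t y‖ ≤ ε * ‖y‖ := by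
  -- The variational equation is solved in the space of operators, starting from the identity;
  -- negative times are handled through the flow of `-v`.
  let D : ℝ → (E →L[ℝ] E) →L[ℝ] (E →L[ℝ] E) := fun t =>
    ContinuousLinearMap.compL ℝ E E E (fderiv ℝ v (Φ t x))
  have hD : Continuous D := (ContinuousLinearMap.compL ℝ E E E).continuous.comp
    (huc.continuous.comp (h.continuous_time x))
  have hDK : ∀ t, ‖D t‖ ≤ K := fun t => by
    refine ContinuousLinearMap.opNorm_le_bound _ K.2 fun B => ?_
    exact (ContinuousLinearMap.opNorm_comp_le _ _).trans
      (mul_le_mul_of_nonneg_right (norm_fderiv_le_of_lipschitz ℝ hv) (norm_nonneg _))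
  obtain ⟨A, hA0, hAc, hA⟩ := exists_linear_solution hD hDK (ContinuousLinearMap.id ℝ E) |T|
  have hTT := le_abs_self T
  refine ⟨A, hAc, fun ε hε => ?_⟩
  obtain ⟨δ₁, hδ₁, h₁⟩ := h.linearization_forward hv hd huc hA0
    (fun t ht => hA t ⟨by linarith [ht.1, abs_nonneg T], ht.2⟩) hε
  have hfn : fderiv ℝ (fun x => -v x) = fun x => -fderiv ℝ v x := by
    funext x; exact fderiv_fun_neg
  obtain ⟨δ₂, hδ₂, h₂⟩ := h.neg.linearization_forward (K := K) hv.neg hd.neg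
    (by rw [hfn]; exact huc.neg) (x := x) (A := fun t => A (-t)) (T := |T|) (by simpa using hA0)
    (fun t ht => by
      have := (hA (-t) ⟨by linarith [ht.2], by linarith [ht.1, abs_nonneg T]⟩).scomp t
        (hasDerivAt_neg t)
      rw [hfn]
      simpa [D, Function.comp_def] using this) hε
  refine ⟨min δ₁ δ₂, lt_min hδ₁ hδ₂, fun y hy t ht => ?_⟩
  rcases le_total 0 t with h0 | h0
  · exact h₁ y (hy.trans_le (min_le_left _ _)) t ⟨h0, by linarith [ht.2]⟩
  · simpa using h₂ y (hy.trans_le (min_le_right _ _)) (-t) ⟨by linarith, by linarith [ht.1]⟩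

theorem hasFDerivAt_of_linearization {x : E} {T t : ℝ} (ht : t ∈ Set.Icc (-T) T)
    {A : ℝ → E →L[ℝ] E} (hA : ∀ ε > 0, ∃ δ > 0, ∀ y, ‖y‖ < δ →
      ∀ t ∈ Set.Icc (-T) T, ‖Φ t (x + y) - Φ t x - A t y‖ ≤ ε * ‖y‖) :
    HasFDerivAt (Φ t) (A t) x := by
  rw [hasFDerivAt_iff_isLittleO_nhds_zero, Asymptotics.isLittleO_iff]
  intro ε hε
  obtain ⟨δ, hδ, h⟩ := hA ε hε
  filter_upwards [Metric.ball_mem_nhds (0 : E) hδ] with y hy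
  exact h y (by simpa using hy) t ht

theorem hasFDerivAt [FiniteDimensional ℝ E] (h : IsFlowOf v Φ) (hv : LipschitzWith K v)
    (hd : Differentiable ℝ v) (huc : UniformContinuous (fderiv ℝ v)) (x : E) (t : ℝ) :
    HasFDerivAt (Φ t) (fderiv ℝ (Φ t) x) x := by
  obtain ⟨A, -, hA⟩ := h.exists_linearization hv hd huc x |t|
  exact (hasFDerivAt_of_linearization ⟨neg_abs_le t, le_abs_self t⟩ hA).differentiableAt.hasFDerivAt

/-- The rescaled difference of nearby trajectories converges to the linearised flow. -/
theorem tendsto_rescaled [FiniteDimensional ℝ E] (h : IsFlowOf v Φ) (hv : LipschitzWith K v)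
    (hd : Differentiable ℝ v) (huc : UniformContinuous (fderiv ℝ v)) {ι : Type*} {l : Filter ι}
    {x u : E} {t : ℝ} {τ r : ι → ℝ} {y : ι → E} (hτ : Tendsto τ l (𝓝 t))
    (hr : Tendsto r l (𝓝[>] 0)) (hy : Tendsto (fun i => (r i)⁻¹ • (y i - x)) l (𝓝 u)) :
    Tendsto (fun i => (r i)⁻¹ • (Φ (τ i) (y i) - Φ (τ i) x)) l (𝓝 (fderiv ℝ (Φ t) x u)) := by
  obtain ⟨A, hAc, hA⟩ := h.exists_linearization hv hd huc x (|t| + 1)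
  have ht1 := neg_abs_le t
  have ht2 := le_abs_self t
  rw [(hasFDerivAt_of_linearization ⟨by linarith, by linarith⟩ hA).fderiv]
  have hr0 : Tendsto r l (𝓝 0) := hr.mono_right nhdsWithin_le_nhds
  have hrpos : ∀ᶠ i in l, 0 < r i := hr.eventually self_mem_nhdsWithin
  have hyx : Tendsto (fun i => y i - x) l (𝓝 0) := by
    have := hr0.smul hy
    rw [zero_smul] at this
    refine this.congr' ?_
    filter_upwards [hrpos] with i hi
    rw [smul_smul, mul_inv_cancel₀ hi.ne', one_smul]
  have h1 : Tendsto (fun i => A (τ i) ((r i)⁻¹ • (y i - x))) l (𝓝 (A t u)) :=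
    (isBoundedBilinearMap_apply.continuous.tendsto (A t, u)).comp
      (((hAc.tendsto t).comp hτ).prodMk_nhds hy)
  refine h1.congr_dist (Metric.tendsto_nhds.2 fun ε hε => ?_)
  obtain ⟨δ, hδ, hδ'⟩ := hA (ε / (‖u‖ + 1)) (by positivity)
  have hbd : ∀ᶠ i in l, ‖(r i)⁻¹ • (y i - x)‖ < ‖u‖ + 1 :=
    hy.norm.eventually_lt_const (by linarith)
  have hyδ : ∀ᶠ i in l, ‖y i - x‖ < δ := by
    have := hyx.norm
    rw [norm_zero] at this
    exact this.eventually_lt_const hδ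
  filter_upwards [hbd, hyδ, hrpos, hτ.eventually (Icc_mem_nhds (a := -(|t| + 1)) (b := |t| + 1)
    (by linarith) (by linarith))] with i hi₁ hi₂ hi₃ hi₄
  have := hδ' (y i - x) hi₂ (τ i) hi₄
  rw [add_sub_cancel] at this
  rw [Real.dist_eq, sub_zero, abs_of_nonneg dist_nonneg, dist_comm, dist_eq_norm, map_smul,
    ← smul_sub, norm_smul]
  rw [norm_smul] at hi₁
  have hn : 0 < ‖(r i)⁻¹‖ := by simpa using hi₃.ne'
  calc ‖(r i)⁻¹‖ * ‖Φ (τ i) (y i) - Φ (τ i) x - A (τ i) (y i - x)‖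
      ≤ ‖(r i)⁻¹‖ * (ε / (‖u‖ + 1) * ‖y i - x‖) := mul_le_mul_of_nonneg_left this hn.le
    _ = ε / (‖u‖ + 1) * (‖(r i)⁻¹‖ * ‖y i - x‖) := by ring
    _ < ε / (‖u‖ + 1) * (‖u‖ + 1) := mul_lt_mul_of_pos_left hi₁ (by positivity)
    _ = ε := by field_simp

end IsFlowOf

end GlobalFlows

/-! ### The Reeb vector field and its flow -/

section Reeb

open scoped NNReal

variable {lam : E4 → E4 →L[ℝ] ℝ}

theorem norm_eq_one_of_mem_S3 {x : E4} (hx : x ∈ S3) : ‖x‖ = 1 := by simpa [S3] using hx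

theorem mem_S3_iff {x : E4} : x ∈ S3 ↔ ‖x‖ = 1 := by simp [S3]

theorem inner_self_of_mem_S3 {x : E4} (hx : x ∈ S3) : inner ℝ x x = 1 := by
  rw [real_inner_self_eq_norm_sq, norm_eq_one_of_mem_S3 hx, one_pow]

theorem radialProj_mem {y : E4} (hy : y ≠ 0) : radialProj y ∈ S3 := by
  have : ‖y‖ ≠ 0 := norm_ne_zero_iff.2 hy
  rw [mem_S3_iff, radialProj, norm_smul, norm_inv, norm_norm, inv_mul_cancel₀ this]

theorem radialProj_of_mem {x : E4} (hx : x ∈ S3) : radialProj x = x := by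
  simp [radialProj, norm_eq_one_of_mem_S3 hx]

theorem ne_zero_of_mem_S3 {x : E4} (hx : x ∈ S3) : x ≠ 0 := by
  rintro rfl
  simpa using norm_eq_one_of_mem_S3 hx

theorem contDiffAt_radialProj {y : E4} (hy : y ≠ 0) : ContDiffAt ℝ ∞ radialProj y :=
  ((contDiffAt_norm ℝ hy).inv (norm_ne_zero_iff.2 hy)).smul contDiffAt_id

theorem fderiv_radialProj {x u : E4} (hx : x ∈ S3) (hu : IsTangentS3 x u) :
    fderiv ℝ radialProj x u = u := by
  have hn : ‖x‖ ≠ 0 := by simp [norm_eq_one_of_mem_S3 hx]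
  have h1 := (hasStrictFDerivAt_norm_sq x).hasFDerivAt.sqrt (pow_ne_zero 2 hn)
  simp only [Real.sqrt_sq (norm_nonneg _)] at h1
  have h2 := ((hasDerivAt_inv hn).comp_hasFDerivAt x h1).smul (hasFDerivAt_id x)
  have h3 : HasFDerivAt radialProj _ x := h2
  rw [h3.fderiv]
  have : inner ℝ x u = 0 := hu
  simp [this, norm_eq_one_of_mem_S3 hx]

section ExtD

variable (x u v w : E4) (a : ℝ)

theorem extD_add_left : extD lam x (u + v) w = extD lam x u w + extD lam x v w := by
  simp [extD]; ring
theorem extD_add_right : extD lam x u (v + w) = extD lam x u v + extD lam x u w := by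
  simp [extD]; ring
theorem extD_sub_left : extD lam x (u - v) w = extD lam x u w - extD lam x v w := by
  simp [extD]; ring
theorem extD_smul_left : extD lam x (a • u) w = a * extD lam x u w := by
  simp [extD]; ring
theorem extD_smul_right : extD lam x u (a • w) = a * extD lam x u w := by
  simp [extD]; ring
theorem extD_self : extD lam x u u = 0 := by simp [extD]
theorem extD_swap : extD lam x u w = -extD lam x w u := by simp [extD]
theorem extD_zero_left : extD lam x 0 w = 0 := by simp [extD]

end ExtD

theorem contDiffAt_extD (hlam : ContDiff ℝ ∞ lam) {v w : E4 → E4} {x : E4}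
    (hv : ContDiffAt ℝ ∞ v x) (hw : ContDiffAt ℝ ∞ w x) :
    ContDiffAt ℝ ∞ (fun y => extD lam y (v y) (w y)) x := by
  have h : ContDiff ℝ ∞ (fderiv ℝ lam) := hlam.fderiv_right (by simp)
  exact ((h.contDiffAt.clm_apply hv).clm_apply hw).sub ((h.contDiffAt.clm_apply hw).clm_apply hv)

theorem continuous_extD (hlam : ContDiff ℝ ∞ lam) :
    Continuous fun p : E4 × E4 × E4 => extD lam p.1 p.2.1 p.2.2 := by
  have h : Continuous (fderiv ℝ lam) := hlam.continuous_fderiv (by simp)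
  unfold extD
  fun_prop

/-- The tangential part of the vector representing `lam`. -/
def reebAux (lam : E4 → E4 →L[ℝ] ℝ) (x : E4) : E4 :=
  (InnerProductSpace.toDual ℝ E4).symm (lam x) -
    inner ℝ x ((InnerProductSpace.toDual ℝ E4).symm (lam x)) • x

theorem isTangentS3_reebAux {x : E4} (hx : x ∈ S3) : IsTangentS3 x (reebAux lam x) := by
  simp [IsTangentS3, reebAux, inner_sub_right, inner_smul_right, norm_eq_one_of_mem_S3 hx]

theorem lam_eq_inner_reebAux {x v : E4} (hv : IsTangentS3 x v) :
    lam x v = inner ℝ (reebAux lam x) v := by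
  have h : inner ℝ x v = 0 := hv
  rw [reebAux, inner_sub_left, inner_smul_left, h]
  simp

theorem reebAux_ne_zero (hlam : IsContactForm lam) {x : E4} (hx : x ∈ S3) :
    reebAux lam x ≠ 0 := by
  intro h
  obtain ⟨u, v, w, hu, hv, hw, hne⟩ := hlam.nondegenerate x hx
  apply hne
  have := fun {v} (hv : IsTangentS3 x v) => lam_eq_inner_reebAux (lam := lam) hv
  simp only [h, inner_zero_left] at this
  simp [contactVol, this hu, this hv, this hw]

theorem contDiff_reebAux (hlam : ContDiff ℝ ∞ lam) : ContDiff ℝ ∞ (reebAux lam) := by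
  have h : ContDiff ℝ ∞ fun x => (InnerProductSpace.toDual ℝ E4).symm (lam x) :=
    (InnerProductSpace.toDual ℝ E4).symm.toContinuousLinearEquiv.contDiff.comp hlam
  exact h.sub ((contDiff_id.inner ℝ h).smul contDiff_id)

/-- The contact plane as a subspace. -/
def contactSubmodule (lam : E4 → E4 →L[ℝ] ℝ) (x : E4) : Submodule ℝ E4 :=
  LinearMap.ker ((innerSL ℝ x).toLinearMap.prod (lam x).toLinearMap)

theorem mem_contactSubmodule {x u : E4} : u ∈ contactSubmodule lam x ↔ InContactPlane lam x u := by
  simp [contactSubmodule, InContactPlane, IsTangentS3]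

theorem finrank_contactSubmodule (hlam : IsContactForm lam) {x : E4} (hx : x ∈ S3) :
    Module.finrank ℝ (contactSubmodule lam x) = 2 := by
  set L := (innerSL ℝ x).toLinearMap.prod (lam x).toLinearMap with hL
  have hsurj : Function.Surjective L := by
    rintro ⟨a, b⟩
    have hne : inner ℝ (reebAux lam x) (reebAux lam x) ≠ 0 := by
      simpa using reebAux_ne_zero hlam hx
    refine ⟨a • x + ((b - a * lam x x) / inner ℝ (reebAux lam x) (reebAux lam x)) •
      reebAux lam x, ?_⟩
    have h1 := isTangentS3_reebAux (lam := lam) hx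
    have h2 := lam_eq_inner_reebAux (lam := lam) h1
    have h1' : inner ℝ x (reebAux lam x) = 0 := h1
    refine Prod.ext ?_ ?_
    · simp [hL, inner_add_right, inner_smul_right, h1', norm_eq_one_of_mem_S3 hx]
    · have h3 : ∀ v, (L v).2 = lam x v := fun v => rfl
      rw [h3, map_add, map_smul, map_smul, h2, smul_eq_mul, smul_eq_mul,
        div_mul_cancel₀ _ hne]
      ring
  have := L.finrank_range_add_finrank_ker
  rw [LinearMap.range_eq_top.2 hsurj, finrank_top] at this
  simp only [Module.finrank_prod, Module.finrank_self, finrank_euclideanSpace, Fintype.card_fin]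
    at this
  change Module.finrank ℝ (LinearMap.ker L) = 2
  omega

variable {Z₁ Z₂ : E4 → E4}

/-- Pairing with the frame shows that `Z₁ x`, `Z₂ x` are independent, hence a basis of the
two-dimensional contact plane; the same pairing reads off the coefficients. -/
theorem IsSymplecticFrame.expand (hσ : IsSymplecticFrame lam Z₁ Z₂) (hlam : IsContactForm lam)
    {x u : E4} (hx : x ∈ S3) (hu : InContactPlane lam x u) :
    u = extD lam x u (Z₂ x) • Z₁ x + extD lam x (Z₁ x) u • Z₂ x := by
  have hω := hσ.symplectic x hx
  have h21 : extD lam x (Z₂ x) (Z₁ x) = -1 := by rw [extD_swap, hω]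
  let b : Fin 2 → contactSubmodule lam x :=
    ![⟨Z₁ x, mem_contactSubmodule.2 (hσ.mem₁ x hx)⟩, ⟨Z₂ x, mem_contactSubmodule.2 (hσ.mem₂ x hx)⟩]
  have hb : LinearIndependent ℝ b := by
    rw [LinearIndependent.pair_iff]
    intro s t hst
    have h : s • Z₁ x + t • Z₂ x = 0 := congrArg Subtype.val hst
    constructor
    · have := congrArg (fun v => extD lam x v (Z₂ x)) h
      simpa [extD_add_left, extD_smul_left, hω, extD_self, extD_zero_left] using this
    · have := congrArg (fun v => extD lam x v (Z₁ x)) h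
      simpa [extD_add_left, extD_smul_left, h21, extD_self, extD_zero_left] using this
  have hspan := hb.span_eq_top_of_card_eq_finrank (by
    rw [finrank_contactSubmodule hlam hx]; simp)
  have hmem : (⟨u, mem_contactSubmodule.2 hu⟩ : contactSubmodule lam x) ∈
      Submodule.span ℝ (Set.range b) := hspan ▸ Submodule.mem_top
  rw [Matrix.range_cons_cons_empty, Submodule.mem_span_pair] at hmem
  obtain ⟨s, t, hst⟩ := hmem
  have h : s • Z₁ x + t • Z₂ x = u := congrArg Subtype.val hst
  rw [← h]
  simp [extD_add_left, extD_smul_left, extD_add_right, extD_smul_right, hω, extD_self]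

theorem IsReebVector.unique (hσ : IsSymplecticFrame lam Z₁ Z₂) (hlam : IsContactForm lam)
    {x u v : E4} (hx : x ∈ S3) (hu : IsReebVector lam x u) (hv : IsReebVector lam x v) : u = v := by
  have hmem : InContactPlane lam x (u - v) := by
    refine ⟨?_, by rw [map_sub, hu.2.1, hv.2.1, sub_self]⟩
    have h1 : inner ℝ x u = 0 := hu.1
    have h2 : inner ℝ x v = 0 := hv.1
    simp [IsTangentS3, inner_sub_right, h1, h2]
  have h := hσ.expand hlam hx hmem
  have e₁ : extD lam x (u - v) (Z₂ x) = 0 := by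
    rw [extD_sub_left, hu.2.2 _ (hσ.mem₂ x hx).1, hv.2.2 _ (hσ.mem₂ x hx).1, sub_self]
  have e₂ : extD lam x (Z₁ x) (u - v) = 0 := by
    rw [extD_swap, extD_sub_left, hu.2.2 _ (hσ.mem₁ x hx).1, hv.2.2 _ (hσ.mem₁ x hx).1]
    simp
  rw [e₁, e₂, zero_smul, zero_smul, add_zero] at h
  exact sub_eq_zero.1 h

/-- An explicit formula for the Reeb vector field in terms of a symplectic frame. -/
def reebFormula (lam : E4 → E4 →L[ℝ] ℝ) (Z₁ Z₂ : E4 → E4) (x : E4) : E4 :=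
  (‖reebAux lam x‖ ^ 2)⁻¹ • reebAux lam x
    - extD lam x ((‖reebAux lam x‖ ^ 2)⁻¹ • reebAux lam x) (Z₂ x) • Z₁ x
    + extD lam x ((‖reebAux lam x‖ ^ 2)⁻¹ • reebAux lam x) (Z₁ x) • Z₂ x

/-- Starting from a tangent vector with `lam = 1`, adding contact vectors does not change `lam`. The
two coefficients are chosen to cancel the pairings of `d lam` with `Z₁` and `Z₂`. Any tangent vector
is a combination of `Z₁`, `Z₂` and the resulting vector, so all pairings vanish. -/
theorem isReebVector_reebFormula (hσ : IsSymplecticFrame lam Z₁ Z₂) (hlam : IsContactForm lam)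
    {x : E4} (hx : x ∈ S3) : IsReebVector lam x (reebFormula lam Z₁ Z₂ x) := by
  obtain ⟨v, hv⟩ : ∃ v, v = (‖reebAux lam x‖ ^ 2)⁻¹ • reebAux lam x := ⟨_, rfl⟩
  have hω := hσ.symplectic x hx
  have h21 : extD lam x (Z₂ x) (Z₁ x) = -1 := by rw [extD_swap, hω]
  have ht : IsTangentS3 x v := by
    have h1 : inner ℝ x (reebAux lam x) = 0 := isTangentS3_reebAux hx
    simp [IsTangentS3, hv, inner_smul_right, h1]
  have hl : lam x v = 1 := by
    have hne : ‖reebAux lam x‖ ≠ 0 := norm_ne_zero_iff.2 (reebAux_ne_zero hlam hx)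
    rw [hv, map_smul, lam_eq_inner_reebAux (isTangentS3_reebAux hx), real_inner_self_eq_norm_sq,
      smul_eq_mul, inv_mul_cancel₀ (pow_ne_zero 2 hne)]
  have t₁ : inner ℝ x (Z₁ x) = 0 := (hσ.mem₁ x hx).1
  have t₂ : inner ℝ x (Z₂ x) = 0 := (hσ.mem₂ x hx).1
  have tv : inner ℝ x v = 0 := ht
  have hR : reebFormula lam Z₁ Z₂ x =
    v - extD lam x v (Z₂ x) • Z₁ x + extD lam x v (Z₁ x) • Z₂ x := by rw [hv]; rfl
  have hRt : IsTangentS3 x (reebFormula lam Z₁ Z₂ x) := by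
    rw [hR]
    simp [IsTangentS3, inner_add_right, inner_sub_right, inner_smul_right, t₁, t₂, tv]
  have hRl : lam x (reebFormula lam Z₁ Z₂ x) = 1 := by
    rw [hR]
    simp [(hσ.mem₁ x hx).2, (hσ.mem₂ x hx).2, hl]
  refine ⟨hRt, hRl, fun w hw => ?_⟩
  have e₁ : extD lam x (reebFormula lam Z₁ Z₂ x) (Z₁ x) = 0 := by
    rw [hR, extD_add_left, extD_sub_left, extD_smul_left, extD_smul_left, extD_self, h21]; ring
  have e₂ : extD lam x (reebFormula lam Z₁ Z₂ x) (Z₂ x) = 0 := by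
    rw [hR, extD_add_left, extD_sub_left, extD_smul_left, extD_smul_left, extD_self, hω]; ring
  have hw0 : InContactPlane lam x (w - lam x w • reebFormula lam Z₁ Z₂ x) := by
    have h1 : inner ℝ x w = 0 := hw
    have h2 : inner ℝ x (reebFormula lam Z₁ Z₂ x) = 0 := hRt
    exact ⟨by simp [IsTangentS3, inner_sub_right, inner_smul_right, h1, h2], by simp [hRl]⟩
  have hexp := hσ.expand hlam hx hw0
  have hweq := sub_eq_iff_eq_add.1 hexp
  rw [hweq, extD_add_right, extD_add_right, extD_smul_right, extD_smul_right, extD_smul_right,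
    e₁, e₂, extD_self]
  ring

theorem contDiffAt_reebFormula (hσ : IsSymplecticFrame lam Z₁ Z₂) (hlam : IsContactForm lam)
    {x : E4} (hx : x ∈ S3) : ContDiffAt ℝ ∞ (reebFormula lam Z₁ Z₂) x := by
  have ha := (contDiff_reebAux hlam.smooth).contDiffAt (x := x)
  have hne : ‖reebAux lam x‖ ^ 2 ≠ 0 :=
    pow_ne_zero 2 (norm_ne_zero_iff.2 (reebAux_ne_zero hlam hx))
  have hv : ContDiffAt ℝ ∞ (fun x => (‖reebAux lam x‖ ^ 2)⁻¹ • reebAux lam x) x :=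
    ((ha.norm_sq ℝ).inv hne).smul ha
  exact (hv.sub ((contDiffAt_extD hlam.smooth hv hσ.smooth₂.contDiffAt).smul
    hσ.smooth₁.contDiffAt)).add
    ((contDiffAt_extD hlam.smooth hv hσ.smooth₁.contDiffAt).smul hσ.smooth₂.contDiffAt)

/-- `Y` is a smooth vector field on `ℝ⁴` that is tangent to all spheres around the origin and
extends the Reeb vector field, and `Φ` is its flow. -/
structure IsReebModel (lam : E4 → E4 →L[ℝ] ℝ) (Y : E4 → E4) (Φ : ℝ → E4 → E4) (K : ℝ≥0) :
    Prop where
  smooth : ContDiff ℝ ∞ Y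
  lipschitz : LipschitzWith K Y
  uniform : UniformContinuous (fderiv ℝ Y)
  tangent : ∀ y, inner ℝ y (Y y) = 0
  reeb : ∀ x ∈ S3, IsReebVector lam x (Y x)
  field : ∀ x ∈ S3, reebField lam x = Y x
  flow : IsFlowOf Y Φ

/-- `reebField` and `reebFlow` are made by choice. Replacing them by a compactly supported smooth
field on `ℝ⁴` allows the flow to be studied with ordinary calculus in a vector space. -/
theorem exists_isReebModel (hσ : IsSymplecticFrame lam Z₁ Z₂) (hlam : IsContactForm lam) :
    ∃ Y Φ K, IsReebModel lam Y Φ K := by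
  -- The difference `b₁ - b₂` is `1` on the sphere and `0` near the origin, where the degree-zero
  -- extension is singular.
  let b₁ : ContDiffBump (0 : E4) := ⟨1, 2, by norm_num, by norm_num⟩
  let b₂ : ContDiffBump (0 : E4) := ⟨1 / 4, 1 / 2, by norm_num, by norm_num⟩
  let Y : E4 → E4 := fun y => (b₁ y - b₂ y) • reebFormula lam Z₁ Z₂ (radialProj y)
  have hsm : ContDiff ℝ ∞ Y := by
    rw [contDiff_iff_contDiffAt]
    intro y
    rcases eq_or_ne y 0 with rfl | hy
    · refine contDiffAt_const (c := (0 : E4)) |>.congr_of_eventuallyEq ?_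
      filter_upwards [Metric.closedBall_mem_nhds (0 : E4) (show (0 : ℝ) < 1 / 4 by norm_num)]
        with z hz
      have h1 : b₁ z = 1 := b₁.one_of_mem_closedBall
        (Metric.closedBall_subset_closedBall (show (1 / 4 : ℝ) ≤ 1 by norm_num) hz)
      have h2 : b₂ z = 1 := b₂.one_of_mem_closedBall hz
      simp [Y, h1, h2]
    · exact (b₁.contDiff.contDiffAt.sub b₂.contDiff.contDiffAt).smul
        ((contDiffAt_reebFormula hσ hlam (radialProj_mem hy)).comp y (contDiffAt_radialProj hy))
  have hcs : HasCompactSupport Y := by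
    have : HasCompactSupport fun y => b₁ y - b₂ y := b₁.hasCompactSupport.sub b₂.hasCompactSupport
    exact this.smul_right
  have hYS : ∀ x ∈ S3, Y x = reebFormula lam Z₁ Z₂ x := fun x hx => by
    have hn := norm_eq_one_of_mem_S3 hx
    have h1 : b₁ x = 1 := b₁.one_of_mem_closedBall (by simp [b₁, hn])
    have h2 : b₂ x = 0 := b₂.zero_of_le_dist (by simp [b₂, hn]; norm_num)
    simp [Y, h1, h2, radialProj_of_mem hx]
  have hreeb : ∀ x ∈ S3, IsReebVector lam x (Y x) := fun x hx => by
    rw [hYS x hx]; exact isReebVector_reebFormula hσ hlam hx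
  obtain ⟨K, hK⟩ := (hsm.of_le (by simp : (1 : WithTop ℕ∞) ≤ ∞)).lipschitzWith_of_hasCompactSupport
    hcs (by simp)
  obtain ⟨C, hC⟩ := hcs.exists_bound_of_continuous hsm.continuous
  obtain ⟨Φ, hΦ⟩ := exists_isFlowOf (L := ⟨|C|, abs_nonneg C⟩) hK
    (fun x => (hC x).trans (le_abs_self C))
  refine ⟨Y, Φ, K, hsm, hK, ?_, fun y => ?_, hreeb, fun x hx => ?_, hΦ⟩
  · exact (hcs.fderiv ℝ).uniformContinuous_of_continuous (hsm.continuous_fderiv (by simp))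
  · rcases eq_or_ne y 0 with rfl | hy
    · simp
    · have h : inner ℝ (radialProj y) (reebFormula lam Z₁ Z₂ (radialProj y)) = 0 :=
        (isReebVector_reebFormula hσ hlam (radialProj_mem hy)).1
      have hn : ‖y‖ ≠ 0 := norm_ne_zero_iff.2 hy
      rw [radialProj, inner_smul_left] at h
      have := (mul_eq_zero.1 h).resolve_left (by simpa using hn)
      simp only [Y, inner_smul_right]
      rw [radialProj, this, mul_zero]
  · have hex : ∃ v, IsReebVector lam x v := ⟨_, hreeb x hx⟩
    rw [reebField, dif_pos hex]
    exact hex.choose_spec.unique hσ hlam hx (hreeb x hx)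

namespace IsReebModel

variable {Y : E4 → E4} {Φ : ℝ → E4 → E4} {K : ℝ≥0}

theorem norm_flow (h : IsReebModel lam Y Φ K) (t : ℝ) (x : E4) : ‖Φ t x‖ = ‖x‖ := by
  have hd : ∀ s, HasDerivAt (fun s => ‖Φ s x‖ ^ 2) 0 s := fun s => by
    simpa [h.tangent] using (h.flow.deriv x s).norm_sq
  have := is_const_of_deriv_eq_zero (fun s => (hd s).differentiableAt) (fun s => (hd s).deriv) t 0
  simp only [h.flow.zero] at this
  exact (pow_left_inj₀ (norm_nonneg _) (norm_nonneg _) two_ne_zero).1 this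

theorem flow_mem (h : IsReebModel lam Y Φ K) (t : ℝ) {x : E4} (hx : x ∈ S3) : Φ t x ∈ S3 := by
  rw [mem_S3_iff, h.norm_flow, norm_eq_one_of_mem_S3 hx]

theorem isReebTrajectory (h : IsReebModel lam Y Φ K) {x : E4} (hx : x ∈ S3) :
    IsReebTrajectory lam (fun t => Φ t x) := fun t => by
  refine ⟨h.flow_mem t hx, ?_⟩
  rw [h.field _ (h.flow_mem t hx)]
  exact h.flow.deriv x t

theorem eq_of_isReebTrajectory (h : IsReebModel lam Y Φ K) {c : ℝ → E4}
    (hc : IsReebTrajectory lam c) (t : ℝ) : c t = Φ t (c 0) :=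
  h.flow.eq_of_hasDerivAt h.lipschitz (fun t => by
    have := (hc t).2
    rwa [h.field _ (hc t).1] at this) t

theorem reebFlow_eq (h : IsReebModel lam Y Φ K) (t : ℝ) {x : E4} (hx : x ∈ S3) :
    reebFlow lam t x = Φ t x := by
  have hex : ∃ c, IsReebTrajectory lam c ∧ c 0 = x :=
    ⟨_, h.isReebTrajectory hx, h.flow.zero x⟩
  rw [reebFlow, dif_pos hex, h.eq_of_isReebTrajectory hex.choose_spec.1, hex.choose_spec.2]

theorem continuous_flow (h : IsReebModel lam Y Φ K) : Continuous fun p : ℝ × E4 => Φ p.1 p.2 :=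
  h.flow.continuous h.lipschitz

theorem flow_add (h : IsReebModel lam Y Φ K) (s t : ℝ) (x : E4) : Φ (s + t) x = Φ s (Φ t x) :=
  h.flow.add h.lipschitz s t x

theorem hasFDerivAt_flow (h : IsReebModel lam Y Φ K) (t : ℝ) (x : E4) :
    HasFDerivAt (Φ t) (fderiv ℝ (Φ t) x) x :=
  h.flow.hasFDerivAt h.lipschitz (h.smooth.differentiable (by simp)) h.uniform x t

theorem tendsto_rescaled (h : IsReebModel lam Y Φ K) {ι : Type*} {l : Filter ι}
    {x u : E4} {t : ℝ} {τ r : ι → ℝ} {y : ι → E4} (hτ : Tendsto τ l (𝓝 t))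
    (hr : Tendsto r l (𝓝[>] 0)) (hy : Tendsto (fun i => (r i)⁻¹ • (y i - x)) l (𝓝 u)) :
    Tendsto (fun i => (r i)⁻¹ • (Φ (τ i) (y i) - Φ (τ i) x)) l (𝓝 (fderiv ℝ (Φ t) x u)) :=
  h.flow.tendsto_rescaled h.lipschitz (h.smooth.differentiable (by simp)) h.uniform hτ hr hy

theorem linReebFlow_eq (h : IsReebModel lam Y Φ K) (t : ℝ) {x u : E4} (hx : x ∈ S3)
    (hu : IsTangentS3 x u) : linReebFlow lam t x u = fderiv ℝ (Φ t) x u := by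
  have hev : (fun y => reebFlow lam t (radialProj y)) =ᶠ[𝓝 x] fun y => Φ t (radialProj y) := by
    filter_upwards [isOpen_ne.mem_nhds (ne_zero_of_mem_S3 hx)] with y hy
    exact h.reebFlow_eq t (radialProj_mem hy)
  have h1 := (contDiffAt_radialProj (ne_zero_of_mem_S3 hx)).differentiableAt (by simp)
  have h2 : HasFDerivAt (Φ t) (fderiv ℝ (Φ t) x) (radialProj x) := by
    rw [radialProj_of_mem hx]; exact h.hasFDerivAt_flow t x
  have h3 : HasFDerivAt (fun y => Φ t (radialProj y)) _ x := h2.comp x h1.hasFDerivAt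
  rw [linReebFlow, hev.fderiv_eq, h3.fderiv]
  simp [fderiv_radialProj hx hu]

theorem fderiv_flow_add (h : IsReebModel lam Y Φ K) (s t : ℝ) (x u : E4) :
    fderiv ℝ (Φ (s + t)) x u = fderiv ℝ (Φ s) (Φ t x) (fderiv ℝ (Φ t) x u) := by
  have : Φ (s + t) = Φ s ∘ Φ t := funext fun y => h.flow_add s t y
  rw [this, ((h.hasFDerivAt_flow s _).comp x (h.hasFDerivAt_flow t x)).fderiv]
  rfl

theorem fderiv_flow_zero (h : IsReebModel lam Y Φ K) (x u : E4) : fderiv ℝ (Φ 0) x u = u := by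
  have : Φ 0 = id := funext fun y => h.flow.zero y
  simp [this]

/-- Differentiation of `Φ t (Φ s x) = Φ (t + s) x` at `s = 0`. -/
theorem fderiv_flow_field (h : IsReebModel lam Y Φ K) (t : ℝ) (x : E4) :
    fderiv ℝ (Φ t) x (Y x) = Y (Φ t x) := by
  have h1 : HasDerivAt (fun s => Φ t (Φ s x)) (fderiv ℝ (Φ t) x (Y x)) 0 := by
    have h2 := h.flow.deriv x 0
    have h3 : HasFDerivAt (Φ t) (fderiv ℝ (Φ t) x) (Φ 0 x) := by
      rw [h.flow.zero]; exact h.hasFDerivAt_flow t x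
    have := h3.comp_hasDerivAt 0 h2
    rwa [h.flow.zero] at this
  have h4 : HasDerivAt (fun s => Φ t (Φ s x)) (Y (Φ t x)) 0 := by
    have := (h.flow.deriv x (t + 0)).comp_const_add t 0
    simpa [h.flow_add, h.flow.zero] using this
  exact h1.unique h4

theorem fderiv_flow_neg_apply (h : IsReebModel lam Y Φ K) (t : ℝ) (x u : E4) :
    fderiv ℝ (Φ (-t)) (Φ t x) (fderiv ℝ (Φ t) x u) = u := by
  rw [← h.fderiv_flow_add, neg_add_cancel, h.fderiv_flow_zero]

theorem isTangentS3_fderiv_flow (h : IsReebModel lam Y Φ K) (t : ℝ) {x u : E4}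
    (hu : IsTangentS3 x u) : IsTangentS3 (Φ t x) (fderiv ℝ (Φ t) x u) := by
  have h1 := (h.hasFDerivAt_flow t x).norm_sq
  have h2 : (fun y => ‖Φ t y‖ ^ 2) = fun y => ‖y‖ ^ 2 := by funext y; rw [h.norm_flow]
  rw [h2] at h1
  have h3 := congrArg (fun L => L u) (h1.unique (hasStrictFDerivAt_norm_sq x).hasFDerivAt)
  have hu' : inner ℝ x u = 0 := hu
  simpa [hu', IsTangentS3] using h3

end IsReebModel

end Reeb

/-! ### Local coordinates adapted to an embedded disk -/

section Charts

variable {f : ℂ → E4}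

theorem IsEmbeddedDisk.mem_S3 (hE : IsEmbeddedDisk f) {z : ℂ}
    (hz : z ∈ Metric.closedBall (0 : ℂ) 1) : f z ∈ S3 := hE.mapsTo hz

theorem IsEmbeddedDisk.isCompact_diskImage (hE : IsEmbeddedDisk f) : IsCompact (diskImage f) :=
  (isCompact_closedBall 0 1).image hE.smooth.continuous

theorem IsEmbeddedDisk.hasFDerivAt (hE : IsEmbeddedDisk f) (z : ℂ) :
    HasFDerivAt f (fderiv ℝ f z) z :=
  (hE.smooth.differentiable (by simp) z).hasFDerivAt

/-- Only the closed disk is known to map into `S³`. At its boundary points `‖f‖²` is constant merely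
on one side, which still determines the derivative because a convex set with interior has unique
differentials. -/
theorem IsEmbeddedDisk.isTangentS3_fderiv (hE : IsEmbeddedDisk f) {z : ℂ}
    (hz : z ∈ Metric.closedBall (0 : ℂ) 1) (v : ℂ) : IsTangentS3 (f z) (fderiv ℝ f z v) := by
  have hud : UniqueDiffWithinAt ℝ (Metric.closedBall (0 : ℂ) 1) z :=
    uniqueDiffOn_convex (convex_closedBall 0 1)
      ⟨0, Metric.ball_subset_interior_closedBall (Metric.mem_ball_self one_pos)⟩ z hz
  have h1 : HasFDerivWithinAt (fun y => ‖f y‖ ^ 2)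
      (2 • (innerSL ℝ (f z)).comp (fderiv ℝ f z)) (Metric.closedBall 0 1) z :=
    (hE.hasFDerivAt z).norm_sq.hasFDerivWithinAt
  have h2 : HasFDerivWithinAt (fun y => ‖f y‖ ^ 2) (0 : ℂ →L[ℝ] ℝ) (Metric.closedBall 0 1) z :=
    (hasFDerivWithinAt_const (1 : ℝ) z _).congr
      (fun y hy => by rw [norm_eq_one_of_mem_S3 (hE.mem_S3 hy), one_pow])
      (by rw [norm_eq_one_of_mem_S3 (hE.mem_S3 hz), one_pow])
  have h3 := congrArg (fun L => L v) (hud.eq h1 h2)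
  simpa [IsTangentS3] using h3

/-- Continuity of the inverse of the embedding: the image of the compact remainder of the disk is
closed and, by injectivity, misses `f w`. -/
theorem IsEmbeddedDisk.eventually_preimage_mem (hE : IsEmbeddedDisk f) {w : ℂ}
    (hw : w ∈ Metric.closedBall (0 : ℂ) 1) {N : Set ℂ} (hN : N ∈ 𝓝 w) :
    ∀ᶠ y in 𝓝 (f w), ∀ z ∈ Metric.closedBall (0 : ℂ) 1, f z = y → z ∈ N := by
  have hK : IsCompact (f '' (Metric.closedBall 0 1 \ interior N)) :=
    ((isCompact_closedBall 0 1).diff isOpen_interior).image hE.smooth.continuous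
  have hnot : f w ∉ f '' (Metric.closedBall 0 1 \ interior N) := by
    rintro ⟨z, ⟨hz, hz'⟩, hzw⟩
    rw [hE.injOn hz hw hzw] at hz'
    exact hz' (mem_interior_iff_mem_nhds.2 hN)
  filter_upwards [hK.isClosed.isOpen_compl.mem_nhds hnot] with y hy z hz hzy
  by_contra hcon
  exact hy ⟨z, ⟨hz, fun h => hcon (interior_subset h)⟩, hzy⟩

/-- Local coordinates `y = f (ζ y) + s y • n + β y • f w` of `ℝ⁴` near the point `f w` of an
embedded disk. -/
structure DiskChart (f : ℂ → E4) (w : ℂ) where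
  ζ : E4 → ℂ
  s : E4 → ℝ
  β : E4 → ℝ
  n : E4
  contDiff_ζ : ContDiffAt ℝ 2 ζ (f w)
  contDiff_s : ContDiffAt ℝ 2 s (f w)
  contDiff_β : ContDiffAt ℝ 2 β (f w)
  tangent : inner ℝ (f w) n = 0
  right : ∀ᶠ y in 𝓝 (f w), f (ζ y) + s y • n + β y • f w = y
  left : ∀ᶠ z in 𝓝 w, ζ (f z) = z ∧ s (f z) = 0 ∧ β (f z) = 0

/-- Inverse function theorem for `(z, a, b) ↦ f z + a • n + b • f w`. The tangent plane of the disk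
and the radius span at most three dimensions, which leaves room for the normal `n`. Since `f` is
smooth on all of `ℂ`, boundary points need no separate treatment. -/
theorem exists_diskChart (hE : IsEmbeddedDisk f) {w : ℂ}
    (hw : w ∈ Metric.closedBall (0 : ℂ) 1) : Nonempty (DiskChart f w) := by
  set x := f w with hx
  have hxS : x ∈ S3 := hE.mem_S3 hw
  set D := fderiv ℝ f w with hD
  set V : Submodule ℝ E4 := LinearMap.range D.toLinearMap ⊔ Submodule.span ℝ {x} with hV
  have hVne : Vᗮ ≠ ⊥ := by
    intro hbot
    rw [Submodule.orthogonal_eq_bot_iff] at hbot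
    have h1 : Module.finrank ℝ V ≤ 2 + 1 := by
      refine (Submodule.finrank_add_le_finrank_add_finrank _ _).trans (add_le_add ?_ ?_)
      · exact (LinearMap.finrank_range_le _).trans (by simp)
      · exact (finrank_span_le_card ({x} : Set E4)).trans (by simp)
    rw [hbot, finrank_top] at h1
    simp at h1
  obtain ⟨n, hnV, hn⟩ := Submodule.exists_mem_ne_zero_of_ne_bot hVne
  have hnD : ∀ v, inner ℝ (D v) n = 0 := fun v =>
    (Submodule.mem_orthogonal V n).1 hnV _ (Submodule.mem_sup_left ⟨v, rfl⟩)
  have hnx : inner ℝ x n = 0 := (Submodule.mem_orthogonal V n).1 hnV _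
    (Submodule.mem_sup_right (Submodule.mem_span_singleton_self x))
  have hxD : ∀ v, inner ℝ x (D v) = 0 := hE.isTangentS3_fderiv hw
  let F : ℂ × ℝ × ℝ → E4 := fun p => f p.1 + p.2.1 • n + p.2.2 • x
  have hF : ContDiff ℝ 2 F :=
    (((contDiff_infty.1 hE.smooth 2).comp contDiff_fst).add
      ((contDiff_fst.comp contDiff_snd).smul contDiff_const)).add
      ((contDiff_snd.comp contDiff_snd).smul contDiff_const)
  have hF' : HasFDerivAt F _ (w, 0, 0) :=
    (((hE.hasFDerivAt w).comp (w, (0 : ℝ), (0 : ℝ)) hasFDerivAt_fst).add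
      ((hasFDerivAt_fst.comp (w, (0 : ℝ), (0 : ℝ)) hasFDerivAt_snd).smul_const n)).add
      ((hasFDerivAt_snd.comp (w, (0 : ℝ), (0 : ℝ)) hasFDerivAt_snd).smul_const x)
  obtain ⟨L, hL⟩ : ∃ L : ℂ × ℝ × ℝ →L[ℝ] E4, HasFDerivAt F L (w, 0, 0) ∧
      ∀ p, L p = D p.1 + p.2.1 • n + p.2.2 • x := ⟨_, hF', fun p => by simp [hD]⟩
  have hinj : Function.Injective L := by
    rw [injective_iff_map_eq_zero]
    rintro ⟨v, a, b⟩ hp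
    rw [hL.2] at hp
    have e₁ := congrArg (fun y => inner ℝ y n) hp
    have e₂ := congrArg (fun y => inner ℝ x y) hp
    simp only [inner_add_left, inner_smul_left, hnD, hnx, inner_zero_left] at e₁
    simp only [inner_add_right, inner_smul_right, hxD, hnx, inner_zero_right,
      inner_self_of_mem_S3 hxS] at e₂
    have ha : a = 0 := by simpa [hn] using e₁
    have hb : b = 0 := by simpa using e₂
    subst ha hb
    have hv : D v = D 0 := by simpa using hp
    have := hE.immersion w hw hv
    simp [this]
  let e : (ℂ × ℝ × ℝ) ≃L[ℝ] E4 :=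
    (LinearMap.linearEquivOfInjective L.toLinearMap hinj (by simp)).toContinuousLinearEquiv
  have he : (e : (ℂ × ℝ × ℝ) →L[ℝ] E4) = L := ContinuousLinearMap.ext fun p => rfl
  have hFe : HasFDerivAt F (e : (ℂ × ℝ × ℝ) →L[ℝ] E4) (w, 0, 0) := by rw [he]; exact hL.1
  have hFc : ContDiffAt ℝ 2 F (w, 0, 0) := hF.contDiffAt
  have hst := hFc.hasStrictFDerivAt' hFe two_ne_zero
  set g : E4 → ℂ × ℝ × ℝ := hFc.localInverse hFe two_ne_zero with hg
  have hFw : F (w, 0, 0) = x := by simp [F, hx]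
  have hgc : ContDiffAt ℝ 2 g x := by
    have := hFc.to_localInverse hFe two_ne_zero
    rwa [hFw] at this
  have hright : ∀ᶠ y in 𝓝 x, F (g y) = y := by
    have := hst.eventually_right_inverse
    rwa [hFw] at this
  have hleft : ∀ᶠ p in 𝓝 (w, (0 : ℝ), (0 : ℝ)), g (F p) = p := hst.eventually_left_inverse
  refine ⟨⟨fun y => (g y).1, fun y => (g y).2.1, fun y => (g y).2.2, n, hgc.fst, hgc.snd.fst,
    hgc.snd.snd, hnx, hright, ?_⟩⟩
  have hcont : Tendsto (fun z : ℂ => (z, (0 : ℝ), (0 : ℝ))) (𝓝 w) (𝓝 (w, 0, 0)) :=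
    (Continuous.prodMk_left (0, 0)).continuousAt
  filter_upwards [hcont.eventually hleft] with z hz
  have : F (z, 0, 0) = f z := by simp [F]
  rw [this] at hz
  simp [hz]

namespace DiskChart

variable {w : ℂ} (C : DiskChart f w)

include C

theorem ζ_self : C.ζ (f w) = w := C.left.self_of_nhds.1
theorem s_self : C.s (f w) = 0 := C.left.self_of_nhds.2.1
theorem β_self : C.β (f w) = 0 := C.left.self_of_nhds.2.2

theorem continuousAt_ζ : ContinuousAt C.ζ (f w) := C.contDiff_ζ.continuousAt

theorem eventually_disk (hE : IsEmbeddedDisk f) (hw : w ∈ Metric.closedBall (0 : ℂ) 1) :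
    ∀ᶠ y in 𝓝 (f w), ∀ z ∈ Metric.closedBall (0 : ℂ) 1, f z = y →
      C.ζ y = z ∧ C.s y = 0 := by
  filter_upwards [hE.eventually_preimage_mem hw C.left] with y hy z hz hzy
  obtain ⟨h1, h2, -⟩ := hy z hz hzy
  rw [← hzy]
  exact ⟨h1, h2⟩

/-- When `s` vanishes, `y` and `f (ζ y)` are two points of the sphere differing by `β • f w`.
Comparing norms gives `β (2⟨f ζ, f w⟩ + β) = 0`, whose second factor is close to `2`. -/
theorem eventually_mem (hE : IsEmbeddedDisk f) (hw : w ∈ Metric.closedBall (0 : ℂ) 1) :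
    ∀ᶠ y in 𝓝 (f w), y ∈ S3 → C.s y = 0 → ‖C.ζ y‖ ≤ 1 → y ∈ diskImage f := by
  have h1 : Tendsto (fun y => 2 * inner ℝ (f (C.ζ y)) (f w) + C.β y) (𝓝 (f w)) (𝓝 2) := by
    have hc : ContinuousAt (fun y => 2 * inner ℝ (f (C.ζ y)) (f w) + C.β y) (f w) :=
      (continuousAt_const.mul ((hE.smooth.continuous.continuousAt.comp C.continuousAt_ζ).inner
        continuousAt_const)).add C.contDiff_β.continuousAt
    have := hc.tendsto
    simpa [C.ζ_self, C.β_self, norm_eq_one_of_mem_S3 (hE.mem_S3 hw)] using this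
  filter_upwards [C.right, h1.eventually_ne two_ne_zero] with y hy hne hyS hs hζ
  have hfz : f (C.ζ y) ∈ S3 := hE.mem_S3 (by simpa using hζ)
  rw [hs, zero_smul, add_zero] at hy
  have h2 : ‖f (C.ζ y) + C.β y • f w‖ ^ 2 = 1 := by
    rw [hy, norm_eq_one_of_mem_S3 hyS, one_pow]
  rw [norm_add_sq_real, norm_smul, inner_smul_right, norm_eq_one_of_mem_S3 hfz,
    norm_eq_one_of_mem_S3 (hE.mem_S3 hw), mul_one, Real.norm_eq_abs, sq_abs] at h2
  have h3 : C.β y * (2 * inner ℝ (f (C.ζ y)) (f w) + C.β y) = 0 := by linarith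
  have hβ := (mul_eq_zero.1 h3).resolve_right hne
  rw [hβ, zero_smul, add_zero] at hy
  exact ⟨C.ζ y, by simpa using hζ, hy⟩

theorem eventually_expand (hE : IsEmbeddedDisk f) : ∀ᶠ y in 𝓝 (f w), ∀ u,
    fderiv ℝ f (C.ζ y) (fderiv ℝ C.ζ y u) + fderiv ℝ C.s y u • C.n + fderiv ℝ C.β y u • f w =
      u := by
  filter_upwards [C.right.eventually_nhds, C.contDiff_ζ.eventually (by simp),
    C.contDiff_s.eventually (by simp), C.contDiff_β.eventually (by simp)] with y hy h1 h2 h3 u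
  have d1 := (h1.differentiableAt two_ne_zero).hasFDerivAt
  have d2 := (h2.differentiableAt two_ne_zero).hasFDerivAt
  have d3 := (h3.differentiableAt two_ne_zero).hasFDerivAt
  have hd := (((hE.hasFDerivAt (C.ζ y)).comp y d1).add (d2.smul_const C.n)).add
    (d3.smul_const (f w))
  have hid : HasFDerivAt (fun y => y) (ContinuousLinearMap.id ℝ E4) y := hasFDerivAt_id y
  have := congrArg (fun L => L u) ((hid.congr_of_eventuallyEq hy).unique hd)
  simpa using this.symm

theorem fderiv_ζ_apply (hE : IsEmbeddedDisk f) (v : ℂ) :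
    fderiv ℝ C.ζ (f w) (fderiv ℝ f w v) = v := by
  have d1 := (C.contDiff_ζ.differentiableAt two_ne_zero).hasFDerivAt.comp w (hE.hasFDerivAt w)
  have hev : (C.ζ ∘ f) =ᶠ[𝓝 w] id := C.left.mono fun z hz => hz.1
  have := congrArg (fun L => L v) (((hasFDerivAt_id w).congr_of_eventuallyEq hev).unique d1)
  simpa using this.symm

theorem fderiv_s_apply (hE : IsEmbeddedDisk f) (v : ℂ) :
    fderiv ℝ C.s (f w) (fderiv ℝ f w v) = 0 := by
  have d1 := (C.contDiff_s.differentiableAt two_ne_zero).hasFDerivAt.comp w (hE.hasFDerivAt w)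
  have hev : (C.s ∘ f) =ᶠ[𝓝 w] fun _ => 0 := C.left.mono fun z hz => hz.2.1
  have := congrArg (fun L => L v)
    (((hasFDerivAt_const (0 : ℝ) w).congr_of_eventuallyEq hev).unique d1)
  simpa using this.symm

theorem expand (hE : IsEmbeddedDisk f) (hw : w ∈ Metric.closedBall (0 : ℂ) 1) {u : E4}
    (hu : IsTangentS3 (f w) u) :
    u = fderiv ℝ f w (fderiv ℝ C.ζ (f w) u) + fderiv ℝ C.s (f w) u • C.n := by
  have h1 := (C.eventually_expand hE).self_of_nhds u
  rw [C.ζ_self] at h1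
  have h2 := congrArg (fun y => inner ℝ (f w) y) h1
  have h3 : inner ℝ (f w) (fderiv ℝ f w (fderiv ℝ C.ζ (f w) u)) = 0 :=
    hE.isTangentS3_fderiv hw _
  have h4 : inner ℝ (f w) u = 0 := hu
  simp only [inner_add_right, inner_smul_right, h3, C.tangent, h4,
    inner_self_of_mem_S3 (hE.mem_S3 hw)] at h2
  have h5 : fderiv ℝ C.β (f w) u = 0 := by linarith
  rw [h5, zero_smul, add_zero] at h1
  exact h1.symm

end DiskChart

end Charts

/-! ### Intersections of trajectories with an embedded disk -/

section HitAnalysis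

open scoped NNReal

/-- A function with derivative bounded away from zero and small central value has exactly one
zero. -/
theorem existsUnique_zero_of_deriv_pos {σ σ' : ℝ → ℝ} {t δ m : ℝ} (hδ : 0 < δ) (hm : 0 < m)
    (hd : ∀ s ∈ Set.Icc (t - δ) (t + δ), HasDerivAt σ (σ' s) s)
    (hσ : ∀ s ∈ Set.Icc (t - δ) (t + δ), m ≤ σ' s) (h0 : |σ t| < m * δ) :
    ∃! s, s ∈ Set.Icc (t - δ) (t + δ) ∧ σ s = 0 := by
  have hcont : ContinuousOn σ (Set.Icc (t - δ) (t + δ)) := fun s hs =>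
    (hd s hs).continuousAt.continuousWithinAt
  have hdiff : DifferentiableOn ℝ σ (interior (Set.Icc (t - δ) (t + δ))) := fun s hs =>
    (hd s (interior_subset hs)).differentiableAt.differentiableWithinAt
  have hge : ∀ s ∈ interior (Set.Icc (t - δ) (t + δ)), m ≤ _root_.deriv σ s := fun s hs => by
    rw [(hd s (interior_subset hs)).deriv]; exact hσ s (interior_subset hs)
  have hmono := fun {a b : ℝ} (ha : a ∈ Set.Icc (t - δ) (t + δ))
      (hb : b ∈ Set.Icc (t - δ) (t + δ)) (hab : a ≤ b) =>
    (convex_Icc (t - δ) (t + δ)).mul_sub_le_image_sub_of_le_deriv hcont hdiff hge a ha b hb hab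
  have hl : t - δ ∈ Set.Icc (t - δ) (t + δ) := ⟨le_rfl, by linarith⟩
  have hr : t + δ ∈ Set.Icc (t - δ) (t + δ) := ⟨by linarith, le_rfl⟩
  have ht : t ∈ Set.Icc (t - δ) (t + δ) := ⟨by linarith, by linarith⟩
  have h1 := hmono hl ht (by linarith)
  have h2 := hmono ht hr (by linarith)
  rw [abs_lt] at h0
  have hz : (0 : ℝ) ∈ Set.Icc (σ (t - δ)) (σ (t + δ)) := ⟨by linarith, by linarith⟩
  obtain ⟨s, hs, hs0⟩ := intermediate_value_Icc (by linarith) hcont hz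
  refine ⟨s, ⟨hs, hs0⟩, fun s' ⟨hs', hs0'⟩ => ?_⟩
  rcases le_total s s' with h | h
  · have := hmono hs hs' h
    nlinarith
  · have := hmono hs' hs h
    nlinarith

theorem existsUnique_zero_of_deriv {σ σ' : ℝ → ℝ} {t δ m g : ℝ} (hδ : 0 < δ) (hm : 0 < m)
    (hg : g ≠ 0) (hd : ∀ s ∈ Set.Icc (t - δ) (t + δ), HasDerivAt σ (σ' s) s)
    (hσ : ∀ s ∈ Set.Icc (t - δ) (t + δ), m ≤ g * σ' s) (h0 : |g * σ t| < m * δ) :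
    ∃! s, s ∈ Set.Icc (t - δ) (t + δ) ∧ σ s = 0 := by
  have := existsUnique_zero_of_deriv_pos (σ := fun s => g * σ s) hδ hm
    (fun s hs => (hd s hs).const_mul g) hσ h0
  simpa [hg] using this

/-- Strict differentiability is needed because both points move. Along the boundary orbit the
reference point depends on time. -/
theorem HasStrictFDerivAt.tendsto_rescaled {E F : Type*} [NormedAddCommGroup E] [NormedSpace ℝ E]
    [NormedAddCommGroup F] [NormedSpace ℝ F]
    {ψ : E → F} {L : E →L[ℝ] F} {x : E} (hψ : HasStrictFDerivAt ψ L x) {ι : Type*} {l : Filter ι}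
    {p q : ι → E} {r : ι → ℝ} {u : E} (hp : Tendsto p l (𝓝 x)) (hq : Tendsto q l (𝓝 x))
    (h : Tendsto (fun i => (r i)⁻¹ • (p i - q i)) l (𝓝 u)) :
    Tendsto (fun i => (r i)⁻¹ • (ψ (p i) - ψ (q i))) l (𝓝 (L u)) := by
  have ho : (fun i => ψ (p i) - ψ (q i) - L (p i - q i)) =o[l] fun i => p i - q i :=
    hψ.isLittleO.comp_tendsto (hp.prodMk_nhds hq)
  have ho' : (fun i => (r i)⁻¹ • (ψ (p i) - ψ (q i) - L (p i - q i))) =o[l]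
      fun i => (r i)⁻¹ • (p i - q i) := (Asymptotics.isBigO_refl _ l).smul_isLittleO ho
  have hz := (ho'.trans_isBigO (h.isBigO_one ℝ)).tendsto_zero_of_tendsto tendsto_const_nhds
  have := hz.add ((L.continuous.tendsto u).comp h)
  rw [zero_add] at this
  refine this.congr fun i => ?_
  rw [Function.comp_apply, map_smul, ← smul_add, sub_add_cancel]

variable {lam : E4 → E4 →L[ℝ] ℝ} {Y : E4 → E4} {Φ : ℝ → E4 → E4} {K : ℝ≥0} {f : ℂ → E4} {w : ℂ}

/-- The derivative of the coordinate transverse to the disk along the flow. -/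
def DiskChart.speed (C : DiskChart f w) (Y : E4 → E4) (y : E4) : ℝ := fderiv ℝ C.s y (Y y)

theorem DiskChart.contDiffAt_speed (C : DiskChart f w) (h : IsReebModel lam Y Φ K) :
    ContDiffAt ℝ 1 (C.speed Y) (f w) :=
  (C.contDiff_s.fderiv_right (m := 1) (by norm_num)).clm_apply
    (contDiff_infty.1 h.smooth 1).contDiffAt

theorem DiskChart.eventually_hasDerivAt_s (C : DiskChart f w) (h : IsReebModel lam Y Φ K) :
    ∀ᶠ p in 𝓝 (f w), ∀ x t, Φ t x = p → HasDerivAt (fun t => C.s (Φ t x)) (C.speed Y (Φ t x)) t := by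
  filter_upwards [C.contDiff_s.eventually (by simp)] with p hp x t hxt
  subst hxt
  exact (hp.differentiableAt two_ne_zero).hasFDerivAt.comp_hasDerivAt t (h.flow.deriv x t)

/-- As long as `ζ` stays in the closed disk, hits are exactly zeros of `s` along the trajectory.
Near the boundary orbit the speed of `s` degenerates, so it is divided by the distance scale `r`: a
nonzero limit `g` of the rescaled speed and a vanishing limit of the rescaled value at time `t`
force exactly one zero in a small window. -/
theorem DiskChart.exists_simple_hit (C : DiskChart f w) (h : IsReebModel lam Y Φ K)
    (hE : IsEmbeddedDisk f) (hw : w ∈ Metric.closedBall (0 : ℂ) 1) {ι : Type*} {l : Filter ι}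
    {y : ι → E4} {r : ι → ℝ} {t g : ℝ} (hr : ∀ᶠ i in l, 0 < r i) (hy : ∀ᶠ i in l, y i ∈ S3)
    (hp : Tendsto (fun p : ι × ℝ => Φ p.2 (y p.1)) (l ×ˢ 𝓝 t) (𝓝 (f w)))
    (hG : Tendsto (fun p : ι × ℝ => (r p.1)⁻¹ * C.speed Y (Φ p.2 (y p.1))) (l ×ˢ 𝓝 t) (𝓝 g))
    (hg : g ≠ 0) (hs : Tendsto (fun i => (r i)⁻¹ * C.s (Φ t (y i))) l (𝓝 0))
    (hζ : ∀ᶠ p in l ×ˢ 𝓝 t, ‖C.ζ (Φ p.2 (y p.1))‖ ≤ 1) :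
    ∀ δ₀ > 0, ∃ δ > 0, δ < δ₀ ∧
      ∀ᶠ i in l, ∃! s, s ∈ Set.Icc (t - δ) (t + δ) ∧ Φ s (y i) ∈ diskImage f := by
  intro δ₀ hδ₀
  have hg2 : 0 < g * g := mul_self_pos.2 hg
  have hGg : ∀ᶠ p in l ×ˢ 𝓝 t, g * g / 2 < g * ((r p.1)⁻¹ * C.speed Y (Φ p.2 (y p.1))) :=
    (hG.const_mul g).eventually_const_lt (by linarith)
  have hall := (((hp.eventually (C.eventually_mem hE hw)).and
    (hp.eventually (C.eventually_disk hE hw))).and (hp.eventually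
    (C.eventually_hasDerivAt_s h))).and (hGg.and hζ)
  obtain ⟨P, hP, Q, hQ, hPQ⟩ := eventually_prod_iff.1 hall
  obtain ⟨ε, hε, hεQ⟩ := Metric.eventually_nhds_iff_ball.1 hQ
  set δ := min δ₀ ε / 2 with hδ
  have hδpos : 0 < δ := by positivity
  have hδ1 : δ < δ₀ := by have := min_le_left δ₀ ε; linarith
  have hδ2 : δ < ε := by have := min_le_right δ₀ ε; linarith
  refine ⟨δ, hδpos, hδ1, ?_⟩
  have hsm : ∀ᶠ i in l, |g * ((r i)⁻¹ * C.s (Φ t (y i)))| < g * g / 2 * δ := by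
    have := (hs.const_mul g).abs
    rw [mul_zero, abs_zero] at this
    exact this.eventually_lt_const (by positivity)
  filter_upwards [hP, hr, hy, hsm] with i hPi hri hyi hsi
  have hin : ∀ s ∈ Set.Icc (t - δ) (t + δ), Q s := fun s hs => hεQ s (by
    rw [Metric.mem_ball, Real.dist_eq, abs_lt]
    constructor <;> linarith [hs.1, hs.2])
  have hiff : ∀ s ∈ Set.Icc (t - δ) (t + δ), Φ s (y i) ∈ diskImage f ↔ C.s (Φ s (y i)) = 0 := by
    intro s hs
    obtain ⟨⟨⟨h1, h2⟩, -⟩, -, h5⟩ := hPQ hPi (hin s hs)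
    exact ⟨fun ⟨z, hz, hzs⟩ => (h2 z hz hzs).2, fun h0 => h1 (h.flow_mem s hyi) h0 h5⟩
  have hz := existsUnique_zero_of_deriv (σ := fun s => C.s (Φ s (y i)))
    (σ' := fun s => C.speed Y (Φ s (y i))) (t := t) (δ := δ) (m := r i * (g * g / 2)) (g := g) hδpos
    (by positivity) hg (fun s hs => (hPQ hPi (hin s hs)).1.2 _ _ rfl)
    (fun s hs => by
      have h4 := (hPQ hPi (hin s hs)).2.1
      have := mul_lt_mul_of_pos_left h4 hri
      rw [mul_left_comm, mul_inv_cancel_left₀ hri.ne'] at this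
      exact this.le)
    (by
      have := mul_lt_mul_of_pos_left hsi hri
      rwa [← abs_of_pos hri, ← abs_mul, abs_of_pos hri, mul_left_comm,
        mul_inv_cancel_left₀ hri.ne', ← mul_assoc] at this)
  obtain ⟨s, ⟨hs1, hs2⟩, hs3⟩ := hz
  exact ⟨s, ⟨hs1, (hiff s hs1).2 hs2⟩, fun s' ⟨hs1', hs2'⟩ => hs3 s' ⟨hs1', (hiff s' hs1').1 hs2'⟩⟩

/-! #### Behaviour at the boundary orbit -/

section Boundary

variable {x₀ : E4}

theorem DiskChart.eventually_orbit (C : DiskChart f w) (h : IsReebModel lam Y Φ K)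
    (hE : IsEmbeddedDisk f) (hw : w ∈ Metric.sphere (0 : ℂ) 1)
    (hγ : ∀ t, Φ t x₀ ∈ f '' Metric.sphere 0 1) {t : ℝ} (ht : Φ t x₀ = f w) :
    ∀ᶠ t' in 𝓝 t, ‖C.ζ (Φ t' x₀)‖ = 1 ∧ C.s (Φ t' x₀) = 0 ∧ f (C.ζ (Φ t' x₀)) = Φ t' x₀ := by
  have hc : Tendsto (fun t => Φ t x₀) (𝓝 t) (𝓝 (f w)) := by
    rw [← ht]; exact (h.flow.continuous_time x₀).tendsto t
  filter_upwards [hc.eventually (C.eventually_disk hE (Metric.sphere_subset_closedBall hw))]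
    with t' ht'
  obtain ⟨z, hz, hzt⟩ := hγ t'
  obtain ⟨h1, h2⟩ := ht' z (Metric.sphere_subset_closedBall hz) hzt
  rw [h1]
  exact ⟨by simpa using hz, h2, hzt⟩

theorem DiskChart.eventually_speed_eq_zero (C : DiskChart f w) (h : IsReebModel lam Y Φ K)
    (hE : IsEmbeddedDisk f) (hw : w ∈ Metric.sphere (0 : ℂ) 1)
    (hγ : ∀ t, Φ t x₀ ∈ f '' Metric.sphere 0 1) {t : ℝ} (ht : Φ t x₀ = f w) :
    ∀ᶠ t' in 𝓝 t, C.speed Y (Φ t' x₀) = 0 := by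
  have hc : Tendsto (fun t => Φ t x₀) (𝓝 t) (𝓝 (f w)) := by
    rw [← ht]; exact (h.flow.continuous_time x₀).tendsto t
  filter_upwards [(C.eventually_orbit h hE hw hγ ht).eventually_nhds,
    hc.eventually (C.eventually_hasDerivAt_s h)] with t' h1 h2
  have h3 : (fun t => C.s (Φ t x₀)) =ᶠ[𝓝 t'] fun _ => 0 := h1.mono fun s hs => hs.2.1
  exact (h2 x₀ t' rfl).unique ((hasDerivAt_const t' (0 : ℝ)).congr_of_eventuallyEq h3)

theorem complex_expand {w : ℂ} (hw : ‖w‖ = 1) (v : ℂ) :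
    v = inner ℝ w v • w + inner ℝ (Complex.I * w) v • (Complex.I * w) := by
  have h : w.re * w.re + w.im * w.im = 1 := by
    rw [← Complex.normSq_apply, Complex.normSq_eq_norm_sq, hw, one_pow]
  apply Complex.ext
  · simp [Complex.inner]
    linear_combination (-v.re) * h
  · simp [Complex.inner]
    linear_combination (-v.im) * h

/-- Along the boundary orbit, the tangent plane of the disk is spanned by the outward normal and
the Reeb vector field. -/
theorem exists_boundary_decomposition (h : IsReebModel lam Y Φ K)
    (hE : IsEmbeddedDisk f) (hw : w ∈ Metric.sphere (0 : ℂ) 1)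
    (hγ : ∀ t, Φ t x₀ ∈ f '' Metric.sphere 0 1) {t : ℝ} (ht : Φ t x₀ = f w) (v : ℂ) :
    ∃ b : ℝ, fderiv ℝ f w v = inner ℝ w v • outwardNormal f w + b • Y (f w) := by
  have hwn : ‖w‖ = 1 := by simpa using hw
  have hwc := Metric.sphere_subset_closedBall hw
  obtain ⟨C⟩ := exists_diskChart hE hwc
  have hYt : IsTangentS3 (f w) (Y (f w)) := h.tangent _
  have hflow : HasDerivAt (fun t => Φ t x₀) (Y (f w)) t := by
    have := h.flow.deriv x₀ t; rwa [ht] at this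
  set c := fderiv ℝ C.ζ (f w) (Y (f w)) with hc
  have hs0 : fderiv ℝ C.s (f w) (Y (f w)) = 0 := by
    have := (C.eventually_speed_eq_zero h hE hw hγ ht).self_of_nhds
    rwa [ht] at this
  have hYc : Y (f w) = fderiv ℝ f w c := by
    have := C.expand hE hwc hYt
    rwa [hs0, zero_smul, add_zero] at this
  -- The orbit keeps `‖ζ‖ = 1`, so in the parameter disk the Reeb vector points along `I * w`; its
  -- coefficient is nonzero because `lam` is `1` on it.
  have hwc0 : inner ℝ w c = 0 := by
    have hd : HasFDerivAt C.ζ (fderiv ℝ C.ζ (f w)) (Φ t x₀) := by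
      rw [ht]; exact (C.contDiff_ζ.differentiableAt two_ne_zero).hasFDerivAt
    have h1 : HasDerivAt (fun t => C.ζ (Φ t x₀)) c t := hd.comp_hasDerivAt t hflow
    have h2 := h1.norm_sq
    have h3 : (fun t => ‖C.ζ (Φ t x₀)‖ ^ 2) =ᶠ[𝓝 t] fun _ => 1 :=
      (C.eventually_orbit h hE hw hγ ht).mono fun s hs => by
        change ‖C.ζ (Φ s x₀)‖ ^ 2 = 1
        rw [hs.1, one_pow]
    have := h2.unique ((hasDerivAt_const t (1 : ℝ)).congr_of_eventuallyEq h3)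
    rw [ht, C.ζ_self] at this
    linarith
  set κ := inner ℝ (Complex.I * w) c with hκ
  have hcκ : c = κ • (Complex.I * w) := by
    have := complex_expand hwn c
    rwa [hwc0, zero_smul, zero_add] at this
  have hκ0 : κ ≠ 0 := by
    intro h0
    rw [h0, zero_smul] at hcκ
    rw [hcκ, map_zero] at hYc
    have := (h.reeb _ (hE.mem_S3 hwc)).2.1
    rw [hYc, map_zero] at this
    exact zero_ne_one this
  refine ⟨inner ℝ (Complex.I * w) v / κ, ?_⟩
  conv_lhs => rw [complex_expand hwn v, map_add, map_smul, map_smul]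
  rw [hYc, hcκ, map_smul, smul_smul, div_mul_cancel₀ _ hκ0]
  rfl

theorem isTangentS3_outwardNormal (hE : IsEmbeddedDisk f) (hw : w ∈ Metric.sphere (0 : ℂ) 1) :
    IsTangentS3 (f w) (outwardNormal f w) :=
  hE.isTangentS3_fderiv (Metric.sphere_subset_closedBall hw) w

/-- Modulo the Reeb direction, which `d lam` ignores, the tangent plane of the disk is a line along
the boundary. -/
theorem extD_fderiv_outwardNormal (h : IsReebModel lam Y Φ K)
    (hE : IsEmbeddedDisk f) (hw : w ∈ Metric.sphere (0 : ℂ) 1)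
    (hγ : ∀ t, Φ t x₀ ∈ f '' Metric.sphere 0 1) {t : ℝ} (ht : Φ t x₀ = f w) (v : ℂ) :
    extD lam (f w) (fderiv ℝ f w v) (outwardNormal f w) = 0 := by
  obtain ⟨b, hb⟩ := exists_boundary_decomposition h hE hw hγ ht v
  rw [hb, extD_add_left, extD_smul_left, extD_smul_left, extD_self,
    (h.reeb _ (hE.mem_S3 (Metric.sphere_subset_closedBall hw))).2.2 _
      (isTangentS3_outwardNormal hE hw)]
  ring

/-- The coordinate transverse to the disk along the linearised trajectory of the outward normal
is `o(t)` if the speed has zero derivative in the outward direction. -/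
theorem DiskChart.isLittleO_linearized (C : DiskChart f w) (h : IsReebModel lam Y Φ K)
    (hE : IsEmbeddedDisk f) (hw : w ∈ Metric.sphere (0 : ℂ) 1)
    (hγ : ∀ t, Φ t (f w) ∈ f '' Metric.sphere 0 1)
    (h0 : fderiv ℝ (C.speed Y) (f w) (outwardNormal f w) = 0) :
    (fun t => fderiv ℝ C.s (Φ t (f w)) (fderiv ℝ (Φ t) (f w) (outwardNormal f w))) =o[𝓝 0]
      fun t : ℝ => t := by
  set ν := outwardNormal f w with hν
  have hwc := Metric.sphere_subset_closedBall hw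
  have hz : Φ 0 (f w) = f w := h.flow.zero _
  rw [Asymptotics.isLittleO_iff]
  intro ε hε
  have hr0 : Tendsto (fun r : ℝ => r) (𝓝[>] 0) (𝓝 0) := nhdsWithin_le_nhds
  have hyt : Tendsto (fun r : ℝ => f w + r • ν) (𝓝[>] 0) (𝓝 (f w)) := by
    have : Continuous fun r : ℝ => f w + r • ν := by fun_prop
    have := (this.tendsto 0).comp hr0
    simpa [Function.comp_def] using this
  have hrat : Tendsto (fun r : ℝ => r⁻¹ • (f w + r • ν - f w)) (𝓝[>] 0) (𝓝 ν) := by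
    refine tendsto_const_nhds.congr' ?_
    filter_upwards [self_mem_nhdsWithin] with r hr
    rw [add_sub_cancel_left, smul_smul, inv_mul_cancel₀ (ne_of_gt hr), one_smul]
  have hp1 : Tendsto (fun p : ℝ × ℝ => Φ p.2 (f w + p.1 • ν)) (𝓝[>] 0 ×ˢ 𝓝 0) (𝓝 (f w)) := by
    have := (h.continuous_flow.tendsto (0, f w)).comp
      ((tendsto_snd (f := 𝓝[>] (0 : ℝ)) (g := 𝓝 (0 : ℝ))).prodMk_nhds (hyt.comp tendsto_fst))
    simpa [hz, Function.comp_def] using this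
  have hq1 : Tendsto (fun p : ℝ × ℝ => Φ p.2 (f w)) (𝓝[>] 0 ×ˢ 𝓝 0) (𝓝 (f w)) := by
    have := ((h.flow.continuous_time (f w)).tendsto 0).comp
      (tendsto_snd (f := 𝓝[>] (0 : ℝ)) (g := 𝓝 (0 : ℝ)))
    simpa [hz, Function.comp_def] using this
  have hG := ((C.contDiffAt_speed h).hasStrictFDerivAt one_ne_zero).tendsto_rescaled hp1 hq1
    (h.tendsto_rescaled (t := 0) (r := Prod.fst) tendsto_snd tendsto_fst (hrat.comp tendsto_fst))
  rw [h.fderiv_flow_zero, h0] at hG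
  have hev := ((hp1.eventually (C.eventually_hasDerivAt_s h)).and
    ((hG.abs.eventually_lt_const (by simpa using hε)).and
    (tendsto_snd.eventually (C.eventually_speed_eq_zero h hE hw hγ hz))))
  obtain ⟨P, hP, Q, hQ, hPQ⟩ := eventually_prod_iff.1 hev
  obtain ⟨δ, hδ, hδQ⟩ := Metric.eventually_nhds_iff_ball.1 hQ
  have hcd : ∀ᶠ t in 𝓝 (0 : ℝ), DifferentiableAt ℝ C.s (Φ t (f w)) := by
    have : Tendsto (fun t => Φ t (f w)) (𝓝 0) (𝓝 (f w)) := by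
      have := (h.flow.continuous_time (f w)).tendsto 0
      rwa [hz] at this
    filter_upwards [this.eventually (C.contDiff_s.eventually (by simp))] with t ht
    exact ht.differentiableAt two_ne_zero
  filter_upwards [Metric.ball_mem_nhds (0 : ℝ) hδ, hcd, C.eventually_orbit h hE hw hγ hz]
    with t htδ htd hts
  -- As `s` vanishes on the orbit, the quantity is the limit of `r⁻¹ * s` along the trajectory of `f
  -- w + r • ν`. For small `r` this has time derivative at most `ε`, because the speed vanishes on
  -- the orbit and has no first-order variation in direction `ν`. The mean value inequality survives
  -- the limit `r → 0`.
  have hlim : ∀ t : ℝ, DifferentiableAt ℝ C.s (Φ t (f w)) → C.s (Φ t (f w)) = 0 →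
      Tendsto (fun r : ℝ => r⁻¹ * C.s (Φ t (f w + r • ν))) (𝓝[>] 0)
        (𝓝 (fderiv ℝ C.s (Φ t (f w)) (fderiv ℝ (Φ t) (f w) ν))) := by
    intro t hd hs
    have hd1 := (hd.hasFDerivAt.comp (f w) (h.hasFDerivAt_flow t (f w))).hasLineDerivAt ν
    have := hd1.tendsto_slope_zero_right
    simpa [hs] using this
  have hl1 := hlim t htd hts.2.1
  have hl0 := hlim 0 (by rw [hz]; exact C.contDiff_s.differentiableAt two_ne_zero)
    (by rw [hz, C.s_self])
  rw [hz, h.fderiv_flow_zero, hν, outwardNormal, C.fderiv_s_apply hE] at hl0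
  have hl := (hl1.sub hl0).abs
  rw [sub_zero] at hl
  refine le_of_tendsto hl ?_
  filter_upwards [hP, self_mem_nhdsWithin] with r hPr hrpos
  have hrpos : 0 < r := hrpos
  have hmv := (convex_ball (0 : ℝ) δ).norm_image_sub_le_of_norm_hasDerivWithin_le
    (f := fun t => C.s (Φ t (f w + r • ν))) (C := r * ε) (x := 0) (y := t)
    (fun s hs => ((hPQ hPr (hδQ s hs)).1 _ _ rfl).hasDerivWithinAt)
    (fun s hs => by
      have h1 := (hPQ hPr (hδQ s hs)).2.1
      rw [(hPQ hPr (hδQ s hs)).2.2, sub_zero, smul_eq_mul, abs_mul, abs_inv, abs_of_pos hrpos,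
        inv_mul_lt_iff₀ hrpos] at h1
      exact h1.le) (Metric.mem_ball_self hδ) htδ
  have hν' : ν = fderiv ℝ f w w := rfl
  rw [← hν', ← mul_sub, abs_mul, abs_inv, abs_of_pos hrpos, inv_mul_le_iff₀ hrpos]
  rw [sub_zero, Real.norm_eq_abs] at hmv
  linarith

/-- Strong transversality along the boundary orbit, in local coordinates. -/
theorem DiskChart.fderiv_speed_ne_zero (C : DiskChart f w) (h : IsReebModel lam Y Φ K)
    (hlam : IsContactForm lam)
    (hE : IsEmbeddedDisk f) (hw : w ∈ Metric.sphere (0 : ℂ) 1)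
    (hγ : ∀ t, Φ t (f w) ∈ f '' Metric.sphere 0 1) (hstrong : IsBoundaryStrong lam f) :
    fderiv ℝ (C.speed Y) (f w) (outwardNormal f w) ≠ 0 := by
  -- If the derivative were zero, the area function in `IsBoundaryStrong.transverse` would be
  -- `o(t)`.
  intro h0
  have hwc := Metric.sphere_subset_closedBall hw
  have hz : Φ 0 (f w) = f w := h.flow.zero _
  have hxS := hE.mem_S3 hwc
  choose wt hwt hwtf using hγ
  have hwt0 : wt 0 = w := hE.injOn (Metric.sphere_subset_closedBall (hwt 0)) hwc (by rw [hwtf, hz])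
  refine hstrong.transverse wt (fun s => ⟨hwt s, by rw [hwt0, h.reebFlow_eq s hxS, hwtf]⟩) ?_
  rw [hwt0]
  have hγ' : ∀ t, Φ t (f w) ∈ f '' Metric.sphere 0 1 := fun t => ⟨wt t, hwt t, hwtf t⟩
  have hcp : ContinuousAt (fun t => Φ t (f w)) 0 := (h.flow.continuous_time _).continuousAt
  have hcζ : ContinuousAt (fun t => C.ζ (Φ t (f w))) 0 :=
    ContinuousAt.comp (f := fun t => Φ t (f w)) (by rw [hz]; exact C.continuousAt_ζ) hcp
  have hcν : ContinuousAt (fun t => outwardNormal f (C.ζ (Φ t (f w)))) 0 := by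
    have hcf : Continuous fun z => fderiv ℝ f z z :=
      (hE.smooth.continuous_fderiv (by simp)).clm_apply continuous_id
    exact hcf.continuousAt.comp hcζ
  have hce : ∀ e : E4, ContinuousAt
      (fun t => extD lam (Φ t (f w)) e (outwardNormal f (C.ζ (Φ t (f w))))) 0 := fun e =>
    (continuous_extD hlam.smooth).continuousAt.comp
      (hcp.prodMk (continuousAt_const.prodMk hcν))
  have hin : ContinuousAt (fun t => inner ℝ (Φ t (f w)) (f w)) 0 := hcp.inner continuousAt_const
  have hin0 : inner ℝ (Φ 0 (f w)) (f w) ≠ 0 := by rw [hz, inner_self_of_mem_S3 hxS]; exact one_ne_zero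
  -- In the expansion of the transported normal, the part tangent to the disk has no area with `ν`.
  -- The radial coefficient is a multiple of the `n`-coefficient because the vector is tangent to
  -- the sphere. The area is therefore the `s`-component times the continuous factor `B`.
  let B : ℝ → ℝ := fun t => extD lam (Φ t (f w)) C.n (outwardNormal f (C.ζ (Φ t (f w)))) -
    inner ℝ (Φ t (f w)) C.n / inner ℝ (Φ t (f w)) (f w) *
      extD lam (Φ t (f w)) (f w) (outwardNormal f (C.ζ (Φ t (f w))))
  have hB : ContinuousAt B 0 :=
    (hce _).sub (((hcp.inner continuousAt_const).div hin hin0).mul (hce _))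
  have hcp' : Tendsto (fun t => Φ t (f w)) (𝓝 0) (𝓝 (f w)) := by rw [← hz]; simpa [hz] using hcp.tendsto
  have heq : ∀ᶠ t in 𝓝 (0 : ℝ),
      fderiv ℝ C.s (Φ t (f w)) (fderiv ℝ (Φ t) (f w) (outwardNormal f w)) * B t =
      extD lam (f (wt t)) (linReebFlow lam t (f w) (outwardNormal f w)) (outwardNormal f (wt t)) := by
    filter_upwards [C.eventually_orbit h hE hw hγ' hz, hcp'.eventually (C.eventually_expand hE),
      hin.eventually_ne hin0] with t h1 h2 h3
    have hζwt : C.ζ (Φ t (f w)) = wt t :=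
      hE.injOn (by simpa using h1.1.le) (Metric.sphere_subset_closedBall (hwt t))
        (by rw [h1.2.2, hwtf])
    rw [h.linReebFlow_eq t hxS (isTangentS3_outwardNormal hE hw), hwtf]
    set u := fderiv ℝ (Φ t) (f w) (outwardNormal f w) with hu
    have hut : inner ℝ (Φ t (f w)) u = 0 :=
      h.isTangentS3_fderiv_flow t (isTangentS3_outwardNormal hE hw)
    have h4 := h2 u
    rw [hζwt] at h4
    have hdt : inner ℝ (Φ t (f w)) (fderiv ℝ f (wt t) (fderiv ℝ C.ζ (Φ t (f w)) u)) = 0 := by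
      rw [← hwtf t]
      exact hE.isTangentS3_fderiv (Metric.sphere_subset_closedBall (hwt t)) _
    have h5 := congrArg (fun y => inner ℝ (Φ t (f w)) y) h4
    simp only [inner_add_right, inner_smul_right, hdt, hut, zero_add] at h5
    have h6 : fderiv ℝ C.β (Φ t (f w)) u = -(fderiv ℝ C.s (Φ t (f w)) u *
        (inner ℝ (Φ t (f w)) C.n / inner ℝ (Φ t (f w)) (f w))) := by
      field_simp
      linarith
    have h7 := extD_fderiv_outwardNormal h hE (hwt t) hγ' (t := t) (by rw [hwtf])
      (fderiv ℝ C.ζ (Φ t (f w)) u)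
    rw [hwtf] at h7
    conv_rhs => rw [← h4, extD_add_left, extD_add_left, extD_smul_left, extD_smul_left, h7, h6]
    simp only [B, hζwt]
    ring
  have hlo := ((C.isLittleO_linearized h hE hw hγ' h0).mul_isBigO
    (hB.tendsto.isBigO_one ℝ)).congr' heq (by simp; rfl)
  have hq0 : extD lam (f (wt 0)) (linReebFlow lam 0 (f w) (outwardNormal f w))
      (outwardNormal f (wt 0)) = 0 := by
    rw [h.linReebFlow_eq 0 hxS (isTangentS3_outwardNormal hE hw), h.fderiv_flow_zero, hwt0,
      extD_self]
  refine HasDerivAt.deriv (HasDerivAt.of_isLittleO ?_)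
  simpa [hq0] using hlo

end Boundary

end HitAnalysis

/-! ### Linearised trajectories along the orbit and hits of nearby trajectories -/

section PolarHits

open scoped NNReal

variable {lam : E4 → E4 →L[ℝ] ℝ} {Y : E4 → E4} {Φ : ℝ → E4 → E4} {K : ℝ≥0} {f : ℂ → E4} {w : ℂ}
  {x₀ u : E4} {ι : Type*} {l : Filter ι} {y : ι → E4} {r : ι → ℝ}

theorem tendsto_of_rescaled (hr : Tendsto r l (𝓝[>] 0))
    (hy : Tendsto (fun i => (r i)⁻¹ • (y i - x₀)) l (𝓝 u)) : Tendsto y l (𝓝 x₀) := by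
  have hr0 : Tendsto r l (𝓝 0) := hr.mono_right nhdsWithin_le_nhds
  have h := (hr0.smul hy).const_add x₀
  rw [zero_smul, add_zero] at h
  refine h.congr' ?_
  filter_upwards [hr self_mem_nhdsWithin] with i hi
  have hi : 0 < r i := hi
  rw [smul_smul, mul_inv_cancel₀ hi.ne', one_smul, add_sub_cancel]

theorem IsReebModel.tendsto_flow (h : IsReebModel lam Y Φ K) (hy : Tendsto y l (𝓝 x₀)) (t : ℝ) :
    Tendsto (fun p : ι × ℝ => Φ p.2 (y p.1)) (l ×ˢ 𝓝 t) (𝓝 (Φ t x₀)) :=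
  (h.continuous_flow.tendsto (t, x₀)).comp
    ((tendsto_snd (f := l) (g := 𝓝 t)).prodMk_nhds (hy.comp tendsto_fst))

theorem IsReebModel.tendsto_rescaled_comp (h : IsReebModel lam Y Φ K)
    (hr : Tendsto r l (𝓝[>] 0)) (hy : Tendsto (fun i => (r i)⁻¹ • (y i - x₀)) l (𝓝 u))
    {t : ℝ} {ψ : E4 → ℝ} {L : E4 →L[ℝ] ℝ} (hψ : HasStrictFDerivAt ψ L (Φ t x₀)) :
    Tendsto (fun p : ι × ℝ => (r p.1)⁻¹ * (ψ (Φ p.2 (y p.1)) - ψ (Φ p.2 x₀))) (l ×ˢ 𝓝 t)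
      (𝓝 (L (fderiv ℝ (Φ t) x₀ u))) :=
  hψ.tendsto_rescaled (h.tendsto_flow (tendsto_of_rescaled hr hy) t)
    (h.tendsto_flow (y := fun _ : ι => x₀) tendsto_const_nhds t)
    (h.tendsto_rescaled (r := fun p : ι × ℝ => r p.1) tendsto_snd (hr.comp tendsto_fst)
      (hy.comp tendsto_fst))

theorem IsReebModel.fderiv_field_eq_zero (h : IsReebModel lam Y Φ K) {t c : ℝ} {ψ : E4 → ℝ}
    {L : E4 →L[ℝ] ℝ} (hψ : HasFDerivAt ψ L (Φ t x₀))
    (hc : ∀ᶠ s in 𝓝 t, ψ (Φ s x₀) = c) : L (Y (Φ t x₀)) = 0 :=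
  (hψ.comp_hasDerivAt t (h.flow.deriv x₀ t)).unique
    ((hasDerivAt_const t c).congr_of_eventuallyEq hc)

theorem DiskChart.hasStrictFDerivAt_norm_ζ (C : DiskChart f w) :
    HasStrictFDerivAt (fun y => ‖C.ζ y‖ ^ 2)
      (2 • (innerSL ℝ w).comp (fderiv ℝ C.ζ (f w))) (f w) := by
  have := (C.contDiff_ζ.hasStrictFDerivAt two_ne_zero)
  have h2 := (hasStrictFDerivAt_norm_sq (C.ζ (f w))).comp (f w) this
  rw [C.ζ_self] at h2
  exact h2

/-- A linearised trajectory crossing the inward pointing directions of the disk yields exactly one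
intersection of each nearby trajectory with the disk. -/
theorem exists_simple_hit_of_inward (h : IsReebModel lam Y Φ K) (hlam : IsContactForm lam)
    (hE : IsEmbeddedDisk f) (hstrong : IsBoundaryStrong lam f)
    (hγ : ∀ t, Φ t x₀ ∈ f '' Metric.sphere 0 1) (hr : Tendsto r l (𝓝[>] 0))
    (hy : Tendsto (fun i => (r i)⁻¹ • (y i - x₀)) l (𝓝 u)) (hyS : ∀ᶠ i in l, y i ∈ S3)
    {t a b : ℝ} (hw : w ∈ Metric.sphere (0 : ℂ) 1) (ht : Φ t x₀ = f w) (ha : 0 < a)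
    (hu : fderiv ℝ (Φ t) x₀ u = -(a • outwardNormal f w) + b • Y (f w)) :
    ∀ δ₀ > 0, ∃ δ > 0, δ < δ₀ ∧
      ∀ᶠ i in l, ∃! s, s ∈ Set.Icc (t - δ) (t + δ) ∧ Φ s (y i) ∈ diskImage f := by
  have hwc := Metric.sphere_subset_closedBall hw
  obtain ⟨C⟩ := exists_diskChart hE hwc
  have horb := C.eventually_orbit h hE hw hγ ht
  have hsp := C.eventually_speed_eq_zero h hE hw hγ ht
  have hν : outwardNormal f w = fderiv ℝ f w w := rfl
  have hwn : ‖w‖ = 1 := by simpa using hw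
  have hp := h.tendsto_flow (tendsto_of_rescaled hr hy) t
  rw [ht] at hp
  have hsnd : Tendsto Prod.snd (l ×ˢ 𝓝 t) (𝓝 t) := tendsto_snd
  have dG : HasStrictFDerivAt (C.speed Y) (fderiv ℝ (C.speed Y) (f w)) (Φ t x₀) := by
    rw [ht]; exact (C.contDiffAt_speed h).hasStrictFDerivAt one_ne_zero
  have ds : HasStrictFDerivAt C.s (fderiv ℝ C.s (f w)) (Φ t x₀) := by
    rw [ht]; exact C.contDiff_s.hasStrictFDerivAt two_ne_zero
  have dζ : HasStrictFDerivAt (fun y => ‖C.ζ y‖ ^ 2)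
      (2 • (innerSL ℝ w).comp (fderiv ℝ C.ζ (f w))) (Φ t x₀) := by
    rw [ht]; exact C.hasStrictFDerivAt_norm_ζ
  -- Speed, `s` and `‖ζ‖²` are constant along the orbit, so the `Y`-component of the linearised
  -- vector does not contribute to any of the three limits.
  have hGY := h.fderiv_field_eq_zero dG.hasFDerivAt hsp
  have hsY := h.fderiv_field_eq_zero ds.hasFDerivAt (horb.mono fun s hs => hs.2.1)
  have hζY := h.fderiv_field_eq_zero (c := 1) dζ.hasFDerivAt
    (horb.mono fun s hs => by simp [hs.1])
  rw [ht] at hGY hsY hζY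
  have hγw : ∀ s, Φ s (f w) ∈ f '' Metric.sphere 0 1 := fun s => by
    rw [← ht, ← h.flow_add]; exact hγ _
  have hGν := C.fderiv_speed_ne_zero h hlam hE hw hγw hstrong
  have hGl := h.tendsto_rescaled_comp hr hy dG
  have hsl := h.tendsto_rescaled_comp hr hy ds
  have hζl := h.tendsto_rescaled_comp hr hy dζ
  rw [hu, map_add, map_neg, map_smul, map_smul, hGY, smul_zero, add_zero] at hGl
  rw [hu, map_add, map_neg, map_smul, map_smul, hsY, smul_zero, add_zero, hν, C.fderiv_s_apply hE,
    smul_zero, neg_zero] at hsl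
  have hζν : (2 • (innerSL ℝ w).comp (fderiv ℝ C.ζ (f w))) (outwardNormal f w) = 2 := by
    rw [hν]
    simp [C.fderiv_ζ_apply hE, hwn]
  rw [hu, map_add, map_neg, map_smul, map_smul, hζY, smul_zero, add_zero, hζν] at hζl
  refine C.exists_simple_hit h hE hwc (r := r) (g := -(a • fderiv ℝ (C.speed Y) (f w)
    (outwardNormal f w))) (hr self_mem_nhdsWithin) hyS hp ?_ (by simpa using ⟨ha.ne', hGν⟩) ?_ ?_
  · refine hGl.congr' ?_
    filter_upwards [hsnd.eventually hsp] with p hp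
    rw [hp, sub_zero]
  · have : Tendsto (fun i => (i, t)) l (l ×ˢ 𝓝 t) :=
      tendsto_id.prodMk (tendsto_const_nhds)
    refine (hsl.comp this).congr fun i => ?_
    simp only [Function.comp_apply]
    rw [horb.self_of_nhds.2.1, sub_zero]
  · have hneg : -(a • (2 : ℝ)) < 0 := by simpa using ha
    filter_upwards [hζl.eventually_lt_const hneg, hsnd.eventually horb,
      tendsto_fst.eventually (hr self_mem_nhdsWithin)] with p h1 h2 h3
    have h3 : 0 < r p.1 := h3
    rw [h2.1, inv_mul_lt_iff₀ h3, mul_zero, one_pow, sub_neg, sq_lt_one_iff_abs_lt_one,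
      abs_norm] at h1
    exact h1.le

/-- If the linearised trajectory is not pointing inwards along the disk, nearby trajectories do
not meet the disk. -/
theorem eventually_notMem_of_not_inward (h : IsReebModel lam Y Φ K) (hE : IsEmbeddedDisk f)
    (hγ : ∀ t, Φ t x₀ ∈ f '' Metric.sphere 0 1) (hr : Tendsto r l (𝓝[>] 0))
    (hy : Tendsto (fun i => (r i)⁻¹ • (y i - x₀)) l (𝓝 u)) (hut : IsTangentS3 x₀ u) {t : ℝ}
    (hb : ∀ b : ℝ, fderiv ℝ (Φ t) x₀ u ≠ b • Y (Φ t x₀))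
    (hin : ¬ ∃ w ∈ Metric.sphere (0 : ℂ) 1, Φ t x₀ = f w ∧ ∃ a b : ℝ, 0 < a ∧
      fderiv ℝ (Φ t) x₀ u = -(a • outwardNormal f w) + b • Y (f w)) :
    ∀ᶠ p in l ×ˢ 𝓝 t, Φ p.2 (y p.1) ∉ diskImage f := by
  obtain ⟨w, hw, ht⟩ := hγ t
  have ht := ht.symm
  have hwc := Metric.sphere_subset_closedBall hw
  obtain ⟨C⟩ := exists_diskChart hE hwc
  have horb := C.eventually_orbit h hE hw hγ ht
  have ds : HasStrictFDerivAt C.s (fderiv ℝ C.s (f w)) (Φ t x₀) := by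
    rw [ht]; exact C.contDiff_s.hasStrictFDerivAt two_ne_zero
  have dζ : HasStrictFDerivAt (fun y => ‖C.ζ y‖ ^ 2)
      (2 • (innerSL ℝ w).comp (fderiv ℝ C.ζ (f w))) (Φ t x₀) := by
    rw [ht]; exact C.hasStrictFDerivAt_norm_ζ
  -- Otherwise one may restrict to the pairs that do hit. Passing to the limit along them gives
  -- vanishing `s`-component and nonpositive radial component, so the vector is inward or a multiple
  -- of `Y`.
  by_contra hcon
  have hne : ((l ×ˢ 𝓝 t) ⊓ 𝓟 {p | Φ p.2 (y p.1) ∈ diskImage f}).NeBot := by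
    rw [← frequently_mem_iff_neBot]
    rw [Filter.Frequently]; exact hcon
  set l' := (l ×ˢ 𝓝 t) ⊓ 𝓟 {p | Φ p.2 (y p.1) ∈ diskImage f}
  have hl' : l' ≤ l ×ˢ 𝓝 t := inf_le_left
  have hp := (h.tendsto_flow (tendsto_of_rescaled hr hy) t).mono_left hl'
  have hsl := (h.tendsto_rescaled_comp hr hy ds).mono_left hl'
  have hζl := (h.tendsto_rescaled_comp hr hy dζ).mono_left hl'
  have hsnd : Tendsto Prod.snd l' (𝓝 t) := (tendsto_snd (f := l)).mono_left hl'
  rw [ht] at hp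
  have hhit : ∀ᶠ p in l', Φ p.2 (y p.1) ∈ diskImage f := mem_inf_of_right (mem_principal_self _)
  have hchart : ∀ᶠ p in l', ‖C.ζ (Φ p.2 (y p.1))‖ ≤ 1 ∧ C.s (Φ p.2 (y p.1)) = 0 := by
    filter_upwards [hhit, hp.eventually (C.eventually_disk hE hwc)] with p ⟨z, hz, hzp⟩ h2
    obtain ⟨h3, h4⟩ := h2 z hz hzp
    exact ⟨by rw [h3]; simpa using hz, h4⟩
  have hs0 : fderiv ℝ C.s (f w) (fderiv ℝ (Φ t) x₀ u) = 0 := by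
    refine tendsto_nhds_unique hsl (tendsto_const_nhds.congr' ?_)
    filter_upwards [hchart, hsnd.eventually horb] with p h1 h2
    rw [h1.2, h2.2.1, sub_zero, mul_zero]
  have hrpos : ∀ᶠ i in l, 0 < r i := hr self_mem_nhdsWithin
  have hζ0 : (2 • (innerSL ℝ w).comp (fderiv ℝ C.ζ (f w))) (fderiv ℝ (Φ t) x₀ u) ≤ 0 := by
    refine le_of_tendsto hζl ?_
    filter_upwards [hchart, hsnd.eventually horb,
      ((tendsto_fst.mono_left hl').eventually hrpos : ∀ᶠ p in l', 0 < r p.1)] with p h1 h2 h3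
    rw [h2.1]
    refine mul_nonpos_of_nonneg_of_nonpos (inv_nonneg.2 h3.le) ?_
    nlinarith [norm_nonneg (C.ζ (Φ p.2 (y p.1)))]
  have htan := h.isTangentS3_fderiv_flow t hut
  rw [ht] at htan
  have hex := C.expand hE hwc htan
  rw [hs0, zero_smul, add_zero] at hex
  obtain ⟨b, hdec⟩ := exists_boundary_decomposition h hE hw hγ ht
    (fderiv ℝ C.ζ (f w) (fderiv ℝ (Φ t) x₀ u))
  rw [← hex] at hdec
  have hle : inner ℝ w (fderiv ℝ C.ζ (f w) (fderiv ℝ (Φ t) x₀ u)) ≤ 0 := by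
    simp only [smul_apply, ContinuousLinearMap.comp_apply, innerSL_apply_apply,
      nsmul_eq_mul] at hζ0
    push_cast at hζ0
    linarith
  rcases hle.lt_or_eq with hlt | heq
  · exact hin ⟨w, hw, ht, _, b, neg_pos.2 hlt, by rw [neg_smul, neg_neg]; exact hdec⟩
  · rw [heq, zero_smul, zero_add] at hdec
    exact hb b (by rw [ht]; exact hdec)

/-- Transverse intersections with the interior of the disk. -/
theorem exists_simple_hit_of_interior (h : IsReebModel lam Y Φ K)
    (hE : IsEmbeddedDisk f) (hy : Tendsto y l (𝓝 x₀)) (hyS : ∀ᶠ i in l, y i ∈ S3)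
    {t : ℝ} (hw : w ∈ Metric.ball (0 : ℂ) 1) (ht : Φ t x₀ = f w)
    (htr : Y (f w) ∉ Set.range (fderiv ℝ f w)) :
    ∀ δ₀ > 0, ∃ δ > 0, δ < δ₀ ∧
      ∀ᶠ i in l, ∃! s, s ∈ Set.Icc (t - δ) (t + δ) ∧ Φ s (y i) ∈ diskImage f := by
  have hwc := Metric.ball_subset_closedBall hw
  obtain ⟨C⟩ := exists_diskChart hE hwc
  have hp := h.tendsto_flow hy t
  rw [ht] at hp
  -- In the interior no rescaling is needed: transversality says that the speed itself is nonzero.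
  refine C.exists_simple_hit h hE hwc (r := fun _ => 1) (g := C.speed Y (f w))
    (Eventually.of_forall fun _ => one_pos) hyS hp ?_ ?_ ?_ ?_
  · simpa [Function.comp_def] using ((C.contDiffAt_speed h).continuousAt.tendsto.comp hp)
  · intro h0
    have := C.expand hE hwc (h.tangent (f w))
    rw [show fderiv ℝ C.s (f w) (Y (f w)) = 0 from h0, zero_smul, add_zero] at this
    exact htr ⟨_, this.symm⟩
  · have : Tendsto (fun i => (i, t)) l (l ×ˢ 𝓝 t) := tendsto_id.prodMk tendsto_const_nhds
    have := C.contDiff_s.continuousAt.tendsto.comp (hp.comp this)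
    simpa [Function.comp_def, C.s_self] using this
  · have h1 := (C.continuousAt_ζ.tendsto.comp hp).norm
    rw [C.ζ_self] at h1
    exact (h1.eventually_lt_const (by simpa using hw)).mono fun p hp => hp.le

/-- The linearised flow is invertible and carries `Y` to `Y`, so such a `u` would be `b • Y x₀`, and
`lam` would give `b = 0`. -/
theorem IsReebModel.fderiv_flow_ne_smul (h : IsReebModel lam Y Φ K) (hx : x₀ ∈ S3)
    (hu : InContactPlane lam x₀ u) (hu0 : u ≠ 0) (t b : ℝ) :
    fderiv ℝ (Φ t) x₀ u ≠ b • Y (Φ t x₀) := by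
  intro he
  rw [← h.fderiv_flow_field, ← map_smul] at he
  have h1 := congrArg (fderiv ℝ (Φ (-t)) (Φ t x₀)) he
  rw [h.fderiv_flow_neg_apply, h.fderiv_flow_neg_apply] at h1
  have h2 := hu.2
  rw [h1, map_smul, (h.reeb _ hx).2.1, smul_eq_mul, mul_one] at h2
  rw [h2, zero_smul] at h1
  exact hu0 h1

/-- The linearised trajectory through `u` points inwards along the disk at some time obtained
from a polar intersection of the projection of its opposite to the contact plane. -/
theorem exists_inward (h : IsReebModel lam Y Φ K) (hE : IsEmbeddedDisk f) {R : ℝ → Prop}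
    (hγ : ∀ t, Φ t x₀ ∈ f '' Metric.sphere 0 1)
    (hhit : ∀ z ∈ Metric.sphere (0 : ℂ) 1, ∀ u, InContactPlane lam (f z) u → u ≠ 0 →
      ∃ t, R t ∧ PolarHit lam f (f z) u t)
    (hx : x₀ ∈ S3) (hu : InContactPlane lam x₀ u) (hu0 : u ≠ 0) (c : ℝ) :
    ∃ t, R t ∧ ∃ w ∈ Metric.sphere (0 : ℂ) 1, Φ (t + c) x₀ = f w ∧ ∃ a b : ℝ, 0 < a ∧
      fderiv ℝ (Φ (t + c)) x₀ u = -(a • outwardNormal f w) + b • Y (f w) := by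
  obtain ⟨z, hz, hzc⟩ := hγ c
  have hzS := hE.mem_S3 (Metric.sphere_subset_closedBall hz)
  set v := fderiv ℝ (Φ c) x₀ u with hv
  have hvt : inner ℝ (f z) v = 0 := by
    rw [hzc]; exact h.isTangentS3_fderiv_flow c hu.1
  have hR := h.reeb _ hzS
  have hYt : inner ℝ (f z) (Y (f z)) = 0 := hR.1
  -- `PolarHit` concerns outward directions, so it is applied to `-v`, corrected by a multiple of
  -- `Y` to lie in the contact plane. Starting at time `c` gives control over when the crossing
  -- occurs.
  have hu' : InContactPlane lam (f z) (lam (f z) v • Y (f z) - v) := by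
    refine ⟨?_, by simp [hR.2.1]⟩
    simp [IsTangentS3, inner_sub_right, inner_smul_right, hvt, hYt]
  have hu'0 : lam (f z) v • Y (f z) - v ≠ 0 := by
    rw [sub_ne_zero, hzc]
    exact (h.fderiv_flow_ne_smul hx hu hu0 c _).symm
  obtain ⟨t, hRt, w, hw, htw, a, b, ha, hab⟩ := hhit z hz _ hu' hu'0
  rw [h.reebFlow_eq t hzS] at htw
  have hwS := hE.mem_S3 (Metric.sphere_subset_closedBall hw)
  rw [h.linReebFlow_eq t hzS hu'.1, map_sub, map_smul, h.fderiv_flow_field, htw,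
    h.field _ hwS] at hab
  refine ⟨t, hRt, w, hw, by rw [h.flow_add, ← hzc, htw], a, lam (f z) v - b, ha, ?_⟩
  rw [h.fderiv_flow_add, ← hv, ← hzc, sub_smul]
  rw [sub_eq_iff_eq_add] at hab
  rw [hab]
  abel

end PolarHits

/-! ### The flow on the complement of a periodic orbit -/

section Complement

open scoped NNReal

variable {lam : E4 → E4 →L[ℝ] ℝ} {Y : E4 → E4} {Φ : ℝ → E4 → E4} {K : ℝ≥0} {f : ℂ → E4}
  {γ : ℝ → E4} {T₀ : ℝ}

theorem IsPeriodicReebOrbit.eq_flow (hγ : IsPeriodicReebOrbit lam γ T₀)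
    (h : IsReebModel lam Y Φ K) (t : ℝ) : Φ t (γ 0) = γ t :=
  (h.eq_of_isReebTrajectory hγ.trajectory t).symm

theorem IsPeriodicReebOrbit.flow_mem_iff (hγ : IsPeriodicReebOrbit lam γ T₀)
    (h : IsReebModel lam Y Φ K) (t : ℝ) (x : E4) :
    Φ t x ∈ Set.range γ ↔ x ∈ Set.range γ := by
  have key : ∀ t x, x ∈ Set.range γ → Φ t x ∈ Set.range γ := by
    rintro t _ ⟨s, rfl⟩
    exact ⟨t + s, by rw [← hγ.eq_flow h, ← hγ.eq_flow h s, h.flow_add]⟩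
  refine ⟨fun hx => ?_, key t x⟩
  have := key (-t) _ hx
  rwa [← h.flow_add, neg_add_cancel, h.flow.zero] at this

/-- The Reeb flow on the complement of the periodic orbit `γ`. -/
def complFlow (hγ : IsPeriodicReebOrbit lam γ T₀) (h : IsReebModel lam Y Φ K) :
    Flow ℝ ↥(S3 \ Set.range γ) where
  toFun t x := ⟨Φ t x, h.flow_mem t x.2.1, fun hx => x.2.2 ((hγ.flow_mem_iff h t x).1 hx)⟩
  cont' := (h.continuous_flow.comp
    (continuous_fst.prodMk (continuous_subtype_val.comp continuous_snd))).subtype_mk _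
  map_add' s t x := Subtype.ext (h.flow_add s t x)
  map_zero' x := Subtype.ext (h.flow.zero x)

@[simp]
theorem coe_complFlow (hγ : IsPeriodicReebOrbit lam γ T₀) (h : IsReebModel lam Y Φ K) (t : ℝ)
    (x : ↥(S3 \ Set.range γ)) : (complFlow hγ h t x : E4) = Φ t x := rfl

/-- The interior of the disk `f`, in the complement of its boundary orbit. -/
def pageOf (γ : ℝ → E4) (f : ℂ → E4) : Set ↥(S3 \ Set.range γ) := {x | (x : E4) ∈ diskImage f}

theorem noHitAt_of_eventually (hγ : IsPeriodicReebOrbit lam γ T₀) (h : IsReebModel lam Y Φ K)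
    {ι : Type*} {l : Filter ι} {y : ι → E4} {F : Filter ↥(S3 \ Set.range γ)} {t : ℝ}
    (hF : Tendsto Subtype.val F (map y l))
    (hev : ∀ᶠ p in l ×ˢ 𝓝 t, Φ p.2 (y p.1) ∉ diskImage f) :
    NoHitAt (complFlow hγ h) (pageOf γ f) F t := by
  obtain ⟨P, hP, Q, hQ, hPQ⟩ := eventually_prod_iff.1 hev
  obtain ⟨ε, hε, hεQ⟩ := Metric.eventually_nhds_iff_ball.1 hQ
  have hall : ∀ᶠ x in map y l, ∀ s ∈ Set.Icc (t - ε / 2) (t + ε / 2), Φ s x ∉ diskImage f := by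
    rw [eventually_map]
    filter_upwards [hP] with i hi s hs
    refine hPQ hi (hεQ s ?_)
    rw [Metric.mem_ball, Real.dist_eq, abs_lt]
    constructor <;> linarith [hs.1, hs.2]
  exact ⟨ε / 2, by positivity, hF.eventually hall⟩

theorem simpleHitAt_of_eventually (hγ : IsPeriodicReebOrbit lam γ T₀) (h : IsReebModel lam Y Φ K)
    {ι : Type*} {l : Filter ι} {y : ι → E4} {F : Filter ↥(S3 \ Set.range γ)} {t : ℝ}
    (hF : Tendsto Subtype.val F (map y l))
    (hev : ∀ δ₀ > 0, ∃ δ > 0, δ < δ₀ ∧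
      ∀ᶠ i in l, ∃! s, s ∈ Set.Icc (t - δ) (t + δ) ∧ Φ s (y i) ∈ diskImage f) :
    SimpleHitAt (complFlow hγ h) (pageOf γ f) F t := fun δ₀ hδ₀ => by
  obtain ⟨δ, hδ, hδ', hl⟩ := hev δ₀ hδ₀
  exact ⟨δ, hδ, hδ', hF.eventually (p := fun x => ∃! s, s ∈ Set.Icc (t - δ) (t + δ) ∧
    Φ s x ∈ diskImage f) (eventually_map.2 hl)⟩

/-- The orbit is invariant, so trajectories in its complement hit the disk only in its interior,
where it is transverse to the flow. Starting from `Φ c x` produces a hit after time `c`. -/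
theorem isTransverseAt_nhds (hγ : IsPeriodicReebOrbit lam γ T₀) (h : IsReebModel lam Y Φ K)
    (hf : IsDiskGSS lam γ f) (c : ℝ) (x : ↥(S3 \ Set.range γ)) :
    IsTransverseAt (complFlow hγ h) (pageOf γ f) c (𝓝 x) := by
  have hF : Tendsto Subtype.val (𝓝 x)
      (map (Subtype.val : ↥(S3 \ Set.range γ) → E4) (𝓝 x)) := tendsto_map
  have hv : Tendsto (Subtype.val : ↥(S3 \ Set.range γ) → E4) (𝓝 x) (𝓝 (x : E4)) :=
    continuous_subtype_val.continuousAt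
  have hsimple : ∀ t, Φ t x ∈ diskImage f →
      SimpleHitAt (complFlow hγ h) (pageOf γ f) (𝓝 x) t := by
    rintro t ⟨w, hw, hwt⟩
    have hwb : w ∈ Metric.ball (0 : ℂ) 1 := by
      rw [← Metric.ball_union_sphere] at hw
      refine hw.resolve_right fun hws => x.2.2 ?_
      exact (hγ.flow_mem_iff h t _).1 (hf.boundary.subset ⟨w, hws, hwt⟩)
    refine simpleHitAt_of_eventually hγ h hF (exists_simple_hit_of_interior h hf.embedded hv
      (Eventually.of_forall fun y => y.2.1) hwb hwt.symm ?_)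
    rw [← h.field _ (hf.embedded.mem_S3 hw)]
    exact hf.transverse w hwb
  refine ⟨fun t => ?_, ?_, ?_⟩
  · by_cases ht : Φ t x ∈ diskImage f
    · exact Or.inr (hsimple t ht)
    · refine Or.inl (noHitAt_of_eventually hγ h hF ?_)
      exact (h.tendsto_flow hv t).eventually
        (hf.embedded.isCompact_diskImage.isClosed.isOpen_compl.mem_nhds ht)
  · obtain ⟨t, ht, hit⟩ := hf.forward_hit _ (h.flow_mem c x.2.1)
    rw [h.reebFlow_eq t (h.flow_mem c x.2.1), ← h.flow_add] at hit
    exact ⟨t + c, by linarith, hsimple _ hit⟩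
  · obtain ⟨t, ht, hit⟩ := hf.backward_hit _ x.2.1
    rw [h.reebFlow_eq t x.2.1] at hit
    exact ⟨t, ht, hsimple _ hit⟩

/-! #### Polar coordinates near a point of the orbit -/

/-- Polar coordinates around `x`. -/
def polarPoint (x : E4) (p : ℝ × E4) : E4 := radialProj (x + p.1 • p.2)

/-- The approach to `x` in the direction of `u`, inside directions of the contact plane. -/
def polarNhds (lam : E4 → E4 →L[ℝ] ℝ) (x u : E4) : Filter (ℝ × E4) :=
  𝓝[>] 0 ×ˢ 𝓝[contactSubmodule lam x] u

/-- The filter of points of the complement of `γ` approaching `γ 0` in the direction of `u`. -/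
def polarFilter (lam : E4 → E4 →L[ℝ] ℝ) (γ : ℝ → E4) (u : E4) : Filter ↥(S3 \ Set.range γ) :=
  comap Subtype.val (map (polarPoint (γ 0)) (polarNhds lam (γ 0) u))

theorem add_smul_ne_zero {x v : E4} (hx : x ∈ S3) (hv : IsTangentS3 x v) (r : ℝ) :
    x + r • v ≠ 0 := by
  intro h
  have hv : inner ℝ x v = 0 := hv
  have := congrArg (fun y => inner ℝ x y) h
  simp [inner_add_right, inner_smul_right, hv, norm_eq_one_of_mem_S3 hx] at this

theorem polarPoint_mem_S3 {x v : E4} (hx : x ∈ S3) (hv : IsTangentS3 x v) (r : ℝ) :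
    polarPoint x (r, v) ∈ S3 := radialProj_mem (add_smul_ne_zero hx hv r)

theorem eventually_mem_contactSubmodule (lam : E4 → E4 →L[ℝ] ℝ) (x u : E4) :
    ∀ᶠ p in polarNhds lam x u, InContactPlane lam x p.2 :=
  (tendsto_snd (f := 𝓝[>] (0 : ℝ))).eventually
    (eventually_mem_nhdsWithin.mono fun _ hv => mem_contactSubmodule.1 hv)

theorem tendsto_rescaled_polarPoint {x u : E4} (hx : x ∈ S3) (hu : IsTangentS3 x u) :
    Tendsto (fun p : ℝ × E4 => p.1⁻¹ • (polarPoint x p - x)) (polarNhds lam x u) (𝓝 u) := by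
  have hst : HasStrictFDerivAt radialProj (fderiv ℝ radialProj x) x :=
    (contDiffAt_radialProj (ne_zero_of_mem_S3 hx)).hasStrictFDerivAt (by simp)
  have h1 : Tendsto Prod.fst (polarNhds lam x u) (𝓝[>] 0) := tendsto_fst
  have h2 : Tendsto Prod.snd (polarNhds lam x u) (𝓝 u) := tendsto_snd.mono_right nhdsWithin_le_nhds
  have hs : Tendsto (fun p : ℝ × E4 => p.1⁻¹ • ((x + p.1 • p.2) - x)) (polarNhds lam x u) (𝓝 u) := by
    refine h2.congr' ?_
    filter_upwards [h1.eventually self_mem_nhdsWithin] with p hp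
    rw [add_sub_cancel_left, smul_smul, inv_mul_cancel₀ (ne_of_gt hp), one_smul]
  have := hst.tendsto_rescaled (E := E4) (F := E4) (tendsto_of_rescaled h1 hs) tendsto_const_nhds hs
  rw [fderiv_radialProj hx hu, radialProj_of_mem hx] at this
  exact this

/-- The dichotomy is whether the linearised trajectory of `u` points inwards along the disk at time
`t`; `∂`-strong supplies inward times in the future and in the past. -/
theorem isTransverseAt_polarFilter (hγ : IsPeriodicReebOrbit lam γ T₀) (h : IsReebModel lam Y Φ K)
    (hlam : IsContactForm lam) (hf : IsDiskGSS lam γ f) (hs : IsBoundaryStrong lam f) (c : ℝ)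
    {u : E4} (hu : InContactPlane lam (γ 0) u) (hu0 : u ≠ 0) :
    IsTransverseAt (complFlow hγ h) (pageOf γ f) c (polarFilter lam γ u) := by
  have hx : γ 0 ∈ S3 := (hγ.trajectory 0).1
  have hF : Tendsto Subtype.val (polarFilter lam γ u)
      (map (polarPoint (γ 0)) (polarNhds lam (γ 0) u)) := tendsto_comap
  have hr : Tendsto Prod.fst (polarNhds lam (γ 0) u) (𝓝[>] 0) := tendsto_fst
  have hy := tendsto_rescaled_polarPoint (lam := lam) hx hu.1
  have hyS : ∀ᶠ p in polarNhds lam (γ 0) u, polarPoint (γ 0) p ∈ S3 :=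
    (eventually_mem_contactSubmodule lam (γ 0) u).mono fun p hp => polarPoint_mem_S3 hx hp.1 p.1
  have hΦ : ∀ t, Φ t (γ 0) ∈ f '' Metric.sphere 0 1 := fun t => by
    rw [hf.boundary, hγ.eq_flow h]; exact ⟨t, rfl⟩
  refine ⟨fun t => ?_, ?_, ?_⟩
  · by_cases hin : ∃ w ∈ Metric.sphere (0 : ℂ) 1, Φ t (γ 0) = f w ∧ ∃ a b : ℝ, 0 < a ∧
      fderiv ℝ (Φ t) (γ 0) u = -(a • outwardNormal f w) + b • Y (f w)
    · obtain ⟨w, hw, ht, a, b, ha, hab⟩ := hin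
      exact Or.inr (simpleHitAt_of_eventually hγ h hF
        (exists_simple_hit_of_inward h hlam hf.embedded hs hΦ hr hy hyS hw ht ha hab))
    · exact Or.inl (noHitAt_of_eventually hγ h hF (eventually_notMem_of_not_inward h hf.embedded
        hΦ hr hy hu.1 (h.fderiv_flow_ne_smul hx hu hu0 t) hin))
  · obtain ⟨t, ht, w, hw, htw, a, b, ha, hab⟩ := exists_inward h hf.embedded (R := fun t => t > 0)
      hΦ hs.forward_hit hx hu hu0 c
    exact ⟨t + c, by linarith, simpleHitAt_of_eventually hγ h hF
      (exists_simple_hit_of_inward h hlam hf.embedded hs hΦ hr hy hyS hw htw ha hab)⟩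
  · obtain ⟨t, ht, w, hw, htw, a, b, ha, hab⟩ := exists_inward h hf.embedded (R := fun t => t < 0)
      hΦ hs.backward_hit hx hu hu0 0
    exact ⟨t + 0, by linarith, simpleHitAt_of_eventually hγ h hF
      (exists_simple_hit_of_inward h hlam hf.embedded hs hΦ hr hy hyS hw htw ha hab)⟩

end Complement

/-! ### Compactness of the complement blown up along the orbit -/

section CompactFamily

open scoped NNReal

variable {lam : E4 → E4 →L[ℝ] ℝ} {Y : E4 → E4} {Φ : ℝ → E4 → E4} {K : ℝ≥0} {f : ℂ → E4}
  {γ : ℝ → E4} {T₀ : ℝ}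

/-- The form `lam` at `x`, extended to a function near `x` that is constant in the radial
direction to first order. -/
def contactCoord (lam : E4 → E4 →L[ℝ] ℝ) (x : E4) : E4 →L[ℝ] ℝ :=
  lam x ∘L (ContinuousLinearMap.id ℝ E4 - (innerSL ℝ x).smulRight x)

theorem contactCoord_apply (x y : E4) :
    contactCoord lam x y = lam x (y - inner ℝ x y • x) := by
  simp [contactCoord]

theorem hasDerivAt_contactCoord (h : IsReebModel lam Y Φ K) {x : E4} (hx : x ∈ S3) :
    HasDerivAt (fun t => contactCoord lam x (Φ t x)) 1 0 := by
  have h1 := (contactCoord lam x).hasFDerivAt.comp_hasDerivAt 0 (h.flow.deriv x 0)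
  have h2 : inner ℝ x (Y x) = 0 := h.tangent x
  rw [h.flow.zero, contactCoord_apply, h2, zero_smul, sub_zero, (h.reeb x hx).2.1] at h1
  exact h1

theorem contactCoord_polarPoint {x v : E4} (hx : x ∈ S3) (hv : InContactPlane lam x v) (r : ℝ) :
    contactCoord lam x (polarPoint x (r, v)) = 0 := by
  have h2 : inner ℝ x v = 0 := hv.1
  simp [polarPoint, radialProj, contactCoord_apply, inner_add_right, inner_smul_right, h2, hv.2,
    norm_eq_one_of_mem_S3 hx]

theorem polarPoint_ne {x v : E4} (hx : x ∈ S3) (hv : IsTangentS3 x v) (hv0 : v ≠ 0) {r : ℝ}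
    (hr : 0 < r) : polarPoint x (r, v) ≠ x := by
  intro he
  have h2 : inner ℝ v x = 0 := by rw [real_inner_comm]; exact hv
  have h3 := congrArg (fun y => inner ℝ v y) he
  simp only [polarPoint, radialProj, inner_smul_right, inner_add_right, h2, zero_add,
    real_inner_self_eq_norm_sq] at h3
  have h4 : ‖x + r • v‖ ≠ 0 := norm_ne_zero_iff.2 (add_smul_ne_zero hx hv r)
  have h5 : ‖v‖ ≠ 0 := norm_ne_zero_iff.2 hv0
  have : ‖x + r • v‖⁻¹ * (r * ‖v‖ ^ 2) ≠ 0 := by positivity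
  exact this h3

/-- A periodic orbit meets a small transverse surface only in one point. -/
theorem IsPeriodicReebOrbit.eventually_eq (hγ : IsPeriodicReebOrbit lam γ T₀)
    (h : IsReebModel lam Y Φ K) :
    ∀ᶠ y in 𝓝 (γ 0), contactCoord lam (γ 0) y = 0 → y ∈ Set.range γ → y = γ 0 := by
  have hx : γ 0 ∈ S3 := (hγ.trajectory 0).1
  have hd := hasDerivAt_contactCoord h hx
  have h0 : contactCoord lam (γ 0) (Φ 0 (γ 0)) = 0 := by
    rw [h.flow.zero, contactCoord_apply, inner_self_of_mem_S3 hx]; simp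
  -- `contactCoord` increases at unit rate along the orbit at time `0`, so short times give no
  -- second zero. The remaining times in a period form a compact set whose image avoids `γ 0` by
  -- primitivity.
  have hne := hd.eventually_ne (c := 0) one_ne_zero
  rw [eventually_nhdsWithin_iff] at hne
  obtain ⟨ε, hε, hεne⟩ := Metric.eventually_nhds_iff_ball.1 hne
  have hT := hγ.period_pos
  have hcγ : Continuous γ := continuous_iff_continuousAt.2 fun t => (hγ.trajectory t).2.continuousAt
  have hcomp : IsCompact (γ '' Set.Icc (min ε T₀ / 2) (T₀ - min ε T₀ / 2)) :=
    isCompact_Icc.image hcγ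
  have hε' : 0 < min ε T₀ := lt_min hε hT
  have h1 := min_le_left ε T₀
  have h2 := min_le_right ε T₀
  have hnot : γ 0 ∉ γ '' Set.Icc (min ε T₀ / 2) (T₀ - min ε T₀ / 2) := by
    rintro ⟨s, hs, hs0⟩
    have := hγ.primitive ⟨by linarith [hs.1], by linarith [hs.2]⟩ ⟨le_rfl, hT⟩ hs0
    linarith [hs.1]
  filter_upwards [hcomp.isClosed.isOpen_compl.mem_nhds hnot] with y hy hy0 hyγ
  obtain ⟨s', hs'⟩ := hyγ
  obtain ⟨s, hs, hss⟩ := hγ.periodic.exists_mem_Ico₀ hT s'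
  rw [hs'] at hss
  have hsmall : ∀ σ, |σ| < ε → γ σ = y → σ = 0 := by
    intro σ hσ hσy
    by_contra hne
    refine hεne σ (by simpa [Real.dist_eq] using hσ) hne ?_
    rw [hγ.eq_flow h, hσy, hy0]
  rcases lt_or_ge s (min ε T₀ / 2) with hlt | hge
  · have := hsmall s (by rw [abs_of_nonneg hs.1]; linarith) hss.symm
    rw [hss, this]
  · rcases le_or_gt s (T₀ - min ε T₀ / 2) with hle | hgt
    · exact absurd ⟨s, ⟨hge, hle⟩, hss.symm⟩ hy
    · have := hsmall (s - T₀) (by rw [abs_lt]; constructor <;> linarith [hs.2])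
        (by rw [hγ.periodic.sub_eq]; exact hss.symm)
      linarith [hs.2]

theorem eventually_polarPoint_mem (hγ : IsPeriodicReebOrbit lam γ T₀)
    (h : IsReebModel lam Y Φ K) {u : E4} (hu : InContactPlane lam (γ 0) u) (hu0 : u ≠ 0) :
    ∀ᶠ p in polarNhds lam (γ 0) u, polarPoint (γ 0) p ∈ S3 \ Set.range γ := by
  have hx : γ 0 ∈ S3 := (hγ.trajectory 0).1
  have hr : Tendsto Prod.fst (polarNhds lam (γ 0) u) (𝓝[>] 0) := tendsto_fst
  have hv : Tendsto Prod.snd (polarNhds lam (γ 0) u) (𝓝 u) :=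
    tendsto_snd.mono_right nhdsWithin_le_nhds
  have ht := tendsto_of_rescaled hr (tendsto_rescaled_polarPoint (lam := lam) hx hu.1)
  filter_upwards [eventually_mem_contactSubmodule lam (γ 0) u, ht.eventually (hγ.eventually_eq h),
    hr.eventually self_mem_nhdsWithin, hv.eventually_ne hu0] with p h1 h2 h3 h4
  refine ⟨polarPoint_mem_S3 hx h1.1 p.1, fun hmem => ?_⟩
  exact polarPoint_ne hx h1.1 h4 h3 (h2 (contactCoord_polarPoint hx h1 p.1) hmem)

theorem exists_rectangle {x u : E4} {A : Set (ℝ × E4)} (hA : A ∈ polarNhds lam x u) :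
    ∃ ρ > 0, ∀ r ∈ Set.Ioo 0 ρ, ∀ v ∈ Metric.ball u ρ ∩ contactSubmodule lam x, (r, v) ∈ A := by
  obtain ⟨P, hP, Q, hQ, hPQ⟩ := eventually_prod_iff.1 (show ∀ᶠ p in polarNhds lam x u, p ∈ A from hA)
  obtain ⟨ρ₁, hρ₁, h₁⟩ := Metric.mem_nhdsWithin_iff.1 hP
  obtain ⟨ρ₂, hρ₂, h₂⟩ := Metric.mem_nhdsWithin_iff.1 hQ
  refine ⟨min ρ₁ ρ₂, lt_min hρ₁ hρ₂, fun r hr v hv => hPQ (h₁ ⟨?_, hr.1⟩) (h₂ ⟨?_, hv.2⟩)⟩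
  · rw [Metric.mem_ball, Real.dist_eq, sub_zero, abs_of_pos hr.1]
    exact hr.2.trans_le (min_le_left _ _)
  · exact Metric.ball_subset_ball (min_le_right _ _) hv.1

/-- The filters describing the complement of the orbit `γ`, blown up along `γ`. -/
def complFilters (lam : E4 → E4 →L[ℝ] ℝ) (γ : ℝ → E4) : Set (Filter ↥(S3 \ Set.range γ)) :=
  Set.range (fun x => 𝓝 x) ∪
    polarFilter lam γ '' {u | InContactPlane lam (γ 0) u ∧ ‖u‖ = 1}

/-- The connected neighbourhoods are radial projections of small balls. -/
theorem locallyConnected_compl (hγ : IsPeriodicReebOrbit lam γ T₀) (x : ↥(S3 \ Set.range γ))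
    {U : Set ↥(S3 \ Set.range γ)} (hU : U ∈ 𝓝 x) :
    ∃ W ∈ 𝓝 x, W ⊆ U ∧ IsPreconnected W := by
  have hcγ : Continuous γ := continuous_iff_continuousAt.2 fun t => (hγ.trajectory t).2.continuousAt
  have hclosed : IsClosed (Set.range γ) := by
    have := (isCompact_Icc (a := 0) (b := 0 + T₀)).image hcγ
    rw [hγ.periodic.image_Icc hγ.period_pos] at this
    exact this.isClosed
  obtain ⟨V, hV, hVU⟩ := (mem_nhds_subtype _ _ _).1 hU
  have hx0 := ne_zero_of_mem_S3 x.2.1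
  have hcr : ContinuousAt radialProj (x : E4) := (contDiffAt_radialProj hx0).continuousAt
  have hrx : radialProj (x : E4) = x := radialProj_of_mem x.2.1
  have hev : ∀ᶠ y in 𝓝 (x : E4), y ≠ 0 ∧ radialProj y ∈ V \ Set.range γ := by
    refine (eventually_ne_nhds hx0).and (hcr.preimage_mem_nhds ?_)
    rw [hrx]
    exact inter_mem hV (hclosed.isOpen_compl.mem_nhds x.2.2)
  obtain ⟨ε, hε, hball⟩ := Metric.eventually_nhds_iff_ball.1 hev
  have himg : radialProj '' Metric.ball (x : E4) ε ⊆ S3 \ Set.range γ := by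
    rintro _ ⟨y, hy, rfl⟩
    exact ⟨radialProj_mem (hball y hy).1, (hball y hy).2.2⟩
  refine ⟨Subtype.val ⁻¹' (radialProj '' Metric.ball (x : E4) ε), ?_, ?_, ?_⟩
  · filter_upwards [continuous_subtype_val.continuousAt.preimage_mem_nhds
      (Metric.ball_mem_nhds (x : E4) hε)] with y hy
    exact ⟨y, hy, radialProj_of_mem y.2.1⟩
  · rintro y ⟨z, hz, hzy⟩
    exact hVU (by rw [Set.mem_preimage, ← hzy]; exact (hball z hz).2.1)
  · rw [← Topology.IsInducing.subtypeVal.isPreconnected_image, Subtype.image_preimage_coe,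
      Set.inter_eq_right.2 himg]
    refine (convex_ball (x : E4) ε).isPreconnected.image _ fun y hy => ?_
    exact (contDiffAt_radialProj (hball y hy).1).continuousAt.continuousWithinAt

/-- The connected sets are images of convex rectangles in `(r, v)`. Keeping `v` in the contact plane
places the image on a surface that meets the orbit only at `γ 0` nearby, so nothing has to be
removed from it. -/
theorem locallyConnected_polarFilter (hγ : IsPeriodicReebOrbit lam γ T₀)
    (h : IsReebModel lam Y Φ K) {u : E4} (hu : InContactPlane lam (γ 0) u) (hu0 : u ≠ 0)
    {U : Set ↥(S3 \ Set.range γ)} (hU : U ∈ polarFilter lam γ u) :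
    ∃ W ∈ polarFilter lam γ u, W ⊆ U ∧ IsPreconnected W := by
  have hx : γ 0 ∈ S3 := (hγ.trajectory 0).1
  obtain ⟨V, hV, hVU⟩ := mem_comap.1 hU
  obtain ⟨ρ, hρ, hR⟩ := exists_rectangle (inter_mem (mem_map.1 hV) (eventually_polarPoint_mem hγ h hu hu0))
  set R : Set (ℝ × E4) := Set.Ioo 0 ρ ×ˢ (Metric.ball u ρ ∩ contactSubmodule lam (γ 0)) with hRdef
  have hRmem : R ∈ polarNhds lam (γ 0) u :=
    prod_mem_prod (Ioo_mem_nhdsGT hρ)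
      (inter_mem (nhdsWithin_le_nhds (Metric.ball_mem_nhds u hρ)) self_mem_nhdsWithin)
  have hRR : ∀ p ∈ R, polarPoint (γ 0) p ∈ V ∧ polarPoint (γ 0) p ∈ S3 \ Set.range γ :=
    fun p hp => hR p.1 hp.1 p.2 hp.2
  have himg : polarPoint (γ 0) '' R ⊆ S3 \ Set.range γ := by
    rintro _ ⟨p, hp, rfl⟩
    exact (hRR p hp).2
  refine ⟨Subtype.val ⁻¹' (polarPoint (γ 0) '' R), preimage_mem_comap (image_mem_map hRmem), ?_, ?_⟩
  · rintro y ⟨z, hz, hzy⟩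
    exact hVU (by rw [Set.mem_preimage, ← hzy]; exact (hRR z hz).1)
  · rw [← Topology.IsInducing.subtypeVal.isPreconnected_image, Subtype.image_preimage_coe,
      Set.inter_eq_right.2 himg]
    have hconv : Convex ℝ R := (convex_Ioo 0 ρ).prod
      ((convex_ball u ρ).inter (contactSubmodule lam (γ 0)).convex)
    refine hconv.isPreconnected.image _ fun p hp => ?_
    have h1 : ContinuousAt radialProj (γ 0 + p.1 • p.2) :=
      (contDiffAt_radialProj (add_smul_ne_zero hx (mem_contactSubmodule.1 hp.2.2).1 _)).continuousAt
    have h2 : Continuous fun p : ℝ × E4 => γ 0 + p.1 • p.2 := by fun_prop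
    exact (ContinuousAt.comp (f := fun p : ℝ × E4 => γ 0 + p.1 • p.2) h1
      h2.continuousAt).continuousWithinAt

/-- Central projection from the origin to the tangent space at `x` inverts `polarPoint`: the vector
is `⟨x, y⟩⁻¹ • y - x`, split into length and direction. -/
theorem eventually_exists_polarPoint {x : E4} (hx : x ∈ S3) {ρ : ℝ} (hρ : 0 < ρ) :
    ∀ᶠ y in 𝓝 x, y ∈ S3 → contactCoord lam x y = 0 → y ≠ x →
      ∃ r ∈ Set.Ioo 0 ρ, ∃ v, InContactPlane lam x v ∧ ‖v‖ = 1 ∧ polarPoint x (r, v) = y := by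
  have hin : Tendsto (fun y => inner ℝ x y) (𝓝 x) (𝓝 1) := by
    have : Continuous fun y : E4 => inner ℝ x y := by fun_prop
    simpa [norm_eq_one_of_mem_S3 hx] using this.tendsto x
  have hlim : Tendsto (fun y => ‖(inner ℝ x y)⁻¹ • y - x‖) (𝓝 x) (𝓝 0) := by
    simpa using (((hin.inv₀ one_ne_zero).smul tendsto_id).sub_const x).norm
  filter_upwards [hin.eventually_const_lt one_pos, hlim.eventually_lt_const hρ]
    with y hc hlt hyS hy0 hyx
  set c : ℝ := inner ℝ x y with hcdef
  set v := c⁻¹ • y - x with hv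
  have hcv : y = c • (x + v) := by
    rw [hv, add_sub_cancel, smul_smul, mul_inv_cancel₀ hc.ne', one_smul]
  have hvt : inner ℝ x v = 0 := by
    rw [hv, inner_sub_right, inner_smul_right, inner_self_of_mem_S3 hx, ← hcdef,
      inv_mul_cancel₀ hc.ne', sub_self]
  have hvl : lam x v = 0 := by
    have h1 : v = c⁻¹ • (y - c • x) := by
      rw [hv, smul_sub, smul_smul, inv_mul_cancel₀ hc.ne', one_smul]
    rw [contactCoord_apply] at hy0
    rw [h1, map_smul, hy0, smul_zero]
  have hy1 := norm_eq_one_of_mem_S3 hyS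
  have hv0 : v ≠ 0 := by
    intro h0
    rw [h0, add_zero] at hcv
    rw [hcv, norm_smul, norm_eq_one_of_mem_S3 hx, mul_one, Real.norm_eq_abs, abs_of_pos hc] at hy1
    exact hyx (by rw [hcv, hy1, one_smul])
  have hvn : 0 < ‖v‖ := norm_pos_iff.2 hv0
  refine ⟨‖v‖, ⟨hvn, hlt⟩, ‖v‖⁻¹ • v, ⟨?_, by rw [map_smul, hvl, smul_zero]⟩, ?_, ?_⟩
  · rw [IsTangentS3, inner_smul_right, hvt, mul_zero]
  · rw [norm_smul, norm_inv, norm_norm, inv_mul_cancel₀ hvn.ne']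
  · rw [polarPoint, smul_smul, mul_inv_cancel₀ hvn.ne', one_smul]
    have h1 : ‖x + v‖ = c⁻¹ := by
      rw [hcv, norm_smul, Real.norm_eq_abs, abs_of_pos hc] at hy1
      exact eq_inv_of_mul_eq_one_right hy1
    rw [radialProj, h1, inv_inv, ← hcv]

/-- Points near the orbit flow to the transverse surface in short time. -/
theorem eventually_exists_flow_section (h : IsReebModel lam Y Φ K) {x : E4} (hx : x ∈ S3)
    {N : Set E4} (hN : N ∈ 𝓝 x) :
    ∀ᶠ y in 𝓝 x, ∃ τ ∈ Set.Icc (-1 : ℝ) 1, Φ τ y ∈ N ∧ contactCoord lam x (Φ τ y) = 0 := by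
  have hc : Continuous fun p : E4 × ℝ => Φ p.2 p.1 := h.continuous_flow.comp continuous_swap
  have hN' : ∀ᶠ p in 𝓝 x ×ˢ 𝓝 (0 : ℝ), Φ p.2 p.1 ∈ N := by
    rw [← nhds_prod_eq]
    exact hc.continuousAt.preimage_mem_nhds (by rw [h.flow.zero]; exact hN)
  obtain ⟨P, hP, Q, hQ, hPQ⟩ := eventually_prod_iff.1 hN'
  obtain ⟨ε, hε, hεQ⟩ := Metric.eventually_nhds_iff_ball.1 hQ
  have hd := hasDerivAt_contactCoord h hx
  have h0 : contactCoord lam x (Φ 0 x) = 0 := by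
    rw [h.flow.zero, contactCoord_apply, inner_self_of_mem_S3 hx]; simp
  have hslope := hasDerivAt_iff_tendsto_slope.1 hd
  have hpos := hslope.eventually_const_lt one_pos
  rw [eventually_nhdsWithin_iff] at hpos
  obtain ⟨ε', hε', hpos⟩ := Metric.eventually_nhds_iff_ball.1 hpos
  -- The coordinate changes sign between `-δ` and `δ`, also for nearby points, so it has a zero in
  -- between; `δ < 1` gives the bound on `τ`.
  obtain ⟨δ, hδ, hδ1⟩ := exists_between (lt_min (lt_min hε hε') one_pos)
  simp only [lt_min_iff] at hδ1
  have hsp : 0 < contactCoord lam x (Φ δ x) := by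
    have := hpos δ (by simpa [abs_of_pos hδ] using hδ1.1.2) hδ.ne'
    rw [slope_def_field, h0, sub_zero, sub_zero] at this
    simpa [hδ] using this
  have hsn : contactCoord lam x (Φ (-δ) x) < 0 := by
    have := hpos (-δ) (by simpa [abs_of_pos hδ] using hδ1.1.2) (neg_ne_zero.2 hδ.ne')
    rw [slope_def_field, h0, sub_zero, sub_zero, div_neg, neg_pos] at this
    simpa [hδ, div_neg_iff, hδ.not_gt] using this
  have hcl : ∀ t, Continuous fun y => contactCoord lam x (Φ t y) := fun t =>
    (contactCoord lam x).continuous.comp (h.continuous_flow.comp (Continuous.prodMk_right t))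
  filter_upwards [hP, (hcl δ).continuousAt.eventually_const_lt hsp,
    (hcl (-δ)).continuousAt.eventually_lt_const hsn] with y h1 h2 h3
  have hcy : ContinuousOn (fun t => contactCoord lam x (Φ t y)) (Set.Icc (-δ) δ) :=
    ((contactCoord lam x).continuous.comp (h.flow.continuous_time y)).continuousOn
  obtain ⟨τ, hτ, hτ0⟩ := intermediate_value_Icc (by linarith) hcy ⟨h3.le, h2.le⟩
  refine ⟨τ, ⟨by linarith [hτ.1], by linarith [hτ.2]⟩, hPQ h1 (hεQ τ ?_), hτ0⟩
  rw [Metric.mem_ball, Real.dist_eq, sub_zero, abs_lt]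
  constructor <;> linarith [hτ.1, hτ.2]

/-- A point near the orbit is flowed back to the surface through `γ 0`, where it has polar
coordinates with direction in the compact unit circle of the contact plane. The points away from the
orbit form a compact set covered by ordinary neighbourhoods. -/
theorem isCompactFamily_complFilters (hγ : IsPeriodicReebOrbit lam γ T₀)
    (h : IsReebModel lam Y Φ K) :
    IsCompactFamily (complFlow hγ h) (T₀ + 2) (complFilters lam γ) := by
  have hx : γ 0 ∈ S3 := (hγ.trajectory 0).1
  have hT := hγ.period_pos
  refine ⟨?_, fun x => Or.inl ⟨x, rfl⟩, fun W hW => ?_⟩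
  · rintro F (⟨x, rfl⟩ | ⟨u, ⟨hu, hu1⟩, rfl⟩) U hU
    · exact locallyConnected_compl hγ x hU
    · exact locallyConnected_polarFilter hγ h hu (norm_ne_zero_iff.1 (by rw [hu1]; exact one_ne_zero)) hU
  have hK : IsCompact {u | InContactPlane lam (γ 0) u ∧ ‖u‖ = 1} := by
    have : {u | InContactPlane lam (γ 0) u ∧ ‖u‖ = 1} =
        Metric.sphere 0 1 ∩ (contactSubmodule lam (γ 0) : Set E4) := by
      ext u
      simp [mem_contactSubmodule, and_comm]
    rw [this]
    exact (isCompact_sphere 0 1).inter_right (Submodule.closed_of_finiteDimensional _)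
  obtain ⟨s₁, hs₁, hs₁G, ρ, hρ, hcov⟩ : ∃ s : Set (Filter ↥(S3 \ Set.range γ)), s.Finite ∧
      s ⊆ complFilters lam γ ∧ ∃ ρ > 0, ∀ v ∈ {u | InContactPlane lam (γ 0) u ∧ ‖u‖ = 1},
        ∀ r ∈ Set.Ioo 0 ρ, ∀ m : ↥(S3 \ Set.range γ), polarPoint (γ 0) (r, v) = m →
          ∃ F ∈ s, m ∈ W F := by
    refine hK.induction_on (p := fun K' => ∃ s : Set (Filter ↥(S3 \ Set.range γ)), s.Finite ∧
      s ⊆ complFilters lam γ ∧ ∃ ρ > 0, ∀ v ∈ K', ∀ r ∈ Set.Ioo 0 ρ, ∀ m : ↥(S3 \ Set.range γ),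
        polarPoint (γ 0) (r, v) = m → ∃ F ∈ s, m ∈ W F) ?_ ?_ ?_ ?_
    · exact ⟨∅, Set.finite_empty, Set.empty_subset _, 1, one_pos, by simp⟩
    · rintro A B hAB ⟨s, h1, h2, ρ, h3, h4⟩
      exact ⟨s, h1, h2, ρ, h3, fun v hv => h4 v (hAB hv)⟩
    · rintro A B ⟨s, h1, h2, ρ, h3, h4⟩ ⟨s', h1', h2', ρ', h3', h4'⟩
      refine ⟨s ∪ s', h1.union h1', Set.union_subset h2 h2', min ρ ρ', lt_min h3 h3', ?_⟩
      rintro v (hv | hv) r hr m hm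
      · obtain ⟨F, hF, hmF⟩ := h4 v hv r ⟨hr.1, hr.2.trans_le (min_le_left _ _)⟩ m hm
        exact ⟨F, Or.inl hF, hmF⟩
      · obtain ⟨F, hF, hmF⟩ := h4' v hv r ⟨hr.1, hr.2.trans_le (min_le_right _ _)⟩ m hm
        exact ⟨F, Or.inr hF, hmF⟩
    · intro u hu
      have hmem : polarFilter lam γ u ∈ complFilters lam γ := Or.inr ⟨u, hu, rfl⟩
      obtain ⟨V, hV, hVW⟩ := mem_comap.1 (hW _ hmem)
      obtain ⟨ρ, hρ, hR⟩ := exists_rectangle (mem_map.1 hV)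
      refine ⟨Metric.ball u ρ ∩ {u | InContactPlane lam (γ 0) u ∧ ‖u‖ = 1},
        inter_mem (nhdsWithin_le_nhds (Metric.ball_mem_nhds u hρ)) self_mem_nhdsWithin,
        {polarFilter lam γ u}, Set.finite_singleton _, by simpa using hmem, ρ, hρ, ?_⟩
      intro v hv r hr m hm
      refine ⟨_, rfl, hVW ?_⟩
      rw [Set.mem_preimage, ← hm]
      exact hR r hr v ⟨hv.1, mem_contactSubmodule.2 hv.2.1⟩
  have hN := eventually_exists_polarPoint (lam := lam) hx hρ
  obtain ⟨N', hN'sub, hN'open, hγN'⟩ := mem_nhds_iff.1 (eventually_exists_flow_section h hx hN)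
  -- The times `t` cover a full period but start at `1`. After the correction by `τ ∈ [-1, 1]`, `t -
  -- τ` lies in `[0, T₀ + 2]`.
  set U : Set E4 := ⋃ t ∈ Set.Icc (1 : ℝ) (T₀ + 1), Φ (-t) ⁻¹' N' with hU
  have hUopen : IsOpen U := isOpen_biUnion fun t _ =>
    hN'open.preimage (h.continuous_flow.comp (Continuous.prodMk_right (-t)))
  have hγU : Set.range γ ⊆ U := by
    rintro _ ⟨s', rfl⟩
    obtain ⟨s, hs, hss⟩ := hγ.periodic.exists_mem_Ico hT s' 1
    refine Set.mem_biUnion (x := s) ⟨hs.1, by linarith [hs.2]⟩ ?_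
    rw [Set.mem_preimage, hss, ← hγ.eq_flow h s, ← h.flow_add, neg_add_cancel, h.flow.zero]
    exact hγN'
  have hcomp : IsCompact (S3 \ U) := (isCompact_sphere 0 1).diff hUopen
  obtain ⟨s₂, hs₂, hs₂G, hcov₂⟩ : ∃ s : Set (Filter ↥(S3 \ Set.range γ)), s.Finite ∧
      s ⊆ complFilters lam γ ∧ ∀ m : ↥(S3 \ Set.range γ), (m : E4) ∈ S3 \ U →
          ∃ F ∈ s, m ∈ W F := by
    refine hcomp.induction_on (p := fun K' => ∃ s : Set (Filter ↥(S3 \ Set.range γ)), s.Finite ∧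
      s ⊆ complFilters lam γ ∧ ∀ m : ↥(S3 \ Set.range γ), (m : E4) ∈ K' →
          ∃ F ∈ s, m ∈ W F) ?_ ?_ ?_ ?_
    · exact ⟨∅, Set.finite_empty, Set.empty_subset _, by simp⟩
    · rintro A B hAB ⟨s, h1, h2, h4⟩
      exact ⟨s, h1, h2, fun v hv => h4 v (hAB hv)⟩
    · rintro A B ⟨s, h1, h2, h4⟩ ⟨s', h1', h2', h4'⟩
      refine ⟨s ∪ s', h1.union h1', Set.union_subset h2 h2', ?_⟩
      rintro m (hm | hm)
      · obtain ⟨F, hF, hmF⟩ := h4 m hm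
        exact ⟨F, Or.inl hF, hmF⟩
      · obtain ⟨F, hF, hmF⟩ := h4' m hm
        exact ⟨F, Or.inr hF, hmF⟩
    · intro y hy
      let y' : ↥(S3 \ Set.range γ) := ⟨y, hy.1, fun hyγ => hy.2 (hγU hyγ)⟩
      have hmem : 𝓝 y' ∈ complFilters lam γ := Or.inl ⟨y', rfl⟩
      have hWy := hW _ hmem
      obtain ⟨V, hV, hVW⟩ := (mem_nhds_subtype _ _ _).1 hWy
      refine ⟨V, nhdsWithin_le_nhds hV, {𝓝 y'}, Set.finite_singleton _, by simpa using hmem, ?_⟩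
      intro m hm
      exact ⟨_, rfl, hVW hm⟩
  refine ⟨s₁ ∪ s₂, hs₁.union hs₂, Set.union_subset hs₁G hs₂G, fun m => ?_⟩
  by_cases hm : (m : E4) ∈ U
  · obtain ⟨t, ht, hmt⟩ := Set.mem_iUnion₂.1 hm
    obtain ⟨τ, hτ, hτN, hτ0⟩ := hN'sub hmt
    let m' := complFlow hγ h (τ - t) m
    have hm' : (m' : E4) = Φ τ (Φ (-t) m) := by
      rw [← h.flow_add, ← sub_eq_add_neg]; rfl
    rw [← hm'] at hτN hτ0
    obtain ⟨r, hr, v, hv, hv1, hrv⟩ := hτN m'.2.1 hτ0 fun he => m'.2.2 ⟨0, he.symm⟩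
    obtain ⟨F, hF, hmF⟩ := hcov v ⟨hv, hv1⟩ r hr m' hrv
    refine ⟨F, Or.inl hF, t - τ, ⟨by linarith [ht.1, hτ.2], by linarith [ht.2, hτ.1]⟩, m', hmF, ?_⟩
    rw [← (complFlow hγ h).map_add, sub_add_sub_cancel, sub_self, Flow.map_zero_apply]
  · obtain ⟨F, hF, hmF⟩ := hcov₂ m ⟨m.2.1, hm⟩
    exact ⟨F, Or.inr hF, 0, ⟨le_rfl, by linarith⟩, m, hmF, Flow.map_zero_apply _ _⟩

theorem isTransverseAt_of_mem_complFilters (hγ : IsPeriodicReebOrbit lam γ T₀)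
    (h : IsReebModel lam Y Φ K) (hlam : IsContactForm lam) (hf : IsDiskGSS lam γ f)
    (hs : IsBoundaryStrong lam f) (c : ℝ) (F : Filter ↥(S3 \ Set.range γ))
    (hF : F ∈ complFilters lam γ) : IsTransverseAt (complFlow hγ h) (pageOf γ f) c F := by
  obtain ⟨x, rfl⟩ | ⟨u, ⟨hu, hu1⟩, rfl⟩ := hF
  · exact isTransverseAt_nhds hγ h hf c x
  · exact isTransverseAt_polarFilter hγ h hlam hf hs c hu
      (norm_ne_zero_iff.1 (by rw [hu1]; exact one_ne_zero))

end CompactFamily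

/-! ### Angular variation along loops in the complement -/

section Winding

open scoped NNReal

theorem exp_mul_I_eq_circleExp (t : ℝ) :
    Complex.exp ((t : ℂ) * Complex.I) = (Circle.exp t : ℂ) := (Circle.coe_exp t).symm

theorem IsAngleLift.angleVariation_eq {z : ℝ → ℂ} {a b : ℝ} {F : ℝ → ℝ} (hab : a ≤ b)
    (hF : IsAngleLift z a b F) : angleVariation z a b = F b - F a := by
  have hex : ∃ F, IsAngleLift z a b F := ⟨F, hF⟩
  rw [angleVariation, dif_pos hex]
  obtain ⟨hc, hG⟩ := hex.choose_spec
  set G := hex.choose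
  let d : Set.Icc a b → ℝ := fun t => G t - F t
  have hd : Continuous d :=
    (continuousOn_iff_continuous_domRestrict.1 hc).sub (continuousOn_iff_continuous_domRestrict.1 hF.1)
  have hd1 : ∀ t, Circle.exp (d t) = 1 := fun t => by
    obtain ⟨hz, h1⟩ := hG t t.2
    obtain ⟨-, h2⟩ := hF.2 t t.2
    rw [Circle.exp_sub, div_eq_one]
    refine Circle.coe_injective ?_
    rw [← exp_mul_I_eq_circleExp, ← exp_mul_I_eq_circleExp]
    rw [h1] at h2
    have hn : (‖z t‖ : ℂ) ≠ 0 := by simpa using hz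
    rw [h1, ← h1] at h2
    exact mul_left_cancel₀ hn (h1.symm.trans (hF.2 t t.2).2)
  have : PreconnectedSpace (Set.Icc a b) := Subtype.preconnectedSpace isPreconnected_Icc
  have := Circle.isCoveringMap_exp.const_of_comp hd (fun s t => by rw [hd1, hd1])
    ⟨b, hab, le_rfl⟩ ⟨a, le_rfl, hab⟩
  simp only [d] at this
  linarith

/-- The normalisation of a nowhere vanishing continuous function. -/
def circleMapOf {M : Type*} [TopologicalSpace M] (θ : M → ℂ) (hθ : Continuous θ)
    (h0 : ∀ x, θ x ≠ 0) : C(M, Circle) where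
  toFun x := ⟨θ x / ‖θ x‖, by
    change θ x / ‖θ x‖ ∈ Metric.sphere (0 : ℂ) 1
    simp [h0 x]⟩
  continuous_toFun := Continuous.subtype_mk
    (hθ.div (by fun_prop) fun x => by simpa using h0 x) _

theorem norm_mul_circleMapOf {M : Type*} [TopologicalSpace M] {θ : M → ℂ} (hθ : Continuous θ)
    (h0 : ∀ x, θ x ≠ 0) (x : M) : θ x = (‖θ x‖ : ℂ) * circleMapOf θ hθ h0 x := by
  have : (‖θ x‖ : ℂ) ≠ 0 := by simpa using h0 x
  change θ x = ‖θ x‖ * (θ x / ‖θ x‖)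
  field_simp

variable {lam : E4 → E4 →L[ℝ] ℝ} {Y : E4 → E4} {Φ : ℝ → E4 → E4} {K : ℝ≥0} {f : ℂ → E4}
  {γ : ℝ → E4} {T₀ : ℝ} {θ : E4 → ℂ}

/-- The circle-valued map on the complement of `γ` underlying a Seifert class. -/
def seifertMap (hθ : IsSeifertClass lam γ θ) : C(↥(S3 \ Set.range γ), Circle) :=
  circleMapOf (fun x => θ x) (continuousOn_iff_continuous_domRestrict.1 hθ.1) fun x => hθ.2.1 x x.2

theorem isAngleLift_seifertMap (hθ : IsSeifertClass lam γ θ) {k : ℝ → E4} {a b : ℝ} {F : ℝ → ℝ}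
    (hk : ∀ t ∈ Set.Icc a b, k t ∈ S3 \ Set.range γ) (hF : ContinuousOn F (Set.Icc a b))
    (hexp : ∀ t (ht : t ∈ Set.Icc a b), Circle.exp (F t) = seifertMap hθ ⟨k t, hk t ht⟩) :
    IsAngleLift (fun t => θ (k t)) a b F := by
  refine ⟨hF, fun t ht => ⟨hθ.2.1 _ (hk t ht), ?_⟩⟩
  rw [exp_mul_I_eq_circleExp, hexp t ht]
  exact norm_mul_circleMapOf (θ := fun x : ↥(S3 \ Set.range γ) => θ x)
    (continuousOn_iff_continuous_domRestrict.1 hθ.1) (fun x => hθ.2.1 x x.2) ⟨k t, hk t ht⟩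

/-- A global argument has zero variation along any loop, whereas the Seifert class varies by `2π`
along a small meridian. -/
theorem not_exists_lift_seifertMap {Z₁ Z₂ : E4 → E4} (hγ : IsPeriodicReebOrbit lam γ T₀)
    (h : IsReebModel lam Y Φ K) (hσ : IsSymplecticFrame lam Z₁ Z₂)
    (hθ : IsSeifertClass lam γ θ) :
    ¬ ∃ P : C(↥(S3 \ Set.range γ), ℝ), ∀ x, Circle.exp (P x) = seifertMap hθ x := by
  rintro ⟨P, hP⟩
  have hx : γ 0 ∈ S3 := (hγ.trajectory 0).1
  have hm₁ := hσ.mem₁ _ hx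
  have hm₂ := hσ.mem₂ _ hx
  have hω := hσ.symplectic _ hx
  set e₁ := Z₁ (γ 0)
  set e₂ := Z₂ (γ 0)
  have hderiv : _root_.deriv γ 0 = Y (γ 0) := by
    rw [(hγ.trajectory 0).2.deriv, h.field _ hx]
  -- The meridian is taken in the contact plane with the symplectic frame: it is positive, and for
  -- small `ε` it avoids the whole orbit, so it lies in the domain of the argument.
  have hvol : contactVol lam (γ 0) (_root_.deriv γ 0) e₁ e₂ = 1 := by
    rw [contactVol, hderiv, hm₁.2, hm₂.2, (h.reeb _ hx).2.1, hω]
    ring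
  have hev := hθ.2.2 0 e₁ e₂ hm₁.1 hm₂.1 (by rw [hvol]; exact one_pos)
  have hcr : ContinuousAt radialProj (γ 0) :=
    (contDiffAt_radialProj (ne_zero_of_mem_S3 hx)).continuousAt
  have hgood : ∀ᶠ y in 𝓝 (γ 0), contactCoord lam (γ 0) (radialProj y) = 0 →
      radialProj y ∈ Set.range γ → radialProj y = γ 0 :=
    hcr.eventually (by rw [radialProj_of_mem hx]; exact hγ.eventually_eq h)
  obtain ⟨δ, hδ, hball⟩ := Metric.eventually_nhds_iff_ball.1 hgood
  have hsmall : ∀ᶠ ε : ℝ in 𝓝[>] 0, ε * (‖e₁‖ + ‖e₂‖) < δ := by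
    have : Tendsto (fun ε : ℝ => ε * (‖e₁‖ + ‖e₂‖)) (𝓝[>] 0) (𝓝 0) := by
      have h1 : Continuous fun ε : ℝ => ε * (‖e₁‖ + ‖e₂‖) := by fun_prop
      have h2 := h1.tendsto 0
      rw [zero_mul] at h2
      exact h2.mono_left nhdsWithin_le_nhds
    exact this.eventually_lt_const hδ
  obtain ⟨ε, hε1, hε2, hε3⟩ := (hev.and (hsmall.and self_mem_nhdsWithin)).exists
  have hε : 0 < ε := hε3
  let v : ℝ → E4 := fun s => Real.cos s • e₁ + Real.sin s • e₂
  have hv : ∀ s, InContactPlane lam (γ 0) (v s) := fun s => by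
    rw [← mem_contactSubmodule]
    exact add_mem (Submodule.smul_mem _ _ (mem_contactSubmodule.2 hm₁))
      (Submodule.smul_mem _ _ (mem_contactSubmodule.2 hm₂))
  have hv0 : ∀ s, v s ≠ 0 := fun s h0 => by
    have h1 : extD lam (γ 0) (v s) e₂ = Real.cos s := by
      simp only [v, extD_add_left, extD_smul_left, hω, extD_self]; ring
    have h2 : extD lam (γ 0) e₁ (v s) = Real.sin s := by
      simp only [v, extD_add_right, extD_smul_right, hω, extD_self]; ring
    rw [h0, extD_zero_left] at h1
    rw [h0, extD_swap, extD_zero_left, neg_zero] at h2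
    have := Real.sin_sq_add_cos_sq s
    rw [← h1, ← h2] at this
    norm_num at this
  have hmem : ∀ s, polarPoint (γ 0) (ε, v s) ∈ S3 \ Set.range γ := fun s => by
    refine ⟨polarPoint_mem_S3 hx (hv s).1 ε, fun hr => ?_⟩
    refine polarPoint_ne hx (hv s).1 (hv0 s) hε (hball _ ?_ (contactCoord_polarPoint hx (hv s) ε) hr)
    rw [Metric.mem_ball, dist_eq_norm, add_sub_cancel_left, norm_smul, Real.norm_eq_abs,
      abs_of_pos hε]
    refine lt_of_le_of_lt (mul_le_mul_of_nonneg_left ?_ hε.le) hε2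
    refine (norm_add_le _ _).trans (add_le_add ?_ ?_) <;> rw [norm_smul, Real.norm_eq_abs]
    · exact mul_le_of_le_one_left (norm_nonneg _) (Real.abs_cos_le_one s)
    · exact mul_le_of_le_one_left (norm_nonneg _) (Real.abs_sin_le_one s)
  have hcv : Continuous fun s => γ 0 + ε • v s := by simp only [v]; fun_prop
  have hcont : Continuous fun s => polarPoint (γ 0) (ε, v s) := by
    rw [continuous_iff_continuousAt]
    intro s
    exact ContinuousAt.comp (f := fun s => γ 0 + ε • v s)
      (contDiffAt_radialProj (add_smul_ne_zero hx (hv s).1 ε)).continuousAt hcv.continuousAt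
  have hlift := isAngleLift_seifertMap hθ (k := fun s => polarPoint (γ 0) (ε, v s)) (a := 0)
    (b := 2 * Real.pi) (F := fun s => P ⟨_, hmem s⟩) (fun s _ => hmem s)
    (P.continuous.comp (hcont.subtype_mk hmem)).continuousOn (fun s _ => hP _)
  have h2 := hlift.angleVariation_eq (by positivity)
  have hvv : v (2 * Real.pi) = v 0 := by simp [v]
  have h3 : angleVariation (fun s => θ (polarPoint (γ 0) (ε, v s))) 0 (2 * Real.pi) = 0 := by
    rw [h2]
    simp only [hvv, sub_self]
  have h4 : angleVariation (fun s => θ (polarPoint (γ 0) (ε, v s))) 0 (2 * Real.pi) =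
      2 * Real.pi := hε1
  rw [h3] at h4
  have := Real.pi_pos
  linarith

/-! ### The page of a disk -/

theorem mem_pageOf_iff (hf : IsDiskGSS lam γ f) {x : ↥(S3 \ Set.range γ)} :
    x ∈ pageOf γ f ↔ ∃ z ∈ Metric.ball (0 : ℂ) 1, f z = x := by
  constructor
  · rintro ⟨w, hw, hwt⟩
    refine ⟨w, ?_, hwt⟩
    rw [← Metric.ball_union_sphere] at hw
    exact hw.resolve_right fun hws => x.2.2 (hf.boundary.subset ⟨w, hws, hwt⟩)
  · rintro ⟨z, hz, hzx⟩
    exact ⟨z, Metric.ball_subset_closedBall hz, hzx⟩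

theorem IsDiskGSS.mem_compl (hf : IsDiskGSS lam γ f) {z : ℂ} (hz : z ∈ Metric.ball (0 : ℂ) 1) :
    f z ∈ S3 \ Set.range γ := by
  refine ⟨hf.embedded.mem_S3 (Metric.ball_subset_closedBall hz), fun hr => ?_⟩
  obtain ⟨w, hw, hwz⟩ := hf.boundary.superset hr
  have := hf.embedded.injOn (Metric.sphere_subset_closedBall hw)
    (Metric.ball_subset_closedBall hz) hwz
  rw [this] at hw
  exact (Metric.sphere_disjoint_ball (x := (0 : ℂ)) (ε := 1)).le_bot ⟨hw, hz⟩

/-- The open disk contracts radially, so lifting the homotopy `(s, z) ↦ ϑ (f (s z))` from the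
constant at `s = 0` gives an argument at `s = 1`. -/
theorem exists_isPage (hf : IsDiskGSS lam γ f) (ϑ : C(↥(S3 \ Set.range γ), Circle)) :
    ∃ η : ↥(S3 \ Set.range γ) → ℝ, IsPage ϑ (pageOf γ f) η := by
  have hcf := hf.embedded.smooth.continuous
  let j : Metric.ball (0 : ℂ) 1 → ↥(S3 \ Set.range γ) := fun z => ⟨f z, hf.mem_compl z.2⟩
  have hj : Continuous j := (hcf.comp continuous_subtype_val).subtype_mk _
  let m : unitInterval × Metric.ball (0 : ℂ) 1 → Metric.ball (0 : ℂ) 1 :=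
    fun p => ⟨(p.1 : ℝ) • (p.2 : ℂ), by
      have h1 := (mem_ball_zero_iff.1 p.2.2)
      rw [mem_ball_zero_iff, norm_smul, Real.norm_eq_abs, abs_of_nonneg p.1.2.1]
      exact (mul_le_of_le_one_left (norm_nonneg _) p.1.2.2).trans_lt h1⟩
  have hm : Continuous m := Continuous.subtype_mk (by fun_prop) _
  obtain ⟨α, hα⟩ := Circle.exp_surjective (ϑ (j ⟨0, Metric.mem_ball_self one_pos⟩))
  let H : C(unitInterval × Metric.ball (0 : ℂ) 1, Circle) :=
    ⟨fun p => ϑ (j (m p)), ϑ.continuous.comp (hj.comp hm)⟩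
  have H0 : ∀ a, H (0, a) = Circle.exp ((ContinuousMap.const _ α : C(Metric.ball (0 : ℂ) 1, ℝ)) a) := by
    intro a
    have : m (0, a) = ⟨0, Metric.mem_ball_self one_pos⟩ := Subtype.ext (by simp [m])
    simp only [H, ContinuousMap.coe_mk, this, ContinuousMap.const_apply, hα]
  let L := Circle.isCoveringMap_exp.liftHomotopy H _ H0
  have hL : ∀ p, Circle.exp (L p) = H p := fun p =>
    congr_fun (Circle.isCoveringMap_exp.liftHomotopy_lifts H _ H0) p
  let g : ↥(S3 \ Set.range γ) → ℂ := fun x => Function.invFunOn f (Metric.closedBall 0 1) x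
  have hg : ∀ x ∈ pageOf γ f, g x ∈ Metric.ball (0 : ℂ) 1 ∧ f (g x) = x := by
    intro x hx
    obtain ⟨z, hz, hzx⟩ := (mem_pageOf_iff hf).1 hx
    have hz' := Metric.ball_subset_closedBall hz
    have h1 : g x = z := by
      change Function.invFunOn f _ (x : E4) = z
      rw [← hzx]
      exact hf.embedded.injOn.leftInvOn_invFunOn hz'
    rw [h1]
    exact ⟨hz, hzx⟩
  have hgc : ∀ x ∈ pageOf γ f, Tendsto g (𝓝[pageOf γ f] x) (𝓝 (g x)) := by
    intro x hx N hN
    have h1 := hf.embedded.eventually_preimage_mem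
      (Metric.ball_subset_closedBall (hg x hx).1) hN
    rw [(hg x hx).2] at h1
    have h2 := (continuous_subtype_val.tendsto x).eventually h1
    change ∀ᶠ y in 𝓝[pageOf γ f] x, g y ∈ N
    filter_upwards [nhdsWithin_le_nhds h2, self_mem_nhdsWithin] with y hy hyp
    exact hy _ (Metric.ball_subset_closedBall (hg y hyp).1) (hg y hyp).2
  classical
  let η : ↥(S3 \ Set.range γ) → ℝ := fun x =>
    if hx : x ∈ pageOf γ f then L (1, ⟨g x, (hg x hx).1⟩) else 0
  have hηx : ∀ x (hx : x ∈ pageOf γ f), η x = L (1, ⟨g x, (hg x hx).1⟩) := fun x hx => dif_pos hx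
  refine ⟨η, hf.embedded.isCompact_diskImage.isClosed.preimage continuous_subtype_val, ?_, ?_, ?_⟩
  · have : pageOf γ f = Set.range j := by
      ext x
      rw [mem_pageOf_iff hf]
      constructor
      · rintro ⟨z, hz, hzx⟩
        exact ⟨⟨z, hz⟩, Subtype.ext hzx⟩
      · rintro ⟨z, rfl⟩
        exact ⟨z, z.2, rfl⟩
    rw [this]
    have : PreconnectedSpace (Metric.ball (0 : ℂ) 1) :=
      Subtype.preconnectedSpace (convex_ball (0 : ℂ) 1).isPreconnected
    exact isPreconnected_range hj
  · rw [continuousOn_iff_continuous_domRestrict]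
    have hc : Continuous fun x : pageOf γ f => (⟨g x, (hg x x.2).1⟩ : Metric.ball (0 : ℂ) 1) :=
      Continuous.subtype_mk (continuousOn_iff_continuous_domRestrict.1 fun x hx => hgc x hx) _
    have : (pageOf γ f).domRestrict η = fun x : pageOf γ f => L (1, ⟨g x, (hg x x.2).1⟩) :=
      funext fun x => hηx x x.2
    rw [this]
    exact L.continuous.comp (continuous_const.prodMk hc)
  · intro x hx
    rw [hηx x hx, hL]
    have h1 : m (1, ⟨g x, (hg x hx).1⟩) = ⟨g x, (hg x hx).1⟩ := Subtype.ext (by simp [m])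
    simp only [H, ContinuousMap.coe_mk, h1]
    exact congrArg ϑ (Subtype.ext (hg x hx).2)

/-! ### Closed-up trajectories and their linking numbers -/

/-- Finiteness of hits on bounded intervals shows that the supremum is attained. -/
theorem isGreatest_hitTimeNeg (hγ : IsPeriodicReebOrbit lam γ T₀) (h : IsReebModel lam Y Φ K)
    (hf : IsDiskGSS lam γ f) (x : ↥(S3 \ Set.range γ)) :
    IsGreatest {t | t ≤ 0 ∧ complFlow hγ h t x ∈ pageOf γ f}
      (hitTimeNeg lam (diskImage f) x) := by
  obtain ⟨t, ht, hit⟩ := hf.backward_hit _ x.2.1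
  rw [h.reebFlow_eq t x.2.1] at hit
  obtain ⟨a, ha⟩ := exists_isGreatest_hit (P := fun t => t ≤ 0) (m := 0)
    (finite_hits fun x => isTransverseAt_nhds hγ h hf 0 x) (fun t ht => ht)
    (⟨ht.le, hit⟩ : t ≤ 0 ∧ complFlow hγ h t x ∈ pageOf γ f)
  have : hitTimeNeg lam (diskImage f) x = a := by
    rw [hitTimeNeg, ← ha.csSup_eq]
    simp only [h.reebFlow_eq _ x.2.1]
    rfl
  rw [this]
  exact ha

theorem isLeast_closingTime (hγ : IsPeriodicReebOrbit lam γ T₀) (h : IsReebModel lam Y Φ K)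
    (hf : IsDiskGSS lam γ f) (T : ℝ) (x : ↥(S3 \ Set.range γ)) :
    IsLeast {t | T ≤ t ∧ complFlow hγ h t x ∈ pageOf γ f}
      (closingTime lam (diskImage f) T x) := by
  have hTS := h.flow_mem T x.2.1
  obtain ⟨t, ht, hit⟩ := hf.forward_hit _ hTS
  rw [h.reebFlow_eq t hTS, ← h.flow_add] at hit
  obtain ⟨b, hb⟩ := exists_isLeast_hit (P := fun t => T ≤ t) (m := T)
    (finite_hits fun x => isTransverseAt_nhds hγ h hf 0 x) (fun t ht => ht)
    (⟨by linarith, hit⟩ : T ≤ t + T ∧ complFlow hγ h (t + T) x ∈ pageOf γ f)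
  have hb' : IsLeast {t | 0 ≤ t ∧ Φ (t + T) x ∈ diskImage f} (b - T) := by
    refine ⟨⟨by linarith [hb.1.1], ?_⟩, fun t ht => ?_⟩
    · rw [sub_add_cancel]
      exact hb.1.2
    · have := hb.2 (⟨by linarith [ht.1], ht.2⟩ :
        t + T ∈ {t | T ≤ t ∧ complFlow hγ h t x ∈ pageOf γ f})
      linarith
  have : closingTime lam (diskImage f) T x = b := by
    rw [closingTime, hitTimePos, h.reebFlow_eq T x.2.1]
    simp only [h.reebFlow_eq _ hTS, ← h.flow_add]
    rw [hb'.csInf_eq]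
    ring
  rw [this]
  exact hb

theorem hitTimeNeg_le_closingTime (hγ : IsPeriodicReebOrbit lam γ T₀) (h : IsReebModel lam Y Φ K)
    (hf : IsDiskGSS lam γ f) {T : ℝ} (hT : 0 ≤ T) (x : ↥(S3 \ Set.range γ)) :
    hitTimeNeg lam (diskImage f) x ≤ closingTime lam (diskImage f) T x :=
  ((isGreatest_hitTimeNeg hγ h hf x).1.1.trans hT).trans (isLeast_closingTime hγ h hf T x).1.1

theorem continuousOn_Icc_of_glue {X : Type*} [TopologicalSpace X] {F F₁ F₂ : ℝ → X} {a b c : ℝ}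
    (hab : a ≤ b) (hbc : b ≤ c) (h₁ : ContinuousOn F₁ (Set.Icc a b))
    (h₂ : ContinuousOn F₂ (Set.Icc b c)) (e₁ : Set.EqOn F F₁ (Set.Icc a b))
    (e₂ : Set.EqOn F F₂ (Set.Icc b c)) : ContinuousOn F (Set.Icc a c) := by
  rw [← Set.Icc_union_Icc_eq_Icc hab hbc]
  exact (h₁.congr e₁).union_of_isClosed (h₂.congr e₂) isClosed_Icc isClosed_Icc

/-- The return path is the image of a straight segment in the open disk. Existence ensures that
every `x` and `u` contributes to the infimum in `kappa`. -/
theorem exists_isClosedUpTrajectory (hγ : IsPeriodicReebOrbit lam γ T₀)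
    (h : IsReebModel lam Y Φ K) (hf : IsDiskGSS lam γ f) {T : ℝ} (hT : 0 ≤ T)
    (x : ↥(S3 \ Set.range γ)) :
    ∃ k, IsClosedUpTrajectory lam γ (diskImage f) T x k := by
  have hab := hitTimeNeg_le_closingTime hγ h hf hT x
  obtain ⟨za, hza, hzax⟩ := (mem_pageOf_iff hf).1 (isGreatest_hitTimeNeg hγ h hf x).1.2
  obtain ⟨zb, hzb, hzbx⟩ := (mem_pageOf_iff hf).1 (isLeast_closingTime hγ h hf T x).1.2
  set a := hitTimeNeg lam (diskImage f) x with ha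
  set b := closingTime lam (diskImage f) T x with hb
  rw [coe_complFlow] at hzax hzbx
  let k₂ : ℝ → E4 := fun t => f (AffineMap.lineMap zb za (t - b))
  let k : ℝ → E4 := fun t => if t ≤ b then Φ t x else k₂ t
  have e₁ : Set.EqOn k (fun t => Φ t x) (Set.Icc a b) := fun t ht => if_pos ht.2
  have e₂ : Set.EqOn k k₂ (Set.Icc b (b + 1)) := by
    intro t ht
    rcases ht.1.eq_or_lt with rfl | hlt
    · simp [k, k₂, hzbx]
    · exact if_neg hlt.not_ge
  have hc₂ : Continuous k₂ := hf.embedded.smooth.continuous.comp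
    (AffineMap.lineMap_continuous.comp (continuous_id.sub continuous_const))
  refine ⟨k, ?_, ?_, ?_, ?_⟩
  · exact continuousOn_Icc_of_glue hab (by linarith) (h.flow.continuous_time x).continuousOn
      hc₂.continuousOn e₁ e₂
  · intro t ht
    rw [h.reebFlow_eq t x.2.1]
    exact e₁ ht
  · intro t ht
    rw [e₂ ht]
    have hz : AffineMap.lineMap zb za (t - b) ∈ Metric.ball (0 : ℂ) 1 :=
      (convex_ball (0 : ℂ) 1).lineMap_mem hzb hza ⟨by linarith [ht.1], by linarith [ht.2]⟩
    exact ⟨⟨_, Metric.ball_subset_closedBall hz, rfl⟩, (hf.mem_compl hz).2⟩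
  · rw [e₂ ⟨by linarith, le_rfl⟩, e₁ ⟨le_rfl, hab⟩]
    simp [k₂, hzax]

/-- Along the trajectory the argument changes by the flow variation, along the return path by the
change of `η`; the sum is minus the difference of lifted arguments. In particular the path chosen in
the disk does not matter. -/
theorem linkingNumber_closedUp (hγ : IsPeriodicReebOrbit lam γ T₀)
    (h : IsReebModel lam Y Φ K) (hf : IsDiskGSS lam γ f) (hex : ∃ θ, IsSeifertClass lam γ θ)
    {η : ↥(S3 \ Set.range γ) → ℝ} (hη : IsPage (seifertMap hex.choose_spec) (pageOf γ f) η)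
    {T : ℝ} (hT : 0 ≤ T) {x : ↥(S3 \ Set.range γ)} {k : ℝ → E4}
    (hk : IsClosedUpTrajectory lam γ (diskImage f) T x k) :
    linkingNumber lam γ k (hitTimeNeg lam (diskImage f) x)
        (closingTime lam (diskImage f) T x + 1) =
      -(liftedArg (complFlow hγ h) (seifertMap hex.choose_spec) η x
            (closingTime lam (diskImage f) T x) -
          liftedArg (complFlow hγ h) (seifertMap hex.choose_spec) η x
            (hitTimeNeg lam (diskImage f) x)) / (2 * Real.pi) := by
  have hab := hitTimeNeg_le_closingTime hγ h hf hT x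
  obtain ⟨hk1, hk2, hk3, hk4⟩ := hk
  set a := hitTimeNeg lam (diskImage f) x with ha
  set b := closingTime lam (diskImage f) T x with hb
  set ϑ := seifertMap hex.choose_spec with hϑ
  set φ := complFlow hγ h with hφ
  have hkφ : ∀ t ∈ Set.Icc a b, k t = φ t x := fun t ht => by
    rw [hk2 t ht, h.reebFlow_eq t x.2.1]; rfl
  have hkS : ∀ t ∈ Set.Icc b (b + 1), k t ∈ S3 \ Set.range γ := fun t ht => by
    obtain ⟨⟨z, hz, hzt⟩, h2⟩ := hk3 t ht
    exact ⟨by rw [← hzt]; exact hf.embedded.mem_S3 hz, h2⟩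
  have hkM : ∀ t ∈ Set.Icc a (b + 1), k t ∈ S3 \ Set.range γ := fun t ht => by
    rcases le_total t b with htb | htb
    · rw [hkφ t ⟨ht.1, htb⟩]; exact (φ t x).2
    · exact hkS t ⟨htb, ht.2⟩
  classical
  let ηk : ℝ → ℝ := fun t => if ht : k t ∈ S3 \ Set.range γ then η ⟨k t, ht⟩ else 0
  have hηk : ∀ t (ht : k t ∈ S3 \ Set.range γ), ηk t = η ⟨k t, ht⟩ := fun t ht => dif_pos ht
  obtain ⟨α, hα⟩ := Circle.exp_surjective (ϑ x)
  have hbk : k b = φ b x := hkφ b ⟨hab, le_rfl⟩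
  have hηb : ηk b = η (φ b x) := by
    rw [hηk b (hkM b ⟨hab, by linarith⟩)]
    exact congrArg η (Subtype.ext hbk)
  let F₁ : ℝ → ℝ := fun t => α + flowVariation φ ϑ (x, t)
  let F₂ : ℝ → ℝ := fun t => α + flowVariation φ ϑ (x, b) + (ηk t - η (φ b x))
  let F : ℝ → ℝ := fun t => if t ≤ b then F₁ t else F₂ t
  have e₁ : Set.EqOn F F₁ (Set.Icc a b) := fun t ht => if_pos ht.2
  have e₂ : Set.EqOn F F₂ (Set.Icc b (b + 1)) := by
    intro t ht
    rcases ht.1.eq_or_lt with rfl | hlt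
    · simp [F, F₁, F₂, hηb]
    · exact if_neg hlt.not_ge
  have hx₁ : ∀ t, Circle.exp (F₁ t) = ϑ (φ t x) := fun t => by
    rw [Circle.exp_add, exp_flowVariation, hα, mul_div_cancel]
  have hpb : φ b x ∈ pageOf γ f := (isLeast_closingTime hγ h hf T x).1.2
  have hlift : IsAngleLift (fun t => hex.choose (k t)) a (b + 1) F := by
    refine isAngleLift_seifertMap hex.choose_spec hkM
      (continuousOn_Icc_of_glue hab (by linarith) ?_ ?_ e₁ e₂) ?_
    · exact Continuous.continuousOn (by simp only [F₁]; fun_prop)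
    · refine continuousOn_const.add (ContinuousOn.sub ?_ continuousOn_const)
      have hc : ContinuousOn k (Set.Icc b (b + 1)) := hk1.mono (Set.Icc_subset_Icc_left hab)
      rw [continuousOn_iff_continuous_domRestrict] at hc ⊢
      have h1 : Continuous fun t : Set.Icc b (b + 1) =>
          (⟨⟨k t, hkS t t.2⟩, (hk3 t t.2).1⟩ : pageOf γ f) :=
        Continuous.subtype_mk (Continuous.subtype_mk hc _) _
      have h2 := (continuousOn_iff_continuous_domRestrict.1 hη.continuousOn).comp h1
      convert h2 using 1
      funext t
      exact hηk t (hkS t t.2)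
    · intro t ht
      rcases le_total t b with htb | htb
      · rw [e₁ ⟨ht.1, htb⟩, hx₁]
        exact congrArg ϑ (Subtype.ext (hkφ t ⟨ht.1, htb⟩).symm)
      · rw [e₂ ⟨htb, ht.2⟩]
        have h1 := hx₁ b
        simp only [F₁] at h1
        simp only [F₂]
        rw [Circle.exp_add, Circle.exp_sub, h1, hη.exp_eq _ hpb, hηk t (hkM t ht), hη.exp_eq _
          (show (⟨k t, hkM t ht⟩ : ↥(S3 \ Set.range γ)) ∈ pageOf γ f from
            (hk3 t ⟨htb, ht.2⟩).1), mul_div_cancel]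
  rw [linkingNumber, dif_pos hex, hlift.angleVariation_eq (by linarith),
    e₁ ⟨le_rfl, hab⟩, e₂ ⟨by linarith, le_rfl⟩]
  have hηa : ηk (b + 1) = η (φ a x) := by
    rw [hηk (b + 1) (hkM _ ⟨by linarith, le_rfl⟩)]
    exact congrArg η (Subtype.ext (hk4.trans (hkφ a ⟨le_rfl, hab⟩)))
  simp only [F₁, F₂, hηa, liftedArg]
  ring

end Winding

/-! ### Comparison of the limits -/

section Comparison

open scoped NNReal

/-- `N / L` equals `N / L'` times a factor uniformly close to `1`, for either sign of `N`. Working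
with real numbers strictly above the right-hand limit avoids any case distinction for infinite
values. -/
theorem liminf_sInf_div_le {ι : Type*} {V : Set ι} {N L L' : ℝ → ι → ℝ}
    (hq : ∀ ε > 0, ∀ᶠ T in atTop, ∀ p ∈ V, L T p ≠ 0 ∧ L' T p ≠ 0 ∧
      |L' T p / L T p - 1| ≤ ε) :
    liminf (fun T : ℝ => sInf {r : EReal | ∃ p ∈ V, r = ((N T p / L T p : ℝ) : EReal)}) atTop ≤
      liminf (fun T : ℝ => sInf {r : EReal | ∃ p ∈ V, r = ((N T p / L' T p : ℝ) : EReal)}) atTop := by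
  refine le_of_forall_gt_imp_ge_of_dense fun b hb => ?_
  obtain ⟨a, ha1, ha2⟩ := EReal.lt_iff_exists_real_btwn.1 hb
  obtain ⟨b', hb1, hb2⟩ := EReal.lt_iff_exists_real_btwn.1 ha2
  refine le_trans ?_ hb2.le
  have hab : a < b' := EReal.coe_lt_coe_iff.1 hb1
  -- `1 / 2` keeps the factor `q` positive; the other bound makes `a * q ≤ b'`.
  have hpos : 0 < min (1 / 2) ((b' - a) / (|a| + 1)) :=
    lt_min (by norm_num) (div_pos (by linarith) (by positivity))
  refine liminf_le_of_frequently_le ?_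
  refine ((frequently_lt_of_liminf_lt (by isBoundedDefault) ha1).and_eventually (hq _ hpos)).mono ?_
  rintro T ⟨hT, hqT⟩
  obtain ⟨_, ⟨p, hp, rfl⟩, hlt⟩ := sInf_lt_iff.1 hT
  obtain ⟨hL, hL', hle⟩ := hqT p hp
  refine sInf_le_of_le (Set.mem_ofPred.2 ⟨p, hp, rfl⟩) (EReal.coe_le_coe_iff.2 ?_)
  have hlt' : N T p / L' T p < a := EReal.coe_lt_coe_iff.1 hlt
  set q := L' T p / L T p with hqdef
  have h1 := abs_le.1 (hle.trans (min_le_left _ _))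
  have hq0 : 0 < q := by linarith
  have h2 : N T p / L T p = N T p / L' T p * q := by
    rw [hqdef]; field_simp
  rw [h2]
  have h3 : N T p / L' T p * q ≤ a * q := mul_le_mul_of_nonneg_right hlt'.le hq0.le
  have h4 : |a * (q - 1)| ≤ b' - a := by
    rw [abs_mul]
    have h5 := hle.trans (min_le_right _ _)
    rw [le_div_iff₀ (by positivity)] at h5
    nlinarith [abs_nonneg a, abs_nonneg (q - 1)]
  linarith [le_abs_self (a * (q - 1))]

variable {lam : E4 → E4 →L[ℝ] ℝ} {Y : E4 → E4} {Φ : ℝ → E4 → E4} {K : ℝ≥0} {f g : ℂ → E4}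
  {γ : ℝ → E4} {T₀ : ℝ} {Z₁ Z₂ : E4 → E4}

/-- The variation of the lifted argument along the closed-up trajectory of `x`, up to sign. -/
def lengthOf (hγ : IsPeriodicReebOrbit lam γ T₀) (h : IsReebModel lam Y Φ K)
    (ϑ : C(↥(S3 \ Set.range γ), Circle)) (f : ℂ → E4) (η : ↥(S3 \ Set.range γ) → ℝ) (T : ℝ)
    (x : ↥(S3 \ Set.range γ)) : ℝ :=
  liftedArg (complFlow hγ h) ϑ η x (closingTime lam (diskImage f) T x) -
    liftedArg (complFlow hγ h) ϑ η x (hitTimeNeg lam (diskImage f) x)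

/-- This removes the loop from the infimum, so that both disks give infima over the same index set
with the same numerators. Only `T ≥ 0` matters in the limit. -/
theorem kappa_eq_liminf (hγ : IsPeriodicReebOrbit lam γ T₀)
    (h : IsReebModel lam Y Φ K) (hf : IsDiskGSS lam γ f) (hex : ∃ θ, IsSeifertClass lam γ θ)
    {η : ↥(S3 \ Set.range γ) → ℝ} (hη : IsPage (seifertMap hex.choose_spec) (pageOf γ f) η) :
    kappa lam γ Z₁ Z₂ (diskImage f) =
      liminf (fun T : ℝ => sInf {r : EReal |
        ∃ p ∈ {p : ↥(S3 \ Set.range γ) × E4 | InContactPlane lam p.1 p.2 ∧ p.2 ≠ 0},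
          r = ((angleVariation (fun t => frameCoord lam Z₁ Z₂ (reebFlow lam t p.1)
              (linReebFlow lam t p.1 p.2)) 0 T /
            (-lengthOf hγ h (seifertMap hex.choose_spec) f η T p.1 / (2 * Real.pi)) : ℝ) : EReal)})
        atTop := by
  refine liminf_congr ?_
  filter_upwards [eventually_ge_atTop 0] with T hT
  congr 1
  ext r
  constructor
  · rintro ⟨x, u, k, hx, hu, hu0, hk, rfl⟩
    refine ⟨(⟨x, hx⟩, u), ⟨hu, hu0⟩, ?_⟩
    rw [linkingNumber_closedUp hγ h hf hex hη hT (x := ⟨x, hx⟩) hk]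
    rfl
  · rintro ⟨⟨x, u⟩, ⟨hu, hu0⟩, rfl⟩
    obtain ⟨k, hk⟩ := exists_isClosedUpTrajectory hγ h hf hT x
    refine ⟨x, u, k, x.2, hu, hu0, hk, ?_⟩
    rw [linkingNumber_closedUp hγ h hf hex hη hT hk]
    rfl

theorem kappa_le (hlam : IsContactForm lam) (hγ : IsPeriodicReebOrbit lam γ T₀)
    (hex : ∃ θ, IsSeifertClass lam γ θ) (hσ : IsSymplecticFrame lam Z₁ Z₂)
    (hf : IsDiskGSS lam γ f) (hfs : IsBoundaryStrong lam f)
    (hg : IsDiskGSS lam γ g) (hgs : IsBoundaryStrong lam g) :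
    kappa lam γ Z₁ Z₂ (diskImage f) ≤ kappa lam γ Z₁ Z₂ (diskImage g) := by
  obtain ⟨Y, Φ, K, h⟩ := exists_isReebModel hσ hlam
  obtain ⟨η, hη⟩ := exists_isPage hf (seifertMap hex.choose_spec)
  obtain ⟨η', hη'⟩ := exists_isPage hg (seifertMap hex.choose_spec)
  have hG := isCompactFamily_complFilters hγ h
  have hTf := isTransverseAt_of_mem_complFilters hγ h hlam hf hfs (T₀ + 2)
  have hTg := isTransverseAt_of_mem_complFilters hγ h hlam hg hgs (T₀ + 2)
  have hno := not_exists_lift_seifertMap hγ h hσ hex.choose_spec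
  obtain ⟨C, hC⟩ := exists_winding_bound hG hη' hη hTg hTf
  obtain ⟨κ, hκ, hgrow⟩ := exists_winding_growth hG hη hTf hno
  obtain ⟨κ', hκ', hgrow'⟩ := exists_winding_growth hG hη' hTg hno
  rw [kappa_eq_liminf hγ h hf hex hη, kappa_eq_liminf hγ h hg hex hη']
  refine liminf_sInf_div_le fun ε hε => ?_
  -- The relative error is at most `C / (κ * T)`, a bound independent of `x` and `u`.
  filter_upwards [eventually_gt_atTop 0, eventually_ge_atTop (C / (κ * ε))] with T hT0 hTC
  rintro ⟨x, u⟩ -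
  have b₁ := hgrow x T _ _ hT0.le (isGreatest_hitTimeNeg hγ h hf x) (isLeast_closingTime hγ h hf T x)
  have b₂ := hgrow' x T _ _ hT0.le (isGreatest_hitTimeNeg hγ h hg x)
    (isLeast_closingTime hγ h hg T x)
  have b₃ := hC x T _ _ _ _ (isGreatest_hitTimeNeg hγ h hg x) (isLeast_closingTime hγ h hg T x)
    (isGreatest_hitTimeNeg hγ h hf x) (isLeast_closingTime hγ h hf T x)
  change κ * T ≤ |lengthOf hγ h (seifertMap hex.choose_spec) f η T x| at b₁
  change κ' * T ≤ |lengthOf hγ h (seifertMap hex.choose_spec) g η' T x| at b₂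
  change |lengthOf hγ h (seifertMap hex.choose_spec) g η' T x -
    lengthOf hγ h (seifertMap hex.choose_spec) f η T x| ≤ C at b₃
  set l := lengthOf hγ h (seifertMap hex.choose_spec) f η T x
  set l' := lengthOf hγ h (seifertMap hex.choose_spec) g η' T x
  have hl : l ≠ 0 := abs_pos.1 ((mul_pos hκ hT0).trans_le b₁)
  have hl' : l' ≠ 0 := abs_pos.1 ((mul_pos hκ' hT0).trans_le b₂)
  have hπ := Real.pi_pos
  refine ⟨div_ne_zero (neg_ne_zero.2 hl) (by positivity), div_ne_zero (neg_ne_zero.2 hl') (by positivity), ?_⟩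
  have h1 : -l' / (2 * Real.pi) / (-l / (2 * Real.pi)) - 1 = (l' - l) / l := by
    field_simp
  rw [h1, abs_div, div_le_iff₀ (abs_pos.2 hl)]
  rw [div_le_iff₀ (by positivity)] at hTC
  calc |l' - l| ≤ C := b₃
    _ ≤ T * (κ * ε) := hTC
    _ = ε * (κ * T) := by ring
    _ ≤ ε * |l| := mul_le_mul_of_nonneg_left b₁ hε.le

end Comparison

end

theorem mainTheorem7
    (lam : E4 → E4 →L[ℝ] ℝ) (hlam : IsContactForm lam)
    (γ₀ : ℝ → E4) (T₀ : ℝ) (hγ₀ : IsPeriodicReebOrbit lam γ₀ T₀)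
    (hunknotted : IsUnknotted γ₀)
    (hself : HasSelfLinkingNumber lam γ₀ T₀ (-1))
    (Z₁ Z₂ : E4 → E4) (hσ : IsSymplecticFrame lam Z₁ Z₂)
    (f g : ℂ → E4)
    (hf : IsDiskGSS lam γ₀ f) (hf_strong : IsBoundaryStrong lam f)
    (hg : IsDiskGSS lam γ₀ g) (hg_strong : IsBoundaryStrong lam g) :
    kappa lam γ₀ Z₁ Z₂ (diskImage f) = kappa lam γ₀ Z₁ Z₂ (diskImage g) := by
  -- Without a Seifert class `linkingNumber` takes its default value `0`, which contradicts the
  -- self-linking number `-1`.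
  have hex : ∃ θ, IsSeifertClass lam γ₀ θ := by
    by_contra hcon
    obtain ⟨Z, -, -, hZ⟩ := hself
    obtain ⟨ε, hε⟩ := hZ.exists
    rw [linkingNumber, dif_neg hcon] at hε
    norm_num at hε
  exact le_antisymm (kappa_le hlam hγ₀ hex hσ hf hf_strong hg hg_strong)
    (kappa_le hlam hγ₀ hex hσ hg hg_strong hf hf_strong)
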